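/- Let $X$ be a complex manifold of dimension $n$ and let $E\to X$ be a holomorphic vector bundle of rank $r$. A \emph{singular Hermitian metric} $h$ on a holomorphic vector bundle $W\to X$ is a family of semi-positive, possibly infinite, Hermitian forms on the fibres, with Lebesgue measurable coefficients $h(s,t)$ ($s,t$ local holomorphic sections), such that $h_x$ is finite and positive definite (that is, $0<\det h_x<+\infty$ in a frame) for almost every $x\in X$; it is defined up to modification on null sets. It is \emph{semi-negatively curved} if, for a suitable (then unique) everywhere defined representative with values in the finite semi-positive Hermitian forms, the function $x\mapsto \log|v|^2_{h,x}\in[-\infty,\infty)$ is plurisubharmonic on $U$ for every open $U\subset X$ and every holomorphic section $v$ of $W$ over $U$ (the function $\equiv-\infty$ being allowed). It is \emph{(semi-)positively curved} if the dual metric $h^\star={}^th^{-1}$ on $W^\star$ is semi-negatively curved. Let $h$ be a positively curved singular Hermitian metric on $E$. Then: (1) For every $m\ge 0$, the induced metric on $\mathrm{Sym}^mE$, given by $\langle u_1\cdots u_m, v_1\cdots v_m\rangle=\sum_{\sigma\in S_m}\prod_{i}h(u_{\sigma(i)},v_i)$, is a singular Hermitian metric and is positively curved. (2) For every $q\ge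 0$, the induced metric on $\Lambda^qE$, given by $\langle u_1\wedge\dots\wedge u_q, v_1\wedge\dots\wedge v_q\rangle=\det\big(h(u_i,v_j)\big)_{i,j}$, is a singular Hermitian metric and is positively curved. (3) In particular, the metric $\det h$ induced on the line bundle $\det E=\Lambda^rE$ has positive curvature current: for every nowhere vanishing holomorphic section $s$ of $\det E$ over an open set $U\subset X$, the local weight $\varphi=-\log|s|^2_{\det h}$ is locally integrable on $U$ in holomorphic coordinates $z$, and the current $\frac{\sqrt{-1}}{\pi}\partial\overline\partial\varphi$ is positive, i.e. for every $w\in\mathbb C^n$ the distribution $\sum_{j,k}\frac{\partial^2\varphi}{\partial z_j\partial\bar z_k}w_j\bar w_k$ is nonnegative. -/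

import Mathlib

open MeasureTheory Bundle TensorProduct
open scoped Manifold ContDiff Topology ComplexConjugate

noncomputable section

/-! ### Hermitian forms, and the forms induced on the dual, exterior and symmetric powers -/

/-- Sesquilinear forms `h(u, v)`, linear in `u` and conjugate-linear in `v`. -/
abbrev SesqForm (V : Type*) [AddCommMonoid V] [Module ℂ V] : Type _ := V →ₗ[ℂ] V →ₗ⋆[ℂ] ℂ

section LinearAlgebra

variable {V : Type*} [AddCommGroup V] [Module ℂ V]

/-- A semi-positive (finite) Hermitian form. -/
structure IsPosSemidefForm (h : SesqForm V) : Prop where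
  conj_symm : ∀ u v, conj (h u v) = h v u
  nonneg : ∀ v, 0 ≤ (h v v).re

/-- A positive definite Hermitian form. -/
structure IsPosDefForm (h : SesqForm V) : Prop where
  conj_symm : ∀ u v, conj (h u v) = h v u
  pos : ∀ v, v ≠ 0 → 0 < (h v v).re

/-- The conjugate of a linear functional. -/
def conjFunctional (f : V →ₗ[ℂ] ℂ) : V →ₗ⋆[ℂ] ℂ where
  toFun v := conj (f v)
  map_add' u v := by simp
  map_smul' c v := by simp

/-- The conjugate of a conjugate-linear functional. -/
def conjFunctional' (f : V →ₗ⋆[ℂ] ℂ) : V →ₗ[ℂ] ℂ where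
  toFun v := conj (f v)
  map_add' u v := by simp
  map_smul' c v := by simp

open Classical in
/-- The dual form on `V*`. A positive definite form `h` on a finite-dimensional space gives the
conjugate-linear bijection `w ↦ h(·, w)` from `V` to `V*`; with `ξ = h(·, a)` and `η = h(·, b)` one
has `h*(ξ, η) = h(b, a) = ξ(b)`. In a basis the matrix of `h*` is the transposed inverse of that of
`h`. Where `h` is degenerate the value is set to `0`. -/
def dualForm (h : SesqForm V) : SesqForm (Module.Dual ℂ V) :=
  if hb : Function.Bijective h.flip then
    LinearMap.mk₂'ₛₗ (RingHom.id ℂ) (starRingEnd ℂ)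
      (fun ξ η => ξ ((LinearEquiv.ofBijective h.flip hb).symm η))
      (fun _ _ _ => by simp) (fun _ _ _ => by simp) (fun _ _ _ => by simp)
      (fun _ _ _ => by rw [LinearEquiv.map_smulₛₗ]; simp)
  else 0

theorem dualForm_flip (h : SesqForm V) (hb : Function.Bijective h.flip) (a b : V) :
    dualForm h (h.flip a) (h.flip b) = h b a := by
  have : (LinearEquiv.ofBijective h.flip hb).symm (h.flip b) = b := by
    rw [LinearEquiv.symm_apply_eq]; rfl
  simp [dualForm, hb, this]

theorem extForm_aux {q : ℕ} {f g : (⋀[ℂ]^q V) →ₗ⋆[ℂ] ℂ}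
    (H : ∀ v : Fin q → V, f (exteriorPower.ιMulti ℂ q v) = g (exteriorPower.ιMulti ℂ q v)) :
    f = g := by
  have hspan := exteriorPower.ιMulti_span ℂ q V
  refine LinearMap.ext fun x => ?_
  have hx : x ∈ Submodule.span ℂ (Set.range (exteriorPower.ιMulti ℂ q (M := V))) := by
    rw [hspan]; trivial
  induction hx using Submodule.span_induction with
  | mem x hx => obtain ⟨v, rfl⟩ := hx; exact H v
  | zero => simp
  | add x y _ _ hx hy => rw [map_add, map_add, hx, hy]
  | smul c x _ hx => rw [LinearMap.map_smulₛₗ, LinearMap.map_smulₛₗ, hx]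

/-- The functional `⟨u₁ ∧ … ∧ u_q, ·⟩` on the exterior power. -/
def extFunctional (q : ℕ) (h : SesqForm V) (u : Fin q → V) : (⋀[ℂ]^q V) →ₗ⋆[ℂ] ℂ :=
  conjFunctional (exteriorPower.alternatingMapToDual ℂ V q fun i => conjFunctional' (h (u i)))

theorem extFunctional_ιMulti (q : ℕ) (h : SesqForm V) (u v : Fin q → V) :
    extFunctional q h u (exteriorPower.ιMulti ℂ q v) =
      Matrix.det (Matrix.of fun i j => h (u i) (v j)) := by
  simp only [extFunctional, conjFunctional, conjFunctional', LinearMap.coe_mk, AddHom.coe_mk,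
    exteriorPower.alternatingMapToDual_apply_ιMulti]
  rw [RingHom.map_det, ← Matrix.det_transpose]
  congr 1
  ext i j
  simp

/-- The form induced on the `q`-th exterior power: the one with
`⟨u₁ ∧ … ∧ u_q, v₁ ∧ … ∧ v_q⟩ = det (h (u_i, v_j))`, see `extForm_ιMulti`. -/
def extForm (q : ℕ) (h : SesqForm V) : SesqForm (⋀[ℂ]^q V) :=
  exteriorPower.alternatingMapLinearEquiv
    { toFun := extFunctional q h
      map_update_add' := by
        intro inst u i x y
        obtain rfl := Subsingleton.elim inst (instDecidableEqFin q)
        refine extForm_aux fun v => ?_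
        simp only [LinearMap.add_apply, extFunctional_ιMulti]
        have key : ∀ w : V, (Matrix.of fun k j => h (Function.update u i w k) (v j)) =
            (Matrix.of fun k j => h (u k) (v j)).updateRow i fun j => h w (v j) := by
          intro w
          ext k j
          by_cases hk : k = i
          · subst hk; simp
          · simp [hk]
        rw [key, key, key, ← Matrix.det_updateRow_add]
        congr 2
        funext j
        simp
      map_update_smul' := by
        intro inst u i c x
        obtain rfl := Subsingleton.elim inst (instDecidableEqFin q)
        refine extForm_aux fun v => ?_
        simp only [LinearMap.smul_apply, extFunctional_ιMulti]
        have key : ∀ w : V, (Matrix.of fun k j => h (Function.update u i w k) (v j)) =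
            (Matrix.of fun k j => h (u k) (v j)).updateRow i fun j => h w (v j) := by
          intro w
          ext k j
          by_cases hk : k = i
          · subst hk; simp
          · simp [hk]
        rw [key, key, smul_eq_mul, ← Matrix.det_updateRow_smul]
        congr 2
        funext j
        simp
      map_eq_zero_of_eq' := by
        intro u i j hij hne
        refine extForm_aux fun v => ?_
        rw [extFunctional_ιMulti, LinearMap.zero_apply]
        exact Matrix.det_zero_of_row_eq hne (by funext k; simp [hij]) }

theorem extForm_ιMulti (q : ℕ) (h : SesqForm V) (u v : Fin q → V) :
    extForm q h (exteriorPower.ιMulti ℂ q u) (exteriorPower.ιMulti ℂ q v) =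
      Matrix.det (Matrix.of fun i j => h (u i) (v j)) := by
  rw [extForm, exteriorPower.alternatingMapLinearEquiv_apply_ιMulti]
  exact extFunctional_ιMulti q h u v

/-- The linear map on the symmetric power given by a symmetric multilinear map. -/
def symLift {m : ℕ} {N : Type*} [AddCommMonoid N] [Module ℂ N]
    (f : MultilinearMap ℂ (fun _ : Fin m => V) N)
    (hf : ∀ (e : Equiv.Perm (Fin m)) (v : Fin m → V), f (fun i => v (e i)) = f v) :
    Sym[ℂ]^m V →ₗ[ℂ] N where
  toFun := AddCon.lift (addConGen (SymmetricPower.Rel ℂ (Fin m) V))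
    (PiTensorProduct.lift f).toAddMonoidHom (by
      refine AddCon.addConGen_le.2 ?_
      rintro _ _ ⟨e, v⟩
      simp [AddCon.ker_rel, hf])
  map_add' := map_add _
  map_smul' := by
    intro c x
    induction x using AddCon.induction_on with
    | H x => exact (PiTensorProduct.lift f).map_smul c x

theorem symLift_tprod {m : ℕ} {N : Type*} [AddCommMonoid N] [Module ℂ N]
    (f : MultilinearMap ℂ (fun _ : Fin m => V) N)
    (hf : ∀ (e : Equiv.Perm (Fin m)) (v : Fin m → V), f (fun i => v (e i)) = f v)
    (v : Fin m → V) : symLift f hf (SymmetricPower.tprod ℂ v) = f v :=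
  PiTensorProduct.lift.tprod v

theorem symForm_aux {m : ℕ} {f g : (Sym[ℂ]^m V) →ₗ⋆[ℂ] ℂ}
    (H : ∀ v : Fin m → V, f (SymmetricPower.tprod ℂ v) = g (SymmetricPower.tprod ℂ v)) :
    f = g := by
  refine LinearMap.ext fun x => ?_
  have hx : x ∈ Submodule.span ℂ
      (Set.range (SymmetricPower.tprod ℂ (ι := Fin m) (M := V))) := by
    rw [SymmetricPower.span_tprod_eq_top]; trivial
  induction hx using Submodule.span_induction with
  | mem x hx => obtain ⟨v, rfl⟩ := hx; exact H v
  | zero => simp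
  | add x y _ _ hx hy => rw [map_add, map_add, hx, hy]
  | smul c x _ hx => rw [LinearMap.map_smulₛₗ, LinearMap.map_smulₛₗ, hx]

/-- The functional `⟨u₁ ⋯ u_m, ·⟩` on the symmetric power. -/
def symFunctional (m : ℕ) (h : SesqForm V) (u : Fin m → V) : (Sym[ℂ]^m V) →ₗ⋆[ℂ] ℂ :=
  conjFunctional (symLift
    (∑ σ : Equiv.Perm (Fin m), (MultilinearMap.mkPiAlgebra ℂ (Fin m) ℂ).compLinearMap
      fun i => conjFunctional' (h (u (σ i))))
    (by
      intro e v
      simp only [sum_apply, MultilinearMap.compLinearMap_apply,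
        MultilinearMap.mkPiAlgebra_apply]
      refine Fintype.sum_equiv (Equiv.mulRight e⁻¹) _ _ fun σ => ?_
      refine Fintype.prod_equiv e _ _ fun i => ?_
      simp))

theorem symFunctional_tprod (m : ℕ) (h : SesqForm V) (u v : Fin m → V) :
    symFunctional m h u (SymmetricPower.tprod ℂ v) =
      ∑ σ : Equiv.Perm (Fin m), ∏ i, h (u (σ i)) (v i) := by
  simp [symFunctional, conjFunctional, conjFunctional', symLift_tprod]

/-- The form induced on the `m`-th symmetric power: the one with
`⟨u₁ ⋯ u_m, v₁ ⋯ v_m⟩ = ∑_σ ∏_i h (u_{σ(i)}, v_i)`, see `symForm_tprod`. -/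
def symForm (m : ℕ) (h : SesqForm V) : SesqForm (Sym[ℂ]^m V) :=
  symLift
    { toFun := symFunctional m h
      map_update_add' := by
        intro inst u i x y
        obtain rfl := Subsingleton.elim inst (instDecidableEqFin m)
        refine symForm_aux fun v => ?_
        simp only [LinearMap.add_apply, symFunctional_tprod, ← Finset.sum_add_distrib]
        refine Finset.sum_congr rfl fun σ _ => ?_
        have key : ∀ w : V, ∏ k, h (Function.update u i w (σ k)) (v k) =
            h w (v (σ.symm i)) * ∏ k ∈ Finset.univ.erase (σ.symm i), h (u (σ k)) (v k) := by
          intro w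
          rw [← Finset.mul_prod_erase _ _ (Finset.mem_univ (σ.symm i))]
          simp only [Equiv.apply_symm_apply, Function.update_self]
          congr 1
          refine Finset.prod_congr rfl fun k hk => ?_
          have : σ k ≠ i := fun hki => (Finset.mem_erase.1 hk).1 (by simp [← hki])
          simp [this]
        simp [key, add_mul]
      map_update_smul' := by
        intro inst u i c x
        obtain rfl := Subsingleton.elim inst (instDecidableEqFin m)
        refine symForm_aux fun v => ?_
        simp only [LinearMap.smul_apply, symFunctional_tprod, Finset.smul_sum]
        refine Finset.sum_congr rfl fun σ _ => ?_
        have key : ∀ w : V, ∏ k, h (Function.update u i w (σ k)) (v k) =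
            h w (v (σ.symm i)) * ∏ k ∈ Finset.univ.erase (σ.symm i), h (u (σ k)) (v k) := by
          intro w
          rw [← Finset.mul_prod_erase _ _ (Finset.mem_univ (σ.symm i))]
          simp only [Equiv.apply_symm_apply, Function.update_self]
          congr 1
          refine Finset.prod_congr rfl fun k hk => ?_
          have : σ k ≠ i := fun hki => (Finset.mem_erase.1 hk).1 (by simp [← hki])
          simp [this]
        simp [key, mul_assoc] }
    (by
      intro e u
      refine symForm_aux fun v => ?_
      simp only [MultilinearMap.coe_mk, symFunctional_tprod]
      exact Fintype.sum_equiv (Equiv.mulLeft e) _ _ fun σ => by simp)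

theorem symForm_tprod (m : ℕ) (h : SesqForm V) (u v : Fin m → V) :
    symForm m h (SymmetricPower.tprod ℂ u) (SymmetricPower.tprod ℂ v) =
      ∑ σ : Equiv.Perm (Fin m), ∏ i, h (u (σ i)) (v i) := by
  rw [symForm, symLift_tprod]
  exact symFunctional_tprod m h u v

end LinearAlgebra

/-! ### Plurisubharmonic functions -/

section Psh

variable {n : ℕ}

/-- The mean `∫₀^{2π} φ(z + e^{iθ} ξ) dθ / 2π` of an extended-real function, as the mean of its
positive part minus the mean of its negative part. (The former is finite if `φ < ∞` is upper
semicontinuous on the circle.) -/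
def circleMean (φ : (Fin n → ℂ) → EReal) (z ξ : Fin n → ℂ) : EReal :=
  (((ENNReal.ofReal (2 * Real.pi))⁻¹ * ∫⁻ θ in Set.Ioc 0 (2 * Real.pi),
      (φ (z + Complex.exp (θ * Complex.I) • ξ)).toENNReal : ENNReal) : EReal) -
  (((ENNReal.ofReal (2 * Real.pi))⁻¹ * ∫⁻ θ in Set.Ioc 0 (2 * Real.pi),
      (-φ (z + Complex.exp (θ * Complex.I) • ξ)).toENNReal : ENNReal) : EReal)

/-- Plurisubharmonic functions on an open set `Ω ⊆ ℂⁿ`, with values in `[-∞, ∞)`. -/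
structure IsPsh (φ : (Fin n → ℂ) → EReal) (Ω : Set (Fin n → ℂ)) : Prop where
  lt_top : ∀ z ∈ Ω, φ z < ⊤
  usc : UpperSemicontinuousOn φ Ω
  mean_value : ∀ z ∈ Ω, ∀ᶠ ξ in 𝓝 (0 : Fin n → ℂ), φ z ≤ circleMean φ z ξ

end Psh

section Manifold

variable {n : ℕ} {X : Type*} [TopologicalSpace X] [ChartedSpace (Fin n → ℂ) X]

/-- The image of `U ⊆ X` in the chart `c`. -/
def chartImage (c : OpenPartialHomeomorph X (Fin n → ℂ)) (U : Set X) : Set (Fin n → ℂ) :=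
  c.target ∩ c.symm ⁻¹' U

/-- Plurisubharmonic functions on an open subset of a complex manifold. -/
def IsPshOn (φ : X → EReal) (U : Set X) : Prop :=
  ∀ c ∈ atlas (Fin n → ℂ) X, IsPsh (φ ∘ c.symm) (chartImage c U)

/-- `p` holds at Lebesgue-almost every point of the complex manifold `X`, that is, outside a set
which is a Lebesgue null set in every chart. -/
def HoldsAE (n : ℕ) {X : Type*} [TopologicalSpace X] [ChartedSpace (Fin n → ℂ) X]
    (p : X → Prop) : Prop :=
  ∀ c ∈ atlas (Fin n → ℂ) X, ∀ᵐ z ∂volume.restrict c.target, p (c.symm z)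

/-- Holomorphic functions on an open subset of a complex manifold. -/
def IsHolo (n : ℕ) {X : Type*} [TopologicalSpace X] [ChartedSpace (Fin n → ℂ) X]
    (U : Set X) (f : X → ℂ) : Prop :=
  ContMDiffOn 𝓘(ℂ, Fin n → ℂ) 𝓘(ℂ, ℂ) ω f U

/-! ### Holomorphic sections

The holomorphic structure of a bundle with fibres `W x` is given through its sheaf of holomorphic
sections: `𝒪 U s` says that `s` is a holomorphic section over the open set `U` (the values of `s`
outside `U` are irrelevant). -/

/-- A predicate on the sections of `W` over the subsets of `X`. -/
abbrev SectionPred {X : Type*} (W : X → Type*) : Type _ := Set X → (∀ x, W x) → Prop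

/-- The holomorphic sections of a holomorphic vector bundle `E` with model fibre `F`. -/
def holoSections (n : ℕ) {X : Type*} [TopologicalSpace X] [ChartedSpace (Fin n → ℂ) X]
    (F : Type*) [NormedAddCommGroup F] [NormedSpace ℂ F] (E : X → Type*)
    [TopologicalSpace (TotalSpace F E)] [∀ x, TopologicalSpace (E x)] [FiberBundle F E] :
    SectionPred E := fun U s =>
  ContMDiffOn 𝓘(ℂ, Fin n → ℂ) (𝓘(ℂ, Fin n → ℂ).prod 𝓘(ℂ, F)) ω
    (fun x => (⟨x, s x⟩ : TotalSpace F E)) U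

section Sections

variable {W : X → Type*} [∀ x, AddCommGroup (W x)] [∀ x, Module ℂ (W x)]

/-- A section of the dual bundle is holomorphic if its pairings with the holomorphic sections of
the bundle are holomorphic functions. -/
def dualSections (n : ℕ) {X : Type*} [TopologicalSpace X] [ChartedSpace (Fin n → ℂ) X]
    {W : X → Type*} [∀ x, AddCommGroup (W x)] [∀ x, Module ℂ (W x)]
    (𝒪 : SectionPred W) : SectionPred fun x => Module.Dual ℂ (W x) := fun U ξ =>
  ∀ U' ⊆ U, IsOpen U' → ∀ s, 𝒪 U' s → IsHolo n U' fun x => ξ x (s x)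

/-- A section of the `q`-th exterior power is holomorphic if it is locally a finite sum
`∑ⱼ fⱼ sⱼ₁ ∧ … ∧ sⱼ_q` with holomorphic functions `fⱼ` and holomorphic sections `sⱼᵢ`. -/
def extSections (n : ℕ) {X : Type*} [TopologicalSpace X] [ChartedSpace (Fin n → ℂ) X]
    {W : X → Type*} [∀ x, AddCommGroup (W x)] [∀ x, Module ℂ (W x)]
    (q : ℕ) (𝒪 : SectionPred W) : SectionPred fun x => ⋀[ℂ]^q (W x) := fun U η =>
  ∀ x ∈ U, ∃ U' ⊆ U, IsOpen U' ∧ x ∈ U' ∧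
    ∃ (k : ℕ) (f : Fin k → X → ℂ) (s : Fin k → Fin q → ∀ y, W y),
      (∀ j, IsHolo n U' (f j)) ∧ (∀ j i, 𝒪 U' (s j i)) ∧
      ∀ y ∈ U', η y = ∑ j, f j y • exteriorPower.ιMulti ℂ q fun i => s j i y

/-- A section of the `m`-th symmetric power is holomorphic if it is locally a finite sum
`∑ⱼ fⱼ sⱼ₁ ⋯ sⱼₘ` with holomorphic functions `fⱼ` and holomorphic sections `sⱼᵢ`. -/
def symSections (n : ℕ) {X : Type*} [TopologicalSpace X] [ChartedSpace (Fin n → ℂ) X]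
    {W : X → Type*} [∀ x, AddCommGroup (W x)] [∀ x, Module ℂ (W x)]
    (m : ℕ) (𝒪 : SectionPred W) : SectionPred fun x => Sym[ℂ]^m (W x) := fun U η =>
  ∀ x ∈ U, ∃ U' ⊆ U, IsOpen U' ∧ x ∈ U' ∧
    ∃ (k : ℕ) (f : Fin k → X → ℂ) (s : Fin k → Fin m → ∀ y, W y),
      (∀ j, IsHolo n U' (f j)) ∧ (∀ j i, 𝒪 U' (s j i)) ∧
      ∀ y ∈ U', η y = ∑ j, f j y • SymmetricPower.tprod ℂ fun i => s j i y

/-! ### Singular Hermitian metrics and their curvature -/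

/-- A singular Hermitian metric: a family of Hermitian forms with (Lebesgue) measurable
coefficients, which is finite and positive definite (`0 < det h < ∞`) almost everywhere. Like its
coefficients, it is determined only up to null sets; in particular the values on the null set where
the metric may be infinite or degenerate do not matter, and are arbitrary here. -/
structure IsSingularHermitianMetric (n : ℕ) {X : Type*} [TopologicalSpace X]
    [ChartedSpace (Fin n → ℂ) X] {W : X → Type*} [∀ x, AddCommGroup (W x)] [∀ x, Module ℂ (W x)]
    (𝒪 : SectionPred W) (h : ∀ x, SesqForm (W x)) : Prop where
  measurable : ∀ c ∈ atlas (Fin n → ℂ) X, ∀ U : Set X, IsOpen U → ∀ s t, 𝒪 U s → 𝒪 U t →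
    AEMeasurable (fun z => h (c.symm z) (s (c.symm z)) (t (c.symm z)))
      (volume.restrict (chartImage c U))
  posDef : HoldsAE n fun x => IsPosDefForm (h x)

/-- `log |s|²_h`, with the value `-∞` where `|s|_h = 0`. -/
def logNormSq (h : ∀ x, SesqForm (W x)) (s : ∀ x, W x) (x : X) : EReal :=
  ENNReal.log (ENNReal.ofReal (h x (s x) (s x)).re)

/-- `h` is semi-negatively curved if `log |s|²_h` is plurisubharmonic for every local holomorphic
section `s`. As `h` is given only almost everywhere, this refers to an everywhere defined
representative `h'` of `h` (which is then unique). -/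
def IsSemiNegativelyCurved (n : ℕ) {X : Type*} [TopologicalSpace X]
    [ChartedSpace (Fin n → ℂ) X] {W : X → Type*} [∀ x, AddCommGroup (W x)] [∀ x, Module ℂ (W x)]
    (𝒪 : SectionPred W) (h : ∀ x, SesqForm (W x)) : Prop :=
  ∃ h' : ∀ x, SesqForm (W x), (∀ x, IsPosSemidefForm (h' x)) ∧ HoldsAE n (fun x => h' x = h x) ∧
    ∀ U : Set X, IsOpen U → ∀ s, 𝒪 U s → IsPshOn (n := n) (logNormSq h' s) U

/-- `h` is semi-positively curved if the dual metric on the dual bundle is semi-negatively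
curved. -/
def IsSemiPositivelyCurved (n : ℕ) {X : Type*} [TopologicalSpace X]
    [ChartedSpace (Fin n → ℂ) X] {W : X → Type*} [∀ x, AddCommGroup (W x)] [∀ x, Module ℂ (W x)]
    (𝒪 : SectionPred W) (h : ∀ x, SesqForm (W x)) : Prop :=
  IsSemiNegativelyCurved n (dualSections n 𝒪) fun x => dualForm (h x)

/-- `∑ ∂²χ/∂zⱼ∂z̄ₖ(z) wⱼ w̄ₖ`, the value at `0` of `∂²/∂τ∂τ̄ χ(z + τ w)`. -/
def leviForm (χ : (Fin n → ℂ) → ℝ) (z w : Fin n → ℂ) : ℝ :=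
  (iteratedFDeriv ℝ 2 χ z ![w, w] +
    iteratedFDeriv ℝ 2 χ z ![Complex.I • w, Complex.I • w]) / 4

/-- `φ` is locally integrable on the open set `Ω ⊆ ℂⁿ` and the current `√-1 ∂∂̄φ` is positive: for
every `w ∈ ℂⁿ` the distribution `∑ ∂²φ/∂zⱼ∂z̄ₖ wⱼ w̄ₖ` is nonnegative on test functions `χ ≥ 0`. -/
def IsPositiveDDbar (φ : (Fin n → ℂ) → ℝ) (Ω : Set (Fin n → ℂ)) : Prop :=
  LocallyIntegrableOn φ Ω volume ∧
    ∀ (w : Fin n → ℂ) (χ : (Fin n → ℂ) → ℝ), ContDiff ℝ ∞ χ → HasCompactSupport χ →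
      tsupport χ ⊆ Ω → (∀ z, 0 ≤ χ z) → 0 ≤ ∫ z in Ω, φ z * leviForm χ z w

/-- The metric `g` on the line bundle `L` has positive curvature current: for every nowhere
vanishing holomorphic section `s` of `L` over an open set `U`, the local weight `φ = -log |s|²_g` is
locally integrable in the charts, and the curvature current `√-1/π ∂∂̄φ` is positive. -/
def HasPositiveCurvatureCurrent (n : ℕ) {X : Type*} [TopologicalSpace X]
    [ChartedSpace (Fin n → ℂ) X] {L : X → Type*} [∀ x, AddCommGroup (L x)] [∀ x, Module ℂ (L x)]
    (𝒪 : SectionPred L) (g : ∀ x, SesqForm (L x)) : Prop :=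
  ∀ c ∈ atlas (Fin n → ℂ) X, ∀ U : Set X, IsOpen U → ∀ s, 𝒪 U s → (∀ x ∈ U, s x ≠ 0) →
    IsPositiveDDbar (fun z => -Real.log (g (c.symm z) (s (c.symm z)) (s (c.symm z))).re)
      (chartImage c U)

end Sections

end Manifold

end

/-! Curvature is tested on the dual side. Both `Sym^m V` and `Λ^q V` are quotients of a tensor power
of `V`, so the dual of such a power `N` embeds in the tensor power of `V*`. The dual of the induced
form is `1/m!` times the restriction of the tensor power of the dual form
(`IsInducedForm.dualForm_eq`). The factor appears because the induced form sums over all `m!`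
permutations. The right-hand side makes sense for any semi-positive form on `V*`, so it turns the
everywhere defined representative of `h*` into one for the power. It remains to see that tensor
powers of semi-negatively curved metrics are semi-negatively curved. Passing to `N*` then costs
nothing, since a holomorphic section of `N*` has holomorphic components in the tensor power.

This is a local statement about Hermitian matrix functions, tested on complex lines
(`LogGriffithsNeg.line`). On a plane domain the working condition is that `|v|²_g`, without the
logarithm, is subharmonic for every holomorphic `v` (`GriffithsNeg`). Jensen's inequality derives it
from the logarithmic condition. Conversely it returns the logarithmic one, because `v` may be
multiplied by `e^{-P/2}` with `P` entire and `Re P` a majorant of `log |v|²` on the circle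
(`GriffithsNeg.log_submean`). The advantage of the working condition is that it is linear in `g`,
hence stable under sums and convolution.

In a frame the matrix of the tensor power has entries `∏ₖ g(I k, J k)`. It is a Hadamard product of
reindexed copies of `g`, so everything rests on Hadamard products (`GriffithsNeg.hadamard`). For
differentiable positive definite `g` one writes, near a point, `g = A* K A + R` with `A`
holomorphic, `K` constant and `R` vanishing to first order; the circle means of `R` are non-negative
up to `o(ρ²)` (`GriffithsNeg.exists_normal_frame`). In the product of two such expansions the flat
terms give a sum of squared moduli of holomorphic functions, the mixed terms have almost
non-negative means by the argument of the Schur product theorem, and the product of the remainders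
is `o(ρ²)`. A local maximum principle (`le_circleAverage_of_local`) globalizes this. The general
case follows by rotation-invariant mollification plus a small multiple of the identity, which
converges pointwise (`GriffithsNeg.exists_smooth_approx`).

For the determinant, a nowhere vanishing section `s` has a holomorphic dual section `ξ` with `ξ(s) =
1`, and `|ξ|² = 1/|s|²` almost everywhere. So the weight `-log |s|²` agrees almost everywhere with
`log u` for a log-plurisubharmonic `u`. Its local integrability comes from the submean inequality
and Fatou's lemma, and the positivity of the current from the second-order expansion of circle means
of test functions (`IsLogPsh.isPositiveDDbar`).

Measurability of the induced metrics is read off from their formula. Their definiteness follows from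
the reproducing property `IsInducedForm.tensorDual_apply_flip`. -/

noncomputable section

/-! ### Quadratic forms of Hermitian matrices -/

section Quad

open Matrix
open scoped ComplexOrder MatrixOrder

variable {ι κ : Type*} [Fintype ι] [Fintype κ]

/-- The real quadratic form `∑ conj (v i) M i j v j` of a Hermitian matrix. -/
def quad (M : Matrix ι ι ℂ) (v : ι → ℂ) : ℝ := (∑ i, ∑ j, conj (v i) * M i j * v j).re

theorem quad_eq_dotProduct (M : Matrix ι ι ℂ) (v : ι → ℂ) :
    quad M v = (star v ⬝ᵥ M *ᵥ v).re := by
  simp [quad, dotProduct, mulVec, Finset.mul_sum, mul_assoc]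

theorem quad_add (M N : Matrix ι ι ℂ) (v : ι → ℂ) : quad (M + N) v = quad M v + quad N v := by
  simp [quad, mul_add, add_mul, Finset.sum_add_distrib]

theorem quad_sub (M N : Matrix ι ι ℂ) (v : ι → ℂ) : quad (M - N) v = quad M v - quad N v := by
  simp [quad, mul_sub, sub_mul, Finset.sum_sub_distrib]

theorem quad_smul (c : ℝ) (M : Matrix ι ι ℂ) (v : ι → ℂ) : quad (c • M) v = c * quad M v := by
  simp only [quad, Matrix.smul_apply, Complex.real_smul]
  rw [← Complex.re_ofReal_mul, Finset.mul_sum]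
  congr 1
  refine Finset.sum_congr rfl fun i _ => ?_
  rw [Finset.mul_sum]
  exact Finset.sum_congr rfl fun j _ => by ring

theorem quad_zero (v : ι → ℂ) : quad 0 v = 0 := by simp [quad]

theorem quad_smul_right (c : ℂ) (M : Matrix ι ι ℂ) (v : ι → ℂ) :
    quad M (fun i => c * v i) = ‖c‖ ^ 2 * quad M v := by
  rw [← Complex.normSq_eq_norm_sq, quad, quad, ← Complex.re_ofReal_mul, Finset.mul_sum]
  congr 1
  refine Finset.sum_congr rfl fun i _ => ?_
  rw [Finset.mul_sum]
  refine Finset.sum_congr rfl fun j _ => ?_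
  rw [← Complex.mul_conj, map_mul]
  ring

theorem quad_diagonal [DecidableEq ι] (d : ι → ℂ) (v : ι → ℂ) :
    quad (diagonal d) v = ∑ i, (d i).re * ‖v i‖ ^ 2 := by
  simp only [quad, diagonal_apply, mul_ite, mul_zero, ite_mul, zero_mul, Finset.sum_ite_eq,
    Finset.mem_univ, if_true, Complex.re_sum]
  refine Finset.sum_congr rfl fun i _ => ?_
  rw [mul_right_comm, ← Complex.normSq_eq_conj_mul_self, Complex.re_ofReal_mul,
    Complex.normSq_eq_norm_sq, mul_comm]

theorem quad_one [DecidableEq ι] (v : ι → ℂ) : quad 1 v = ∑ i, ‖v i‖ ^ 2 := by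
  rw [← diagonal_one, quad_diagonal]
  simp

theorem Matrix.PosSemidef.quad_nonneg {M : Matrix ι ι ℂ} (hM : M.PosSemidef) (v : ι → ℂ) :
    0 ≤ quad M v := by
  rw [quad_eq_dotProduct]
  exact (Complex.le_def.1 (hM.dotProduct_mulVec_nonneg v)).1

theorem quad_im_eq_zero {M : Matrix ι ι ℂ} (hM : M.IsHermitian) (v : ι → ℂ) :
    (star v ⬝ᵥ M *ᵥ v).im = 0 := hM.im_star_dotProduct_mulVec_self v

theorem posSemidef_of_quad_nonneg {M : Matrix ι ι ℂ} (hM : M.IsHermitian)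
    (h : ∀ v, 0 ≤ quad M v) : M.PosSemidef := by
  refine posSemidef_iff_dotProduct_mulVec.2 ⟨hM, fun v => ?_⟩
  rw [Complex.le_def]
  exact ⟨by rw [← quad_eq_dotProduct]; exact h v, (quad_im_eq_zero hM v).symm⟩

/-- Reindexing along `f` is a congruence: it pulls the form back by the linear map that sums a
vector over the fibres of `f`. -/
theorem quad_submatrix (M : Matrix ι ι ℂ) (f : κ → ι) [DecidableEq ι] (v : κ → ℂ) :
    quad (M.submatrix f f) v = quad M (fun i => ∑ k with f k = i, v k) := by
  simp only [quad, submatrix_apply, map_sum, Finset.sum_mul, Finset.mul_sum]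
  congr 1
  have key : ∀ (F : κ → κ → ℂ), ∑ i : ι, ∑ j : ι, ∑ l ∈ Finset.univ.filter (fun l => f l = j),
      ∑ k ∈ Finset.univ.filter (fun k => f k = i), F k l = ∑ k, ∑ l, F k l := by
    intro F
    have h1 : ∀ i, (∑ j : ι, ∑ l ∈ Finset.univ.filter (fun l => f l = j),
        ∑ k ∈ Finset.univ.filter (fun k => f k = i), F k l) =
        ∑ k ∈ Finset.univ.filter (fun k => f k = i), ∑ l, F k l := by
      intro i
      rw [Finset.sum_fiberwise (s := Finset.univ) (g := f), Finset.sum_comm]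
    simp_rw [h1]
    exact Finset.sum_fiberwise (s := Finset.univ) (g := f) _
  rw [← key]
  refine Finset.sum_congr rfl fun i _ => Finset.sum_congr rfl fun j _ => ?_
  refine Finset.sum_congr rfl fun l hl => ?_
  refine Finset.sum_congr rfl fun k hk => ?_
  rw [(Finset.mem_filter.1 hl).2, (Finset.mem_filter.1 hk).2]

theorem Matrix.PosSemidef.exists_factor {M : Matrix ι ι ℂ} (hM : M.PosSemidef) :
    ∃ C : Matrix ι ι ℂ, M = Cᴴ * C := by
  classical
  obtain ⟨C, hC⟩ := CStarAlgebra.nonneg_iff_eq_star_mul_self.mp (nonneg_iff_posSemidef.2 hM)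
  exact ⟨C, hC⟩

theorem sum_rotate {α β γ R : Type*} [Fintype α] [Fintype β] [Fintype γ] [AddCommMonoid R]
    (f : α → β → γ → R) : ∑ i, ∑ j, ∑ b, f i j b = ∑ b, ∑ i, ∑ j, f i j b :=
  (Finset.sum_congr rfl fun _ _ => Finset.sum_comm).trans Finset.sum_comm

/-- This is the mechanism of the Schur product theorem. A Hadamard product with a Gram matrix is a
sum of diagonal congruences of `M`, one for each row of `C`, so any property of `quad M` at fixed
vectors that is stable under finite sums carries over. -/
theorem quad_hadamard_factor (M C : Matrix ι ι ℂ) (v : ι → ℂ) :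
    quad (M ⊙ (Cᴴ * C)) v = ∑ b, quad M (fun i => C b i * v i) := by
  simp only [quad, hadamard_apply, mul_apply, conjTranspose_apply, ← Complex.re_sum]
  congr 1
  simp only [Finset.mul_sum, Finset.sum_mul, map_mul]
  rw [sum_rotate]
  exact Finset.sum_congr rfl fun b _ => Finset.sum_congr rfl fun i _ =>
    Finset.sum_congr rfl fun j _ => by rw [RCLike.star_def]; ring

theorem quad_factor (C : Matrix κ ι ℂ) (v : ι → ℂ) :
    quad (Cᴴ * C) v = ∑ b, ‖∑ i, C b i * v i‖ ^ 2 := by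
  have : ∀ b, ‖∑ i, C b i * v i‖ ^ 2 = (∑ i, ∑ j, conj (v i) * (conj (C b i) * C b j) * v j).re := by
    intro b
    rw [← Complex.normSq_eq_norm_sq, ← Complex.ofReal_re (Complex.normSq _),
      Complex.normSq_eq_conj_mul_self, map_sum, Finset.sum_mul_sum]
    congr 1
    refine Finset.sum_congr rfl fun i _ => Finset.sum_congr rfl fun j _ => ?_
    rw [map_mul]; ring
  simp only [this, quad, mul_apply, conjTranspose_apply, ← Complex.re_sum]
  congr 1
  simp only [Finset.mul_sum, Finset.sum_mul]
  rw [sum_rotate]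
  exact Finset.sum_congr rfl fun b _ => Finset.sum_congr rfl fun i _ =>
    Finset.sum_congr rfl fun j _ => by rw [RCLike.star_def]

/-- Cauchy-Schwarz in each row of a factor `C`; the trace is the sum of all `‖C b i‖²`. -/
theorem Matrix.PosSemidef.quad_le_trace {M : Matrix ι ι ℂ} (hM : M.PosSemidef) (v : ι → ℂ) :
    quad M v ≤ M.trace.re * ∑ i, ‖v i‖ ^ 2 := by
  obtain ⟨C, rfl⟩ := hM.exists_factor
  have htr : (Cᴴ * C).trace.re = ∑ b, ∑ i, ‖C b i‖ ^ 2 := by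
    simp only [trace, diag_apply, mul_apply, conjTranspose_apply, Complex.re_sum]
    rw [Finset.sum_comm]
    refine Finset.sum_congr rfl fun b _ => Finset.sum_congr rfl fun i _ => ?_
    rw [RCLike.star_def, ← Complex.normSq_eq_conj_mul_self, Complex.ofReal_re,
      Complex.normSq_eq_norm_sq]
  rw [quad_factor, htr, Finset.sum_mul]
  refine Finset.sum_le_sum fun b _ => ?_
  calc ‖∑ i, C b i * v i‖ ^ 2 ≤ (∑ i, ‖C b i‖ * ‖v i‖) ^ 2 := by
        gcongr
        exact (norm_sum_le _ _).trans (Finset.sum_le_sum fun i _ => norm_mul_le _ _)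
    _ ≤ _ := Finset.sum_mul_sq_le_sq_mul_sq _ _ _

theorem posSemidef_sub_of_quad_le {M N : Matrix ι ι ℂ} (hM : M.IsHermitian) (hN : N.IsHermitian)
    (h : ∀ v, quad M v ≤ quad N v) : (N - M).PosSemidef :=
  posSemidef_of_quad_nonneg (hN.sub hM) fun v => by rw [quad_sub]; linarith [h v]

/-- The difference is `(N - M) ⊙ M' + N ⊙ (N' - M')`, which is semi-positive by the Schur product
theorem. -/
theorem quad_hadamard_mono {M N M' N' : Matrix ι ι ℂ} (hM : M.PosSemidef) (hM' : M'.PosSemidef)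
    (hMN : (N - M).PosSemidef) (hMN' : (N' - M').PosSemidef) (v : ι → ℂ) :
    quad (M ⊙ M') v ≤ quad (N ⊙ N') v := by
  have e : N ⊙ N' = M ⊙ M' + ((N - M) ⊙ M' + (M + (N - M)) ⊙ (N' - M')) := by
    ext i j; simp; ring
  rw [e, quad_add]
  have h2 := ((hMN.hadamard hM').add ((hM.add hMN).hadamard hMN')).quad_nonneg v
  linarith

theorem quad_single [DecidableEq ι] (M : Matrix ι ι ℂ) (i j : ι) (a b : ℂ) :
    quad M (Pi.single i a + Pi.single j b) = (conj a * M i i * a + conj a * M i j * b +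
      conj b * M j i * a + conj b * M j j * b).re := by
  have h1 : star (Pi.single i a + Pi.single j b : ι → ℂ) =
      Pi.single i (conj a) + Pi.single j (conj b) := by
    funext k
    simp [Pi.single_apply, apply_ite (starRingEnd ℂ)]
  rw [quad_eq_dotProduct, h1]
  simp [mulVec_add, add_dotProduct, dotProduct_add, mul_add]
  ring

/-- Polarization. It reduces measurability, bounds and limits of the entries to those of `quad` at
fixed vectors. The summands with coefficient `0` only bring every vector into the shape of
`quad_single`. -/
theorem Matrix.IsHermitian.re_apply_eq [DecidableEq ι] {M : Matrix ι ι ℂ} (hM : M.IsHermitian)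
    (i j : ι) : (M i j).re = (quad M (Pi.single i 1 + Pi.single j 1) -
      quad M (Pi.single i 1 + Pi.single j 0) - quad M (Pi.single i 0 + Pi.single j 1)) / 2 := by
  have := hM.apply i j
  simp only [quad_single, ← this]
  simp
  ring

theorem Matrix.IsHermitian.im_apply_eq [DecidableEq ι] {M : Matrix ι ι ℂ} (hM : M.IsHermitian)
    (i j : ι) : (M i j).im = -(quad M (Pi.single i 1 + Pi.single j Complex.I) -
      quad M (Pi.single i 1 + Pi.single j 0) - quad M (Pi.single i 0 + Pi.single j 1)) / 2 := by
  have h1 := hM.apply i j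
  simp only [quad_single, ← h1]
  simp
  ring

/-- Upper semicontinuity of `quad (g y) v` for fixed `v` is automatically uniform in `v`. -/
theorem eventually_quad_le {Y : Type*} {l : Filter Y} {g : Y → Matrix ι ι ℂ} {K : Matrix ι ι ℂ}
    (hg : ∀ᶠ y in l, (g y).PosSemidef)
    (husc : ∀ v a, quad K v < a → ∀ᶠ y in l, quad (g y) v < a) {δ : ℝ} (hδ : 0 < δ) :
    ∀ᶠ y in l, ∀ v, quad (g y) v ≤ quad K v + δ * ∑ i, ‖v i‖ ^ 2 := by
  classical
  -- The trace is the sum of the values at the standard basis vectors, so finitely many instances of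
  -- `husc` bound it.
  have htr : ∃ C, 0 < C ∧ ∀ᶠ y in l, (g y).trace.re ≤ C := by
    have h1 : ∀ᶠ y in l, ∀ i, quad (g y) (Pi.single i 1) < quad K (Pi.single i 1) + 1 :=
      Filter.eventually_all.2 fun i => husc _ _ (by linarith)
    refine ⟨|∑ i, (quad K (Pi.single i 1) + 1)| + 1, by positivity, ?_⟩
    filter_upwards [h1] with y hy
    have : (g y).trace.re = ∑ i, quad (g y) (Pi.single i 1) := by
      simp only [trace, diag_apply, Complex.re_sum]
      refine Finset.sum_congr rfl fun i _ => ?_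
      have := quad_single (g y) i i 1 0
      simp only [Pi.single_zero, add_zero] at this
      simp [this]
    rw [this]
    have h2 : ∑ i, quad (g y) (Pi.single i 1) ≤ ∑ i, (quad K (Pi.single i 1) + 1) :=
      Finset.sum_le_sum fun i _ => (hy i).le
    linarith [le_abs_self (∑ i, (quad K (Pi.single i 1) + 1))]
  obtain ⟨C, hC, hC'⟩ := htr
  have hKc : Continuous (quad K) := by unfold quad; fun_prop
  -- From `(x + z)² ≤ (1 + η) x² + (1 + η⁻¹) z²` in each row of a factor. The last term is
  -- controlled by the trace bound when `v` is close to `w`, so a bound at one vector spreads to its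
  -- neighbours.
  have young : ∀ (M : Matrix ι ι ℂ), M.PosSemidef → ∀ (η : ℝ), 0 < η → ∀ v w : ι → ℂ,
      quad M v ≤ (1 + η) * quad M w + (1 + η⁻¹) * quad M (v - w) := by
    intro M hM η hη v w
    obtain ⟨B, rfl⟩ := hM.exists_factor
    simp only [quad_factor, Finset.mul_sum, ← Finset.sum_add_distrib]
    refine Finset.sum_le_sum fun b _ => ?_
    have : ∑ i, B b i * v i = ∑ i, B b i * w i + ∑ i, B b i * (v - w) i := by
      rw [← Finset.sum_add_distrib]; exact Finset.sum_congr rfl fun i _ => by simp; ring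
    rw [this]
    set x := ‖∑ i, B b i * w i‖ with hx
    set z := ‖∑ i, B b i * (v - w) i‖ with hz
    have h1 := norm_add_le (∑ i, B b i * w i) (∑ i, B b i * (v - w) i)
    have h2 : ‖∑ i, B b i * w i + ∑ i, B b i * (v - w) i‖ ^ 2 ≤ (x + z) ^ 2 := by gcongr
    refine h2.trans ?_
    have h3 : 0 ≤ η⁻¹ * (η * x - z) ^ 2 := by positivity
    have h4 : η⁻¹ * (η * x - z) ^ 2 = η * x ^ 2 - 2 * x * z + η⁻¹ * z ^ 2 := by
      field_simp; ring
    nlinarith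
  have joint : ∀ v : ι → ℂ, ∑ i, ‖v i‖ ^ 2 = 1 →
      ∀ᶠ p : (ι → ℂ) × Y in 𝓝 v ×ˢ l, quad (g p.2) p.1 ≤ quad K p.1 + δ := by
    intro v _
    obtain ⟨η, hη, hη'⟩ : ∃ η : ℝ, 0 < η ∧ (1 + η) * (quad K v + δ / 8) < quad K v + δ / 4 := by
      have h1 : Filter.Tendsto (fun η : ℝ => (1 + η) * (quad K v + δ / 8)) (𝓝[>] 0)
          (𝓝 ((1 + 0) * (quad K v + δ / 8))) := by
        refine tendsto_nhdsWithin_of_tendsto_nhds ?_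
        exact (Continuous.tendsto (by fun_prop) 0)
      have h2 := h1.eventually_lt_const (u := quad K v + δ / 4) (by linarith)
      obtain ⟨η, h3, h4⟩ := (h2.and self_mem_nhdsWithin).exists
      exact ⟨η, h4, h3⟩
    have e1 := husc v (quad K v + δ / 8) (by linarith)
    have e2 : ∀ᶠ w in 𝓝 v, quad K v < quad K w + δ / 4 := by
      have := (hKc.tendsto v).eventually_const_lt (u := quad K v - δ / 4) (by linarith)
      filter_upwards [this] with w hw; linarith
    have e3 : ∀ᶠ w in 𝓝 v, (1 + η⁻¹) * (C * ∑ i, ‖(w - v) i‖ ^ 2) < δ / 4 := by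
      have hc : Continuous fun w : ι → ℂ => (1 + η⁻¹) * (C * ∑ i, ‖(w - v) i‖ ^ 2) := by
        simp only [Pi.sub_apply]; fun_prop
      refine (hc.tendsto v).eventually_lt_const ?_
      simp; positivity
    filter_upwards [(e2.and e3).prod_mk ((e1.and hg).and hC')] with p hp
    obtain ⟨⟨h2, h3⟩, ⟨h1, h4⟩, h5⟩ := hp
    have h6 := young _ h4 η hη p.1 v
    have h7 : quad (g p.2) (p.1 - v) ≤ C * ∑ i, ‖(p.1 - v) i‖ ^ 2 :=
      (h4.quad_le_trace _).trans (by gcongr)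
    have h8 : (1 + η⁻¹) * quad (g p.2) (p.1 - v) ≤ (1 + η⁻¹) * (C * ∑ i, ‖(p.1 - v) i‖ ^ 2) := by
      gcongr
    have h9 : (1 + η) * quad (g p.2) v ≤ (1 + η) * (quad K v + δ / 8) := by gcongr
    linarith
  have hcpt : IsCompact {v : ι → ℂ | ∑ i, ‖v i‖ ^ 2 = 1} := by
    refine Metric.isCompact_of_isClosed_isBounded
      (isClosed_eq (by fun_prop) continuous_const) ?_
    refine (Metric.isBounded_closedBall (x := (0 : ι → ℂ)) (r := 1)).subset fun v hv => ?_
    rw [mem_closedBall_zero_iff, pi_norm_le_iff_of_nonneg zero_le_one]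
    intro i
    have : ‖v i‖ ^ 2 ≤ ∑ i, ‖v i‖ ^ 2 :=
      Finset.single_le_sum (f := fun i => ‖v i‖ ^ 2) (fun i _ => by positivity) (Finset.mem_univ i)
    rw [Set.mem_ofPred_eq] at hv
    nlinarith [norm_nonneg (v i)]
  -- Compactness of the unit sphere makes the estimates around its points uniform; homogeneity then
  -- gives all vectors.
  have hunif : ∀ᶠ y in l, ∀ v ∈ {v : ι → ℂ | ∑ i, ‖v i‖ ^ 2 = 1},
      quad (g y) v ≤ quad K v + δ := by
    have h1 : ∀ᶠ p : (ι → ℂ) × Y in (𝓝ˢ {v : ι → ℂ | ∑ i, ‖v i‖ ^ 2 = 1}) ×ˢ l,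
        quad (g p.2) p.1 ≤ quad K p.1 + δ :=
      hcpt.mem_nhdsSet_prod_of_forall fun v hv => joint v hv
    obtain ⟨s, hs, t, ht, hst⟩ := Filter.mem_prod_iff.1 h1
    filter_upwards [ht] with y hy v hv
    have h2 : (v, y) ∈ s ×ˢ t := ⟨subset_of_mem_nhdsSet hs hv, hy⟩
    have h3 := hst h2
    rw [Set.mem_ofPred_eq] at h3
    exact h3
  filter_upwards [hunif] with y hy v
  rcases eq_or_ne v 0 with rfl | hv
  · simp [quad]
  set s := ∑ i, ‖v i‖ ^ 2 with hs
  have hs0 : 0 < s := by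
    obtain ⟨i, hi⟩ := Function.ne_iff.1 hv
    exact Finset.sum_pos' (fun i _ => by positivity) ⟨i, Finset.mem_univ _, by
      have : 0 < ‖v i‖ := norm_pos_iff.2 hi
      positivity⟩
  have h1 := hy (fun i => ((Real.sqrt s)⁻¹ : ℝ) * v i) (by
    simp only [Set.mem_ofPred_eq, norm_mul, mul_pow, ← Finset.mul_sum, ← hs]
    rw [Complex.norm_real, Real.norm_eq_abs, sq_abs, inv_pow, Real.sq_sqrt hs0.le]
    field_simp)
  rw [quad_smul_right, quad_smul_right, Complex.norm_real, Real.norm_eq_abs, sq_abs, inv_pow,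
    Real.sq_sqrt hs0.le] at h1
  have h2 := mul_le_mul_of_nonneg_left h1 hs0.le
  rw [mul_add, ← mul_assoc, ← mul_assoc, mul_inv_cancel₀ hs0.ne', one_mul, one_mul] at h2
  linarith

end Quad

end

noncomputable section

/-! ### Submean value inequalities on circles -/

section Circle

open Metric Set

theorem circleIntegrable_of_usc {f : ℂ → ℝ} {c : ℂ} {r m : ℝ} (hr : 0 ≤ r)
    (hf : UpperSemicontinuousOn f (sphere c r)) (hm : ∀ z ∈ sphere c r, m ≤ f z) :
    CircleIntegrable f c r := by
  have h1 : UpperSemicontinuous fun θ : ℝ => f (circleMap c r θ) := by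
    rw [← upperSemicontinuousOn_univ_iff]
    exact hf.comp (continuous_circleMap c r).continuousOn fun θ _ => circleMap_mem_sphere c hr θ
  obtain ⟨M, hM⟩ := hf.bddAbove_of_isCompact (isCompact_sphere c r)
  have hfin : volume (uIcc 0 (2 * Real.pi)) ≠ ⊤ := isCompact_uIcc.measure_ne_top
  refine (Measure.integrableOn_of_bounded (M := |m| + |M|) hfin
    h1.measurable.aestronglyMeasurable (Filter.Eventually.of_forall fun θ => ?_)).intervalIntegrable
  have h2 := hm _ (circleMap_mem_sphere c hr θ)
  have h3 := hM (mem_image_of_mem f (circleMap_mem_sphere c hr θ))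
  rw [Real.norm_eq_abs, abs_le]
  constructor
  · linarith [neg_abs_le m, abs_nonneg M]
  · linarith [le_abs_self M, abs_nonneg m]

/-- The approximants are the sup-convolutions `sup_y (f y - k d(x, y))`, which are `k`-Lipschitz and
lie above `f`. As `k` grows, points at distance at least `η` lose at least `M - m` and no longer
matter, while nearer points are controlled by semicontinuity. -/
theorem exists_continuous_approx_of_usc {α : Type*} [PseudoMetricSpace α] {K : Set α}
    (hK : IsCompact K) (hne : K.Nonempty) {f : α → ℝ} (hf : UpperSemicontinuousOn f K) {m : ℝ}
    (hm : ∀ x ∈ K, m ≤ f x) :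
    ∃ (φ : ℕ → α → ℝ) (M : ℝ), (∀ k, Continuous (φ k)) ∧ (∀ k, ∀ x ∈ K, f x ≤ φ k x) ∧
      (∀ k x, φ k x ≤ M) ∧ ∀ x ∈ K, Filter.Tendsto (fun k => φ k x) Filter.atTop (𝓝 (f x)) := by
  obtain ⟨M, hM⟩ := hf.bddAbove_of_isCompact hK
  have hM' : ∀ y ∈ K, f y ≤ M := fun y hy => hM (mem_image_of_mem f hy)
  have : Nonempty K := hne.to_subtype
  have hbdd : ∀ (k : ℕ) (x : α), BddAbove (range fun y : K => f y - k * dist x y) := by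
    intro k x
    refine ⟨M, ?_⟩
    rintro _ ⟨y, rfl⟩
    have : 0 ≤ k * dist x (y : α) := by positivity
    have := hM' y y.2
    simp only
    linarith
  refine ⟨fun k x => ⨆ y : K, (f y - k * dist x y), M, fun k => ?_, fun k x hx => ?_,
    fun k x => ?_, fun x hx => ?_⟩
  · refine (LipschitzWith.of_le_add_mul (k : NNReal) fun x x' => ?_).continuous
    refine ciSup_le fun y => ?_
    have h1 := le_ciSup (hbdd k x') y
    have h2 := dist_triangle_left x' y x
    have h3 : (k : ℝ) * dist x' y ≤ k * (dist x x' + dist x y) := by gcongr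
    simp only [NNReal.coe_natCast]
    linarith
  · have := le_ciSup (hbdd k x) ⟨x, hx⟩
    simpa using this
  · refine ciSup_le fun y => ?_
    have : 0 ≤ k * dist x (y : α) := by positivity
    have := hM' y y.2
    linarith
  · rw [Metric.tendsto_atTop]
    intro ε hε
    have h1 := hf x hx (f x + ε / 2) (by linarith)
    obtain ⟨η, hη, h2⟩ := Metric.mem_nhdsWithin_iff.1 h1
    obtain ⟨N, hN⟩ := exists_nat_ge ((M - m) / η)
    refine ⟨N, fun k hk => ?_⟩
    have h3 : f x ≤ ⨆ y : K, (f y - k * dist x y) := by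
      simpa using le_ciSup (hbdd k x) ⟨x, hx⟩
    have h4 : ⨆ y : K, (f y - k * dist x y) ≤ f x + ε / 2 := by
      refine ciSup_le fun y => ?_
      by_cases hy : dist (y : α) x < η
      · have h5 := h2 (show (y : α) ∈ ball x η ∩ K from ⟨hy, y.2⟩)
        rw [mem_ofPred_eq] at h5
        have : 0 ≤ k * dist x (y : α) := by positivity
        linarith
      · rw [not_lt] at hy
        have h5 : (M - m) ≤ k * dist x y := by
          rw [div_le_iff₀ hη] at hN
          calc M - m ≤ N * η := hN
            _ ≤ k * dist x y := by
              rw [dist_comm]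
              have : (N : ℝ) ≤ k := by exact_mod_cast hk
              gcongr
        have := hM' y y.2
        have := hm x hx
        linarith
    rw [Real.dist_eq, abs_lt]
    constructor <;> linarith

/-- Trigonometric polynomials are dense on the circle, and the real part of one is the real part of
a polynomial in `z`, since `Re (a e^{-ikθ}) = Re (ā e^{ikθ})`. -/
theorem exists_entire_approx {φ : ℂ → ℝ} (hφ : Continuous φ) (c : ℂ) {r : ℝ} (hr : 0 < r) {ε : ℝ}
    (hε : 0 < ε) : ∃ P : ℂ → ℂ, Differentiable ℂ P ∧ ∀ z ∈ sphere c r, |(P z).re - φ z| < ε := by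
  have hT : Fact (0 < 2 * Real.pi) := ⟨Real.two_pi_pos⟩
  let h : C(AddCircle (2 * Real.pi), ℂ) :=
    ⟨fun x => (φ (c + r * (AddCircle.toCircle x : ℂ)) : ℂ), by
      have := AddCircle.continuous_toCircle (T := 2 * Real.pi)
      fun_prop⟩
  have h1 : h ∈ (Submodule.span ℂ (range (fourier (T := 2 * Real.pi)))).topologicalClosure := by
    rw [span_fourier_closure_eq_top]; trivial
  obtain ⟨g, hg, hgd⟩ := Metric.mem_closure_iff.1 h1 ε hε
  -- The extra factor `a` makes the claim stable under complex scalars, which the real part alone is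
  -- not.
  have key : ∀ a : ℂ, ∃ P : ℂ → ℂ, Differentiable ℂ P ∧
      ∀ x : AddCircle (2 * Real.pi), (a * g x).re = (P (AddCircle.toCircle x : ℂ)).re := by
    clear hgd
    induction hg using Submodule.span_induction with
    | mem x hx =>
      obtain ⟨n, rfl⟩ := hx
      intro a
      obtain ⟨k, rfl | rfl⟩ := n.eq_nat_or_neg
      · exact ⟨fun z => a * z ^ k, by fun_prop, fun x => by
          rw [fourier_apply, AddCircle.toCircle_zsmul]; simp⟩
      · refine ⟨fun z => conj a * z ^ k, by fun_prop, fun x => ?_⟩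
        have e : a * (fourier (-(k : ℤ)) x : ℂ) =
            conj (conj a * (AddCircle.toCircle x : ℂ) ^ k) := by
          rw [fourier_apply, AddCircle.toCircle_zsmul, zpow_neg, zpow_natCast,
            Circle.coe_inv_eq_conj]
          simp
        rw [e, Complex.conj_re]
    | zero => exact fun a => ⟨0, differentiable_const 0, fun x => by simp⟩
    | add x y _ _ hx hy =>
      intro a
      obtain ⟨P, hP, hP'⟩ := hx a
      obtain ⟨Q, hQ, hQ'⟩ := hy a
      exact ⟨P + Q, hP.add hQ, fun z => by
        rw [ContinuousMap.add_apply, mul_add, Complex.add_re, hP', hQ', Pi.add_apply,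
          Complex.add_re]⟩
    | smul b x _ hx =>
      intro a
      obtain ⟨P, hP, hP'⟩ := hx (a * b)
      exact ⟨P, hP, fun z => by rw [← hP', ContinuousMap.smul_apply, smul_eq_mul, mul_assoc]⟩
  obtain ⟨P, hP, hP'⟩ := key 1
  refine ⟨fun z => P ((z - c) / r), by fun_prop, fun z hz => ?_⟩
  have hr' : (r : ℂ) ≠ 0 := by exact_mod_cast hr.ne'
  have hw : (z - c) / r ∈ Submonoid.unitSphere ℂ := by
    rw [mem_sphere_iff_norm] at hz
    simp [Submonoid.unitSphere, hz, abs_of_pos hr, hr.ne']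
  obtain ⟨x, hx⟩ := (AddCircle.homeomorphCircle hT.out.ne').surjective ⟨_, hw⟩
  have hx' : (AddCircle.toCircle x : ℂ) = (z - c) / r := by
    rw [← AddCircle.homeomorphCircle_apply hT.out.ne', hx]
  have h2 : h x = φ z := by
    change ((φ (c + r * (AddCircle.toCircle x : ℂ)) : ℝ) : ℂ) = _
    rw [hx', mul_div_cancel₀ _ hr']; simp
  have h3 := hP' x
  rw [one_mul, hx'] at h3
  simp only [← h3]
  have h4 : dist (h x) (g x) < ε := lt_of_le_of_lt (ContinuousMap.dist_apply_le_dist x) hgd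
  rw [h2, dist_comm, Complex.dist_eq] at h4
  refine lt_of_le_of_lt ?_ h4
  have := Complex.abs_re_le_norm (g x - φ z)
  simpa using this

theorem circleAverage_re_of_differentiableOn {P : ℂ → ℂ} {c : ℂ} {r : ℝ} (hr : 0 ≤ r)
    {W : Set ℂ} (hP : DifferentiableOn ℂ P W) (hW : closedBall c r ⊆ W) :
    Real.circleAverage (fun z => (P z).re) c r = (P c).re := by
  have h1 : DiffContOnCl ℂ P (ball c |r|) := by
    rw [abs_of_nonneg hr]
    exact DifferentiableOn.diffContOnCl_ball (hP.mono hW) subset_rfl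
  have h2 : CircleIntegrable P c r :=
    ((hP.continuousOn.mono hW).mono sphere_subset_closedBall).circleIntegrable hr
  have := Complex.reCLM.circleAverage_comp_comm h2
  rw [h1.circleAverage] at this
  exact this

theorem continuousOn_circleIntegrable {f : ℂ → ℝ} {c : ℂ} {r : ℝ} (hr : 0 ≤ r)
    (hf : ContinuousOn f (sphere c r)) : CircleIntegrable f c r := hf.circleIntegrable hr

/-- The real part of `P` plays the role of the harmonic majorant with boundary values `f`. An entire
`P` is wanted, rather than a harmonic function, because `e^{-P/2}` will multiply holomorphic
sections. -/
theorem exists_entire_majorant {f : ℂ → ℝ} {c : ℂ} {r m : ℝ} (hr : 0 < r)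
    (hf : UpperSemicontinuousOn f (sphere c r)) (hm : ∀ z ∈ sphere c r, m ≤ f z) {ε : ℝ}
    (hε : 0 < ε) : ∃ P : ℂ → ℂ, Differentiable ℂ P ∧ (∀ z ∈ sphere c r, f z ≤ (P z).re) ∧
      (P c).re ≤ Real.circleAverage f c r + ε := by
  obtain ⟨φ, M, hφc, hφf, hφM, hφt⟩ := exists_continuous_approx_of_usc (isCompact_sphere c r)
    (NormedSpace.sphere_nonempty.2 hr.le) hf hm
  have hint : Filter.Tendsto (fun k => Real.circleAverage (φ k) c r) Filter.atTop
      (𝓝 (Real.circleAverage f c r)) := by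
    simp only [Real.circleAverage_def]
    refine Filter.Tendsto.const_smul ?_ _
    refine intervalIntegral.tendsto_integral_filter_of_dominated_convergence
      (fun _ => |M| + |m|) (Filter.Eventually.of_forall fun k => ?_)
      (Filter.Eventually.of_forall fun k => ?_) (by simp) ?_
    · exact ((hφc k).comp (continuous_circleMap c r)).aestronglyMeasurable
    · refine Filter.Eventually.of_forall fun θ _ => ?_
      have h1 := hφM k (circleMap c r θ)
      have h2 := hφf k _ (circleMap_mem_sphere c hr.le θ)
      have h3 := hm _ (circleMap_mem_sphere c hr.le θ)
      rw [Real.norm_eq_abs, abs_le]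
      constructor
      · linarith [neg_abs_le m, abs_nonneg M]
      · linarith [le_abs_self M, abs_nonneg m]
    · exact Filter.Eventually.of_forall fun θ _ => hφt _ (circleMap_mem_sphere c hr.le θ)
  obtain ⟨k, hk⟩ := (hint.eventually_lt_const (u := Real.circleAverage f c r + ε / 3)
    (by linarith)).exists
  obtain ⟨P, hP, hP'⟩ := exists_entire_approx (hφc k) c hr (ε := ε / 3) (by linarith)
  refine ⟨fun z => P z + (ε / 3 : ℝ), by fun_prop, fun z hz => ?_, ?_⟩
  · have h1 := hφf k z hz
    have h2 := (abs_lt.1 (hP' z hz)).1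
    simp only [Complex.add_re, Complex.ofReal_re]
    linarith
  · have h1 : (P c).re ≤ Real.circleAverage (φ k) c r + ε / 3 := by
      rw [← circleAverage_re_of_differentiableOn hr.le hP.differentiableOn (subset_univ _),
        ← sub_le_iff_le_add', ← Real.circleAverage_fun_sub
          (continuousOn_circleIntegrable (f := fun z => (P z).re) hr.le
            (Complex.continuous_re.comp hP.continuous).continuousOn)
          (continuousOn_circleIntegrable hr.le (hφc k).continuousOn)]
      refine Real.circleAverage_mono_on_of_le_circle ?_ ?_
      · exact continuousOn_circleIntegrable hr.le
          (((Complex.continuous_re.comp hP.continuous).sub (hφc k)).continuousOn)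
      · intro z hz
        rw [abs_of_pos hr] at hz
        exact (abs_lt.1 (hP' z hz)).2.le
    simp only [Complex.add_re, Complex.ofReal_re]
    linarith

/-- On the circle the integrand is a constant plus the real part of an affine function vanishing at
the centre. This quantifies the strict subharmonicity of the perturbation used in the maximum
principle. -/
theorem circleAverage_normSq_sub (c z : ℂ) {ρ : ℝ} (hρ : 0 ≤ ρ) :
    Real.circleAverage (fun y => ‖y - c‖ ^ 2) z ρ = ‖z - c‖ ^ 2 + ρ ^ 2 := by
  have h1 : Real.circleAverage (fun y => ‖y - c‖ ^ 2) z ρ =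
      Real.circleAverage (fun y => (((‖z - c‖ ^ 2 + ρ ^ 2 : ℝ) : ℂ) +
        2 * (conj (z - c) * (y - z))).re) z ρ := by
    refine Real.circleAverage_congr_sphere fun y hy => ?_
    rw [abs_of_nonneg hρ, mem_sphere_iff_norm] at hy
    have e : y - c = (z - c) + (y - z) := by ring
    simp only [← hy]
    rw [e, ← Complex.normSq_eq_norm_sq, ← Complex.normSq_eq_norm_sq, ← Complex.normSq_eq_norm_sq,
      Complex.normSq_add]
    have : (conj (z - c) * (y - z)).re = ((z - c) * conj (y - z)).re := by simp; ring
    simp only [Complex.add_re, Complex.ofReal_re, ← this]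
    simp
  rw [h1, circleAverage_re_of_differentiableOn hρ (W := univ) (by fun_prop) (subset_univ _)]
  simp only [sub_self, mul_zero, add_zero, Complex.ofReal_re]

theorem eventually_pos_closedBall_subset {D : Set ℂ} (hD : IsOpen D) {a : ℂ} (ha : a ∈ D) :
    ∀ᶠ ρ in 𝓝[>] (0 : ℝ), 0 < ρ ∧ closedBall a ρ ⊆ D := by
  obtain ⟨e, he, h⟩ := Metric.isOpen_iff.1 hD a ha
  filter_upwards [Ioo_mem_nhdsGT he] with ρ hρ
  exact ⟨hρ.1, (closedBall_subset_ball hρ.2).trans h⟩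

/-- A semicontinuous function which satisfies the submean value inequality up to `o(ρ²)` at the
interior points of a disc satisfies it on the disc. -/
theorem le_circleAverage_of_local {u : ℂ → ℝ} {c : ℂ} {r m : ℝ} (hr : 0 < r)
    (hu : UpperSemicontinuousOn u (closedBall c r)) (hm : ∀ z ∈ closedBall c r, m ≤ u z)
    (hloc : ∀ z ∈ ball c r, ∀ δ > 0, ∀ᶠ ρ in 𝓝[>] (0 : ℝ),
      u z ≤ Real.circleAverage u z ρ + δ * ρ ^ 2) :
    u c ≤ Real.circleAverage u c r := by
  refine le_of_forall_pos_le_add fun ε hε => ?_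
  obtain ⟨P, hP, hP1, hP2⟩ := exists_entire_majorant hr (hu.mono sphere_subset_closedBall)
    (fun z hz => hm z (sphere_subset_closedBall hz)) (half_pos hε)
  -- Chosen so that the perturbation `δ ‖z - c‖²` equals `ε / 2` on the boundary circle.
  set δ : ℝ := ε / 2 / r ^ 2 with hδdef
  have hδ : 0 < δ := by positivity
  let w : ℂ → ℝ := fun z => (-(P z).re + δ * ‖z - c‖ ^ 2)
  have hwc : Continuous w := by
    have := hP.continuous
    fun_prop
  have husc : UpperSemicontinuousOn (fun z => u z + w z) (closedBall c r) :=
    hu.add hwc.continuousOn.upperSemicontinuousOn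
  obtain ⟨a, ha, hamax⟩ := husc.exists_isMaxOn ⟨c, mem_closedBall_self hr.le⟩
    (isCompact_closedBall c r)
  have hδr : δ * r ^ 2 = ε / 2 := by rw [hδdef]; field_simp
  have hle : u a + w a ≤ ε / 2 := by
    -- At an interior maximum the perturbation raises the circle mean by `δ ρ²`, whereas the local
    -- inequality loses only `δ ρ² / 2`. So the maximum lies on the circle, where `u ≤ Re P`.
    by_cases hab : a ∈ ball c r
    · exfalso
      obtain ⟨ρ, h1, hρ, h2⟩ := ((hloc a hab (δ / 2) (half_pos hδ)).and
        (eventually_pos_closedBall_subset isOpen_ball hab)).exists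
      have h3 : sphere a ρ ⊆ closedBall c r :=
        (sphere_subset_closedBall.trans h2).trans ball_subset_closedBall
      have i1 : CircleIntegrable u a ρ :=
        circleIntegrable_of_usc hρ.le (hu.mono h3) fun z hz => hm z (h3 hz)
      have i2 : CircleIntegrable w a ρ := continuousOn_circleIntegrable hρ.le hwc.continuousOn
      have h4 : Real.circleAverage (fun z => u z + w z) a ρ ≤ u a + w a := by
        refine Real.circleAverage_mono_on_of_le_circle (i1.add i2) fun z hz => ?_
        rw [abs_of_pos hρ] at hz
        exact hamax (h3 hz)
      have h5 : Real.circleAverage w a ρ = w a + δ * ρ ^ 2 := by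
        have hPc := hP.continuous
        have e1 : Real.circleAverage w a ρ = Real.circleAverage (fun z => (-P z).re) a ρ +
            Real.circleAverage (fun z => δ * ‖z - c‖ ^ 2) a ρ := by
          rw [← Real.circleAverage_fun_add]
          · rfl
          · exact continuousOn_circleIntegrable hρ.le (by fun_prop)
          · exact continuousOn_circleIntegrable hρ.le (by fun_prop)
        have e2 : Real.circleAverage (fun z => δ * ‖z - c‖ ^ 2) a ρ =
            δ * (‖a - c‖ ^ 2 + ρ ^ 2) := by
          rw [← circleAverage_normSq_sub c a hρ.le]
          exact Real.circleAverage_fun_smul (a := δ)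
        rw [e1, e2, circleAverage_re_of_differentiableOn hρ.le (W := univ) (by fun_prop)
          (subset_univ _)]
        simp only [w, Complex.neg_re]
        ring
      rw [Real.circleAverage_fun_add i1 i2, h5] at h4
      have : 0 < δ / 2 * ρ ^ 2 := by positivity
      nlinarith
    · have hs : a ∈ sphere c r := by
        rw [mem_sphere]; rw [mem_closedBall] at ha; rw [mem_ball, not_lt] at hab
        exact le_antisymm ha hab
      have h1 := hP1 a hs
      rw [mem_sphere_iff_norm] at hs
      simp only [w, hs, hδr]
      linarith
  have h1 : u c + w c ≤ u a + w a := hamax (mem_closedBall_self hr.le)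
  simp only [w, sub_self, norm_zero] at h1 hle
  norm_num at h1
  linarith

end Circle

end

noncomputable section

/-! ### Averaging over rotations -/

section Rotation

open Metric Set

theorem measurePreserving_exp_smul (θ : ℝ) :
    MeasurePreserving (fun w : ℂ => Complex.exp (θ * Complex.I) • w) (volume : Measure ℂ)
      (volume : Measure ℂ) := by
  have e : (fun w : ℂ => Complex.exp (θ * Complex.I) • w) = rotation (Circle.exp θ) := by
    funext w
    simp [rotation_apply, Circle.coe_exp]
  rw [e]
  exact (rotation (Circle.exp θ)).measurePreserving

theorem measurePreserving_exp_smul_pi (n : ℕ) (θ : ℝ) :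
    MeasurePreserving (fun w : Fin n → ℂ => Complex.exp (θ * Complex.I) • w) volume volume :=
  volume_preserving_pi fun _ : Fin n => measurePreserving_exp_smul θ

/-- Each rotation preserves `μ`, so by Fubini the function may be replaced by its mean over
rotations. This turns integrals over discs and polydiscs into integrals of circle means. -/
theorem integral_eq_integral_rotation {V : Type*} [NormedAddCommGroup V] [NormedSpace ℂ V]
    [MeasurableSpace V] [BorelSpace V] [SecondCountableTopology V] {μ : Measure V} [SFinite μ]
    (hμ : ∀ θ : ℝ, MeasurePreserving (fun y : V => Complex.exp (θ * Complex.I) • y) μ μ)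
    {f : V → ℝ} (hf : Integrable f μ) :
    ∫ y, f y ∂μ = ∫ y, ((2 * Real.pi)⁻¹ *
        ∫ θ in (0)..(2 * Real.pi), f (Complex.exp (θ * Complex.I) • y)) ∂μ ∧
      Integrable (fun y => (2 * Real.pi)⁻¹ *
        ∫ θ in (0)..(2 * Real.pi), f (Complex.exp (θ * Complex.I) • y)) μ := by
  have hfin : IsFiniteMeasure (volume.restrict (uIoc 0 (2 * Real.pi))) := by
    rw [uIoc_of_le Real.two_pi_pos.le]; infer_instance
  have hmeas : Measurable (Function.uncurry fun (θ : ℝ) (y : V) =>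
      Complex.exp (θ * Complex.I) • y) := by
    refine Continuous.measurable ?_
    unfold Function.uncurry
    fun_prop
  have hint : Integrable (Function.uncurry fun (θ : ℝ) (y : V) =>
      f (Complex.exp (θ * Complex.I) • y)) ((volume.restrict (uIoc 0 (2 * Real.pi))).prod μ) := by
    have h1 : MeasurePreserving (fun p : ℝ × V => (p.1, Complex.exp (p.1 * Complex.I) • p.2))
        ((volume.restrict (uIoc 0 (2 * Real.pi))).prod μ)
        ((volume.restrict (uIoc 0 (2 * Real.pi))).prod μ) :=
      (MeasurePreserving.id _).skew_product (f := id) hmeas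
        (Filter.Eventually.of_forall fun θ => (hμ θ).map_eq)
    have h2 : Integrable (fun p : ℝ × V => f p.2)
        ((volume.restrict (uIoc 0 (2 * Real.pi))).prod μ) := hf.comp_snd _
    exact (h1.integrable_comp h2.aestronglyMeasurable).2 h2
  have hinv : ∀ θ : ℝ, ∫ y, f (Complex.exp (θ * Complex.I) • y) ∂μ = ∫ y, f y ∂μ := by
    intro θ
    refine (hμ θ).integral_comp ?_ f
    exact (Homeomorph.smulOfNeZero _ (Complex.exp_ne_zero (θ * Complex.I))).measurableEmbedding
  constructor
  · rw [integral_const_mul, ← intervalIntegral_integral_swap hint]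
    simp_rw [hinv]
    rw [intervalIntegral.integral_const, sub_zero, smul_eq_mul, ← mul_assoc,
      inv_mul_cancel₀ Real.two_pi_pos.ne', one_mul]
  · refine Integrable.const_mul ?_ _
    have := hint.integral_prod_right
    simpa only [intervalIntegral.integral_of_le Real.two_pi_pos.le,
      uIoc_of_le Real.two_pi_pos.le, Function.uncurry] using this

/-- A circle mean does not depend on the starting angle, so one may start at the argument of `w`. -/
theorem circleAverage_eq_integral_exp (f : ℂ → ℝ) (z w : ℂ) :
    Real.circleAverage f z ‖w‖ =
      (2 * Real.pi)⁻¹ * ∫ θ in (0)..(2 * Real.pi), f (z + Complex.exp (θ * Complex.I) * w) := by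
  rw [Real.circleAverage_eq_integral_add (Complex.arg w), smul_eq_mul]
  congr 1
  refine intervalIntegral.integral_congr fun θ _ => ?_
  simp only [circleMap]
  congr 2
  push_cast
  rw [add_mul, Complex.exp_add, mul_left_comm]
  rw [Complex.norm_mul_exp_arg_mul_I]

end Rotation

/-! ### Rotation invariant mollifiers -/

section Mollifier

open Metric Set

theorem exists_rotation_invariant_mollifier {ε : ℝ} (hε : 0 < ε) : ∃ ρ : ℂ → ℝ,
    ContDiff ℝ ∞ ρ ∧ HasCompactSupport ρ ∧ (∀ w, 0 ≤ ρ w) ∧ (∀ w, ε < ‖w‖ → ρ w = 0) ∧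
      ∫ w, ρ w = 1 ∧ ∀ (θ : ℝ) w, ρ (Complex.exp (θ * Complex.I) * w) = ρ w := by
  -- The bump is evaluated at `‖w‖²`, which is smooth at the origin; hence the squared radii.
  let ψ : ContDiffBump (0 : ℝ) := ⟨ε ^ 2 / 2, ε ^ 2, by positivity, by
    have : 0 < ε ^ 2 := by positivity
    linarith⟩
  let f : ℂ → ℝ := fun w => ψ (‖w‖ ^ 2)
  have hf : ContDiff ℝ ∞ f := ψ.contDiff.comp (contDiff_norm_sq ℝ)
  have hf0 : ∀ w, ε < ‖w‖ → f w = 0 := by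
    intro w hw
    refine ψ.zero_of_le_dist ?_
    rw [Real.dist_eq, sub_zero, abs_of_nonneg (by positivity)]
    change ε ^ 2 ≤ ‖w‖ ^ 2
    gcongr
  have hfc : HasCompactSupport f := by
    refine HasCompactSupport.intro (isCompact_closedBall 0 ε) fun w hw => hf0 w ?_
    simpa using hw
  have hpos : 0 < ∫ w, f w := by
    refine hf.continuous.integral_pos_of_hasCompactSupport_nonneg_nonzero (x := 0) hfc
      (fun w => ψ.nonneg) ?_
    have : f 0 = 1 := ψ.one_of_mem_closedBall (by
      simp only [norm_zero]
      norm_num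
      change 0 ≤ ε ^ 2 / 2
      positivity)
    rw [this]; exact one_ne_zero
  refine ⟨fun w => (∫ w, f w)⁻¹ * f w, contDiff_const.mul hf, hfc.mul_left,
    fun w => mul_nonneg (inv_nonneg.2 hpos.le) ψ.nonneg, fun w hw => by simp only [hf0 w hw, mul_zero],
    ?_, fun θ w => ?_⟩
  · rw [integral_const_mul, inv_mul_cancel₀ hpos.ne']
  · simp only [f, norm_mul, Complex.norm_exp_ofReal_mul_I, one_mul]

end Mollifier

end

noncomputable section

/-! ### Griffiths semi-negative matrix functions on plane domains -/

section GriffithsNeg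

open Metric Set Matrix
open scoped ComplexOrder MatrixOrder

variable {ι : Type*} [Fintype ι]

/-- A semi-positive Hermitian matrix function `g` on the plane domain `D`, upper semicontinuous
in the sense of forms, such that `|v|²_g` is subharmonic for every holomorphic `v`. -/
structure GriffithsNeg (g : ℂ → Matrix ι ι ℂ) (D : Set ℂ) : Prop where
  psd : ∀ z ∈ D, (g z).PosSemidef
  usc : ∀ z₀ ∈ D, ∀ δ > 0, ∀ᶠ z in 𝓝 z₀, ∀ v,
    quad (g z) v ≤ quad (g z₀) v + δ * ∑ i, ‖v i‖ ^ 2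
  submean : ∀ (c : ℂ) (r : ℝ) (W : Set ℂ) (v : ℂ → ι → ℂ), 0 < r → IsOpen W →
    closedBall c r ⊆ W → W ⊆ D → DifferentiableOn ℂ v W →
      quad (g c) (v c) ≤ Real.circleAverage (fun z => quad (g z) (v z)) c r

theorem GriffithsNeg.mono {g : ℂ → Matrix ι ι ℂ} {D D' : Set ℂ} (hg : GriffithsNeg g D)
    (h : D' ⊆ D) : GriffithsNeg g D' where
  psd z hz := hg.psd z (h hz)
  usc z hz := hg.usc z (h hz)
  submean c r W v hr hW hc hWD hv := hg.submean c r W v hr hW hc (hWD.trans h) hv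

theorem continuous_quad (M : Matrix ι ι ℂ) : Continuous (quad M) := by
  unfold quad; fun_prop

theorem ContinuousOn.quad {Y : Type*} [TopologicalSpace Y] {g : Y → Matrix ι ι ℂ} {v : Y → ι → ℂ}
    {s : Set Y} (hg : ∀ i j, ContinuousOn (fun y => g y i j) s) (hv : ContinuousOn v s) :
    ContinuousOn (fun y => quad (g y) (v y)) s := by
  have hv' := continuousOn_pi.1 hv
  refine Complex.continuous_re.comp_continuousOn ?_
  refine continuousOn_finsetSum _ fun i _ => continuousOn_finsetSum _ fun j _ => ?_
  exact ((Complex.continuous_conj.comp_continuousOn (hv' i)).mul (hg i j)).mul (hv' j)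

theorem upperSemicontinuousWithinAt_quad {Y : Type*} [TopologicalSpace Y] {g : Y → Matrix ι ι ℂ}
    {v : Y → ι → ℂ} {s : Set Y} {y₀ : Y}
    (hg : ∀ δ > 0, ∀ᶠ y in 𝓝[s] y₀, ∀ v, quad (g y) v ≤ quad (g y₀) v + δ * ∑ i, ‖v i‖ ^ 2)
    (hv : ContinuousWithinAt v s y₀) :
    UpperSemicontinuousWithinAt (fun y => quad (g y) (v y)) s y₀ := by
  intro a ha
  set S := ∑ i, ‖v y₀ i‖ ^ 2 with hS
  obtain ⟨δ, hδ, hδ'⟩ : ∃ δ : ℝ, 0 < δ ∧ quad (g y₀) (v y₀) + δ * S < a := by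
    have h1 : Filter.Tendsto (fun δ : ℝ => quad (g y₀) (v y₀) + δ * S) (𝓝[>] 0)
        (𝓝 (quad (g y₀) (v y₀) + 0 * S)) :=
      tendsto_nhdsWithin_of_tendsto_nhds (Continuous.tendsto (by fun_prop) 0)
    obtain ⟨δ, h3, h4⟩ := ((h1.eventually_lt_const (u := a) (by simpa using ha)).and
      self_mem_nhdsWithin).exists
    exact ⟨δ, h4, h3⟩
  have hc : Continuous fun w : ι → ℂ => quad (g y₀) w + δ * ∑ i, ‖w i‖ ^ 2 := by
    have := continuous_quad (g y₀)
    fun_prop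
  have h2 := (hc.continuousAt.tendsto.comp hv).eventually_lt_const hδ'
  filter_upwards [hg δ hδ, h2] with y h3 h4
  exact (h3 (v y)).trans_lt h4

theorem GriffithsNeg.usc_quad {g : ℂ → Matrix ι ι ℂ} {D : Set ℂ} (hg : GriffithsNeg g D)
    {s : Set ℂ} (hs : s ⊆ D) {v : ℂ → ι → ℂ} (hv : ContinuousOn v s) :
    UpperSemicontinuousOn (fun z => quad (g z) (v z)) s := fun z hz =>
  upperSemicontinuousWithinAt_quad
    (fun δ hδ => nhdsWithin_le_nhds (hg.usc z (hs hz) δ hδ)) (hv z hz)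

theorem GriffithsNeg.circleIntegrable {g : ℂ → Matrix ι ι ℂ} {D : Set ℂ} (hg : GriffithsNeg g D)
    {c : ℂ} {r : ℝ} (hr : 0 ≤ r) (hc : sphere c r ⊆ D) {v : ℂ → ι → ℂ}
    (hv : ContinuousOn v (sphere c r)) : CircleIntegrable (fun z => quad (g z) (v z)) c r :=
  circleIntegrable_of_usc (m := 0) hr (hg.usc_quad hc hv) fun z hz =>
    (hg.psd z (hc hz)).quad_nonneg _

/-- The mean value property of `f²` and the triangle inequality for integrals. -/
theorem norm_sq_le_circleAverage {f : ℂ → ℂ} {c : ℂ} {r : ℝ} (hr : 0 < r) {W : Set ℂ}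
    (hf : DifferentiableOn ℂ f W) (hW : closedBall c r ⊆ W) :
    ‖f c‖ ^ 2 ≤ Real.circleAverage (fun z => ‖f z‖ ^ 2) c r := by
  have h1 : DiffContOnCl ℂ (fun z => f z ^ 2) (ball c |r|) := by
    rw [abs_of_pos hr]
    exact DifferentiableOn.diffContOnCl_ball ((hf.pow 2).mono hW) subset_rfl
  have h2 := h1.circleAverage
  rw [← norm_pow, ← h2, Real.circleAverage_def, Real.circleAverage_def, norm_smul, smul_eq_mul,
    norm_inv, Real.norm_of_nonneg Real.two_pi_pos.le]
  gcongr
  refine (intervalIntegral.norm_integral_le_integral_norm Real.two_pi_pos.le).trans_eq ?_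
  simp

/-- The flat model: for holomorphic `C` and `v` the squared norm is the sum of the `|(C v)_b|²`. -/
theorem GriffithsNeg.of_factor {κ : Type*} [Fintype κ] {C : ℂ → Matrix κ ι ℂ}
    (hC : ∀ i j, Differentiable ℂ fun z => C z i j) (D : Set ℂ) :
    GriffithsNeg (fun z => (C z)ᴴ * C z) D where
  psd z _ := posSemidef_conjTranspose_mul_self _
  usc z₀ _ δ hδ := by
    refine eventually_quad_le (Filter.Eventually.of_forall fun z =>
      posSemidef_conjTranspose_mul_self _) (fun v a ha => ?_) hδ
    have hc : Continuous fun z => quad ((C z)ᴴ * C z) v := by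
      simp only [quad_factor]
      have := fun i j => (hC i j).continuous
      fun_prop
    exact hc.continuousAt.tendsto.eventually_lt_const ha
  submean c r W v hr _ hc _ hv := by
    have hv' := differentiableOn_pi.1 hv
    have hd : ∀ b, DifferentiableOn ℂ (fun z => ∑ i, C z b i * v z i) W := fun b =>
      DifferentiableOn.fun_sum fun i _ => (hC b i).differentiableOn.mul (hv' i)
    simp only [quad_factor]
    rw [Real.circleAverage_fun_sum]
    · exact Finset.sum_le_sum fun b _ => norm_sq_le_circleAverage hr (hd b) hc
    · intro b _
      exact continuousOn_circleIntegrable hr.le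
        ((((hd b).continuousOn.norm.pow 2).mono hc).mono sphere_subset_closedBall)

theorem GriffithsNeg.add {g h : ℂ → Matrix ι ι ℂ} {D : Set ℂ} (hg : GriffithsNeg g D)
    (hh : GriffithsNeg h D) : GriffithsNeg (fun z => g z + h z) D where
  psd z hz := (hg.psd z hz).add (hh.psd z hz)
  usc z₀ hz₀ δ hδ := by
    filter_upwards [hg.usc z₀ hz₀ (δ / 2) (half_pos hδ), hh.usc z₀ hz₀ (δ / 2) (half_pos hδ)]
      with z h1 h2 v
    rw [quad_add, quad_add]
    linarith [h1 v, h2 v]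
  submean c r W v hr hW hc hWD hv := by
    have hs : sphere c r ⊆ W := sphere_subset_closedBall.trans hc
    simp only [quad_add]
    rw [Real.circleAverage_fun_add (hg.circleIntegrable hr.le (hs.trans hWD)
      (hv.continuousOn.mono hs)) (hh.circleIntegrable hr.le (hs.trans hWD)
      (hv.continuousOn.mono hs))]
    exact add_le_add (hg.submean c r W v hr hW hc hWD hv) (hh.submean c r W v hr hW hc hWD hv)

theorem GriffithsNeg.smul_one [DecidableEq ι] (η : ℝ) (hη : 0 ≤ η) (D : Set ℂ) :
    GriffithsNeg (fun _ => (η • 1 : Matrix ι ι ℂ)) D := by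
  have h := GriffithsNeg.of_factor (ι := ι) (C := fun _ => (Real.sqrt η • 1 : Matrix ι ι ℂ))
    (fun i j => differentiable_const _) D
  convert h using 2
  rw [conjTranspose_smul, conjTranspose_one, smul_mul_smul_comm, one_mul]
  simp [Real.mul_self_sqrt hη]

theorem quad_integral {α : Type*} [MeasurableSpace α] {μ : Measure α} {F : α → Matrix ι ι ℂ}
    (hF : ∀ i j, Integrable (fun a => F a i j) μ) (v : ι → ℂ) :
    quad (Matrix.of fun i j => ∫ a, F a i j ∂μ) v = ∫ a, quad (F a) v ∂μ := by
  have h1 : ∀ i j, Integrable (fun a => conj (v i) * F a i j * v j) μ := fun i j =>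
    ((hF i j).const_mul _).mul_const _
  have h2 : Integrable (fun a => ∑ i, ∑ j, conj (v i) * F a i j * v j) μ :=
    integrable_finsetSum _ fun i _ => integrable_finsetSum _ fun j _ => h1 i j
  have h3 := integral_re h2
  simp only [RCLike.re_to_complex] at h3
  simp only [quad, of_apply]
  rw [h3, integral_finsetSum _ fun i _ => integrable_finsetSum _ fun j _ => h1 i j]
  congr 1
  refine Finset.sum_congr rfl fun i _ => ?_
  rw [integral_finsetSum _ fun j _ => h1 i j]
  refine Finset.sum_congr rfl fun j _ => ?_
  rw [integral_mul_const, integral_const_mul]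

theorem Matrix.PosSemidef.norm_apply_le [DecidableEq ι] {M : Matrix ι ι ℂ} (hM : M.PosSemidef)
    (i j : ι) : ‖M i j‖ ≤ quad M (Pi.single i 1 + Pi.single j 1) +
      quad M (Pi.single i 1 + Pi.single j Complex.I) + 2 * quad M (Pi.single i 1 + Pi.single j 0) +
      2 * quad M (Pi.single i 0 + Pi.single j 1) := by
  refine (Complex.norm_le_abs_re_add_abs_im _).trans ?_
  rw [hM.1.re_apply_eq, hM.1.im_apply_eq]
  have h1 := hM.quad_nonneg (Pi.single i 1 + Pi.single j 1)
  have h2 := hM.quad_nonneg (Pi.single i 1 + Pi.single j Complex.I)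
  have h3 := hM.quad_nonneg (Pi.single i 1 + Pi.single j 0)
  have h4 := hM.quad_nonneg (Pi.single i 0 + Pi.single j 1)
  generalize quad M (Pi.single i 1 + Pi.single j 1) = a at *
  generalize quad M (Pi.single i 1 + Pi.single j Complex.I) = b at *
  generalize quad M (Pi.single i 1 + Pi.single j 0) = c at *
  generalize quad M (Pi.single i 0 + Pi.single j 1) = d at *
  have e1 : |(a - c - d) / 2| ≤ a + c + d := by rw [abs_le]; constructor <;> linarith
  have e2 : |-(b - c - d) / 2| ≤ b + c + d := by rw [abs_le]; constructor <;> linarith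
  linarith

theorem tendsto_apply_of_tendsto_quad {β : Type*} {l : Filter β} {G : β → Matrix ι ι ℂ}
    {K : Matrix ι ι ℂ} (hG : ∀ b, (G b).IsHermitian) (hK : K.IsHermitian)
    (h : ∀ v, Filter.Tendsto (fun b => quad (G b) v) l (𝓝 (quad K v))) (i j : ι) :
    Filter.Tendsto (fun b => G b i j) l (𝓝 (K i j)) := by
  classical
  have h1 : Filter.Tendsto (fun b => (((G b i j).re : ℝ) : ℂ) + ((G b i j).im : ℝ) * Complex.I) l
      (𝓝 (((K i j).re : ℝ) + ((K i j).im : ℝ) * Complex.I)) := by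
    simp only [(hG _).re_apply_eq i j, (hG _).im_apply_eq i j, hK.re_apply_eq i j,
      hK.im_apply_eq i j]
    refine Filter.Tendsto.add ?_ (Filter.Tendsto.mul_const _ ?_)
    · exact (Complex.continuous_ofReal.tendsto _).comp ((((h _).sub (h _)).sub (h _)).div_const 2)
    · exact (Complex.continuous_ofReal.tendsto _).comp
        ((((h _).sub (h _)).sub (h _)).neg.div_const 2)
  simpa only [Complex.re_add_im] using h1

theorem measurable_apply_of_measurable_quad {β : Type*} [MeasurableSpace β]
    {G : β → Matrix ι ι ℂ} (hG : ∀ b, (G b).IsHermitian)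
    (h : ∀ v, Measurable fun b => quad (G b) v) (i j : ι) : Measurable fun b => G b i j := by
  classical
  have h1 : Measurable fun b => (((G b i j).re : ℝ) : ℂ) + ((G b i j).im : ℝ) * Complex.I := by
    simp only [(hG _).re_apply_eq i j, (hG _).im_apply_eq i j]
    have := fun v => h v
    fun_prop
  simpa only [Complex.re_add_im] using h1

end GriffithsNeg

end

noncomputable section

/-! ### Regularization of Griffiths semi-negative matrix functions -/

section Regularization

open Metric Set Matrix
open scoped ComplexOrder MatrixOrder

variable {ι : Type*} [Fintype ι]

theorem bddAbove_of_usc_of_compact_support {f : ℂ → ℝ} {K : Set ℂ} (hK : IsCompact K)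
    (hf : UpperSemicontinuous f) (h0 : ∀ z ∉ K, f z = 0) : ∃ B, 0 ≤ B ∧ ∀ z, f z ≤ B := by
  obtain ⟨B, hB⟩ := (hf.upperSemicontinuousOn K).bddAbove_of_isCompact hK
  refine ⟨max B 0, le_max_right _ _, fun z => ?_⟩
  by_cases hz : z ∈ K
  · exact (hB (mem_image_of_mem f hz)).trans (le_max_left _ _)
  · rw [h0 z hz]; exact le_max_right _ _

/-- The mollification of a matrix function. -/
def mollify (ρ : ℂ → ℝ) (g : ℂ → Matrix ι ι ℂ) (z : ℂ) : Matrix ι ι ℂ :=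
  Matrix.of fun i j => ∫ w, (ρ w : ℂ) * g (z - w) i j

/-- A bounded measurable semi-positive matrix function with compact support. -/
structure IsTame (g : ℂ → Matrix ι ι ℂ) (C : ℝ) : Prop where
  psd : ∀ z, (g z).PosSemidef
  meas : ∀ i j, Measurable fun z => g z i j
  bound : ∀ z i j, ‖g z i j‖ ≤ C

/-! ### Mollification of bounded semi-positive matrix functions -/

section Tame

variable {g : ℂ → Matrix ι ι ℂ} {C : ℝ} {ρ : ℂ → ℝ}

theorem IsTame.integrable (hg : IsTame g C) (hρ : Continuous ρ) (hρc : HasCompactSupport ρ)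
    (z : ℂ) (i j : ι) : Integrable fun w => (ρ w : ℂ) * g (z - w) i j := by
  have h1 : Integrable fun w => (ρ w : ℂ) :=
    (hρ.integrable_of_hasCompactSupport hρc).ofReal
  refine h1.mul_bdd (c := C) ?_ (Filter.Eventually.of_forall fun w => hg.bound _ i j)
  exact ((hg.meas i j).comp (measurable_const.sub measurable_id)).aestronglyMeasurable

theorem IsTame.quad_mollify (hg : IsTame g C) (hρ : Continuous ρ) (hρc : HasCompactSupport ρ)
    (z : ℂ) (v : ι → ℂ) : quad (mollify ρ g z) v = ∫ w, ρ w * quad (g (z - w)) v := by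
  have h1 : mollify ρ g z = Matrix.of fun i j => ∫ w, (ρ w • g (z - w)) i j := by
    ext i j
    simp [mollify]
  rw [h1, quad_integral (F := fun w => ρ w • g (z - w))]
  · simp only [quad_smul]
  · intro i j
    simpa using hg.integrable hρ hρc z i j

theorem IsTame.measurable_quad (hg : IsTame g C) (v : ι → ℂ) :
    Measurable fun z => quad (g z) v := by
  have := hg.meas
  unfold quad
  refine Complex.measurable_re.comp ?_
  fun_prop

theorem IsTame.quad_le (hg : IsTame g C) (v : ι → ℂ) (z : ℂ) :
    ‖quad (g z) v‖ ≤ ∑ i, ∑ j, ‖v i‖ * C * ‖v j‖ := by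
  unfold quad
  rw [Real.norm_eq_abs]
  refine (Complex.abs_re_le_norm _).trans ?_
  refine (norm_sum_le _ _).trans (Finset.sum_le_sum fun i _ => ?_)
  refine (norm_sum_le _ _).trans (Finset.sum_le_sum fun j _ => ?_)
  rw [norm_mul, norm_mul, RCLike.norm_conj]
  gcongr
  exact hg.bound z i j

theorem IsTame.integrable_quad (hg : IsTame g C) (hρ : Continuous ρ) (hρc : HasCompactSupport ρ)
    (z : ℂ) (v : ι → ℂ) : Integrable fun w => ρ w * quad (g (z - w)) v := by
  refine (hρ.integrable_of_hasCompactSupport hρc).mul_bdd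
    (c := ∑ i, ∑ j, ‖v i‖ * C * ‖v j‖) ?_
    (Filter.Eventually.of_forall fun w => hg.quad_le v _)
  exact ((hg.measurable_quad v).comp (measurable_const.sub measurable_id)).aestronglyMeasurable

theorem IsTame.mollify_psd (hg : IsTame g C) (hρ : Continuous ρ) (hρc : HasCompactSupport ρ)
    (h0 : ∀ w, 0 ≤ ρ w) (z : ℂ) : (mollify ρ g z).PosSemidef := by
  refine posSemidef_of_quad_nonneg ?_ fun v => ?_
  · ext i j
    rw [conjTranspose_apply, RCLike.star_def]
    simp only [mollify, of_apply]
    rw [← integral_conj]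
    refine integral_congr_ae (Filter.Eventually.of_forall fun w => ?_)
    have := (hg.psd (z - w)).1.apply i j
    simp only [map_mul, Complex.conj_ofReal, ← this, RCLike.star_def]
  · rw [hg.quad_mollify hρ hρc]
    exact integral_nonneg fun w => mul_nonneg (h0 w) ((hg.psd _).quad_nonneg v)

theorem IsTame.contDiff_mollify (hg : IsTame g C) (hρ : ContDiff ℝ ∞ ρ)
    (hρc : HasCompactSupport ρ) (i j : ι) : ContDiff ℝ ∞ fun z => mollify ρ g z i j := by
  have h2 : LocallyIntegrable (fun z => g z i j) volume := by
    refine (locallyIntegrable_const C).mono (hg.meas i j).aestronglyMeasurable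
      (Filter.Eventually.of_forall fun z => ?_)
    exact (hg.bound z i j).trans (le_abs_self C)
  have h3 := hρc.contDiff_convolution_left (n := ⊤) (ContinuousLinearMap.lsmul ℝ ℝ) hρ h2
  convert h3 using 2 with z
  simp [mollify, convolution_def]

theorem IsTame.mollify_bound (hg : IsTame g C) (hρ : Continuous ρ) (hρc : HasCompactSupport ρ)
    (h0 : ∀ w, 0 ≤ ρ w) (h1 : ∫ w, ρ w = 1) (z : ℂ) (i j : ι) : ‖mollify ρ g z i j‖ ≤ C := by
  simp only [mollify, of_apply]
  refine (norm_integral_le_integral_norm _).trans ?_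
  have : ∫ w, ρ w * C = C := by rw [integral_mul_const, h1, one_mul]
  rw [← this]
  refine integral_mono_of_nonneg (Filter.Eventually.of_forall fun w => norm_nonneg _)
    ((hρ.integrable_of_hasCompactSupport hρc).mul_const C)
    (Filter.Eventually.of_forall fun w => ?_)
  simp only [norm_mul, Complex.norm_real, Real.norm_of_nonneg (h0 w)]
  exact mul_le_mul_of_nonneg_left (hg.bound _ _ _) (h0 w)

/-- For a rotation-invariant kernel the convolution is a weighted mean of the means over circles
about `z`, and each of these is at least the value at `z`. -/
theorem IsTame.le_quad_mollify (hg : IsTame g C) (hρ : Continuous ρ) (hρc : HasCompactSupport ρ)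
    (h0 : ∀ w, 0 ≤ ρ w) (h1 : ∫ w, ρ w = 1)
    (hrot : ∀ (θ : ℝ) w, ρ (Complex.exp (θ * Complex.I) * w) = ρ w) {ε : ℝ}
    (hsupp : ∀ w, ε < ‖w‖ → ρ w = 0) {z : ℂ} {v : ι → ℂ}
    (hsub : ∀ s, 0 < s → s ≤ ε →
      quad (g z) v ≤ Real.circleAverage (fun y => quad (g y) v) z s) :
    quad (g z) v ≤ quad (mollify ρ g z) v := by
  rw [hg.quad_mollify hρ hρc]
  obtain ⟨e1, e2⟩ := integral_eq_integral_rotation measurePreserving_exp_smul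
    (hg.integrable_quad hρ hρc z v)
  rw [e1]
  have e3 : quad (g z) v = ∫ w, ρ w * quad (g z) v := by
    rw [integral_mul_const, h1, one_mul]
  rw [e3]
  refine integral_mono ((hρ.integrable_of_hasCompactSupport hρc).mul_const _) e2 fun w => ?_
  simp only [smul_eq_mul, hrot, intervalIntegral.integral_const_mul]
  rw [mul_left_comm]
  by_cases hw : ε < ‖w‖
  · simp [hsupp w hw]
  refine mul_le_mul_of_nonneg_left ?_ (h0 w)
  have e4 := circleAverage_eq_integral_exp (fun y => quad (g y) v) z (-w)
  simp only [mul_neg, ← sub_eq_add_neg, norm_neg] at e4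
  rw [← e4]
  rcases eq_or_ne w 0 with rfl | hw0
  · simp
  · exact hsub _ (norm_pos_iff.2 hw0) (not_lt.1 hw)

/-- The convolution is a mean of values on the `ε`-disc. With upper semicontinuity this supplies the
upper half of the pointwise convergence. -/
theorem IsTame.quad_mollify_le (hg : IsTame g C) (hρ : Continuous ρ) (hρc : HasCompactSupport ρ)
    (h0 : ∀ w, 0 ≤ ρ w) (h1 : ∫ w, ρ w = 1) {ε : ℝ} (hsupp : ∀ w, ε < ‖w‖ → ρ w = 0) {z : ℂ}
    {v : ι → ℂ} {a : ℝ} (ha : ∀ y ∈ closedBall z ε, quad (g y) v ≤ a) :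
    quad (mollify ρ g z) v ≤ a := by
  rw [hg.quad_mollify hρ hρc]
  have e3 : a = ∫ w, ρ w * a := by
    rw [integral_mul_const, h1, one_mul]
  rw [e3]
  refine integral_mono (hg.integrable_quad hρ hρc z v)
    ((hρ.integrable_of_hasCompactSupport hρc).mul_const _) fun w => ?_
  by_cases hw : ε < ‖w‖
  · simp [hsupp w hw]
  · exact mul_le_mul_of_nonneg_left (ha _ (by simpa using hw)) (h0 w)

/-- The convolution superposes translates of `g`, and a translate of `g` satisfies the submean
inequality with the translated section `v(· + w)`, still holomorphic. Fubini exchanges the two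
means. -/
theorem IsTame.submean_mollify (hg : IsTame g C) (hρ : Continuous ρ) (hρc : HasCompactSupport ρ)
    (h0 : ∀ w, 0 ≤ ρ w) {ε : ℝ} (hsupp : ∀ w, ε < ‖w‖ → ρ w = 0) {D : Set ℂ}
    (hgD : GriffithsNeg g D) {c : ℂ} {r : ℝ} {W : Set ℂ} {v : ℂ → ι → ℂ} (hr : 0 < r)
    (hW : IsOpen W) (hc : closedBall c r ⊆ W) (hWD : ∀ z ∈ W, closedBall z ε ⊆ D)
    (hv : DifferentiableOn ℂ v W) :
    quad (mollify ρ g c) (v c) ≤ Real.circleAverage (fun z => quad (mollify ρ g z) (v z)) c r := by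
  have hC : 0 ≤ C ∨ IsEmpty ι := by
    by_cases h : Nonempty ι
    · exact Or.inl ((norm_nonneg _).trans (hg.bound 0 h.some h.some))
    · exact Or.inr (not_nonempty_iff.1 h)
  have hs : sphere c r ⊆ W := sphere_subset_closedBall.trans hc
  have hvc : Continuous fun θ : ℝ => v (circleMap c r θ) := by
    rw [← continuousOn_univ]
    exact hv.continuousOn.comp (continuous_circleMap c r).continuousOn
      fun θ _ => hs (circleMap_mem_sphere c hr.le θ)
  have hvb : ∃ B, ∀ θ : ℝ, ∑ i, ∑ j, ‖v (circleMap c r θ) i‖ * C * ‖v (circleMap c r θ) j‖ ≤ B := by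
    have h1 : ContinuousOn (fun z => ∑ i, ∑ j, ‖v z i‖ * C * ‖v z j‖) (sphere c r) := by
      have := continuousOn_pi.1 (hv.continuousOn.mono hs)
      fun_prop
    obtain ⟨B, hB⟩ := (isCompact_sphere c r).bddAbove_image h1
    exact ⟨B, fun θ => hB (mem_image_of_mem _ (circleMap_mem_sphere c hr.le θ))⟩
  obtain ⟨B, hB⟩ := hvb
  have hint : Integrable (Function.uncurry fun (θ : ℝ) (w : ℂ) =>
      ρ w * quad (g (circleMap c r θ - w)) (v (circleMap c r θ)))
      ((volume.restrict (uIoc 0 (2 * Real.pi))).prod volume) := by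
    have hfin : IsFiniteMeasure (volume.restrict (uIoc 0 (2 * Real.pi))) := by
      rw [uIoc_of_le Real.two_pi_pos.le]; infer_instance
    have h1 : Integrable (fun p : ℝ × ℂ => ρ p.2)
        ((volume.restrict (uIoc 0 (2 * Real.pi))).prod volume) :=
      (hρ.integrable_of_hasCompactSupport hρc).comp_snd _
    refine h1.mul_bdd (c := B) ?_ (Filter.Eventually.of_forall fun p =>
      (hg.quad_le _ _).trans (hB p.1))
    refine Measurable.aestronglyMeasurable ?_
    have hm1 : Measurable fun p : ℝ × ℂ => circleMap c r p.1 - p.2 :=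
      (((continuous_circleMap c r).comp continuous_fst).sub continuous_snd).measurable
    have hm2 : ∀ i, Measurable fun p : ℝ × ℂ => v (circleMap c r p.1) i := fun i =>
      ((continuous_apply i).comp (hvc.comp continuous_fst)).measurable
    have hm3 := fun i j => (hg.meas i j).comp hm1
    simp only [Function.comp_def] at hm3
    unfold quad
    refine Complex.measurable_re.comp ?_
    refine Finset.measurable_fun_sum _ fun i _ => Finset.measurable_fun_sum _ fun j _ => ?_
    exact ((Complex.continuous_conj.measurable.comp (hm2 i)).mul (hm3 i j)).mul (hm2 j)
  have e1 : Real.circleAverage (fun z => quad (mollify ρ g z) (v z)) c r =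
      ∫ w, (2 * Real.pi)⁻¹ * ∫ θ in (0)..(2 * Real.pi),
        ρ w * quad (g (circleMap c r θ - w)) (v (circleMap c r θ)) := by
    rw [integral_const_mul, ← intervalIntegral_integral_swap hint, Real.circleAverage_def,
      smul_eq_mul]
    simp only [hg.quad_mollify hρ hρc]
  rw [e1, hg.quad_mollify hρ hρc]
  refine integral_mono (hg.integrable_quad hρ hρc c _) ?_ fun w => ?_
  · refine Integrable.const_mul ?_ _
    have := hint.integral_prod_right
    simpa only [intervalIntegral.integral_of_le Real.two_pi_pos.le,
      uIoc_of_le Real.two_pi_pos.le, Function.uncurry] using this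
  · simp only [intervalIntegral.integral_const_mul]
    rw [mul_left_comm]
    by_cases hw : ε < ‖w‖
    · simp [hsupp w hw]
    refine mul_le_mul_of_nonneg_left ?_ (h0 w)
    rw [not_lt] at hw
    have h2 := hgD.submean (c - w) r ((fun z => z + w) ⁻¹' W) (fun z => v (z + w)) hr
      (hW.preimage (by fun_prop)) (fun z hz => hc (by
        rw [mem_closedBall_iff_norm] at hz ⊢
        convert hz using 2; ring))
      (fun z hz => hWD _ hz (by simpa using hw))
      (hv.comp (by fun_prop) fun z hz => hz)
    rw [Real.circleAverage_def, smul_eq_mul] at h2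
    have e2 : ∀ θ, circleMap (c - w) r θ = circleMap c r θ - w := fun θ => by
      simp only [circleMap]; ring
    simpa only [e2, sub_add_cancel] using h2

end Tame

/-- Convolution gives smoothness, and the added multiple of the identity gives definiteness. The
convergence holds at every point of the disc, not only almost everywhere, which is what the
inequality at the centre needs in the limit. -/
theorem GriffithsNeg.exists_smooth_approx {g : ℂ → Matrix ι ι ℂ} {D : Set ℂ}
    (hg : GriffithsNeg g D) (hD : IsOpen D) {c : ℂ} {r : ℝ} (hr : 0 < r)
    (hc : closedBall c r ⊆ D) :
    ∃ (G : ℕ → ℂ → Matrix ι ι ℂ) (R C : ℝ), r < R ∧ (∀ k, GriffithsNeg (G k) (ball c R)) ∧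
      (∀ k i j, Differentiable ℝ fun z => G k z i j) ∧ (∀ k z, (G k z).PosDef) ∧
      (∀ z ∈ closedBall c r, ∀ i j,
        Filter.Tendsto (fun k => G k z i j) Filter.atTop (𝓝 (g z i j))) ∧
      ∀ k z i j, ‖G k z i j‖ ≤ C := by
  classical
  obtain ⟨δ, hδ, hδD⟩ := (isCompact_closedBall c r).exists_cthickening_subset_open hD hc
  rw [cthickening_closedBall hδ.le hr.le] at hδD
  set K := closedBall c (δ + r) with hK
  -- Extension by zero from a closed disc keeps upper semicontinuity, because the forms are
  -- semi-positive and so can only drop on leaving the disc.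
  set gh : ℂ → Matrix ι ι ℂ := K.indicator g with hgh
  have gh_eq : ∀ z ∈ K, gh z = g z := fun z hz => indicator_of_mem hz g
  have gh_eq0 : ∀ z ∉ K, gh z = 0 := fun z hz => indicator_of_notMem hz g
  have hpsd : ∀ z, (gh z).PosSemidef := by
    intro z
    by_cases hz : z ∈ K
    · rw [gh_eq z hz]; exact hg.psd z (hδD hz)
    · rw [gh_eq0 z hz]; exact PosSemidef.zero
  have husc : ∀ z₀, ∀ η > 0, ∀ᶠ z in 𝓝 z₀, ∀ v,
      quad (gh z) v ≤ quad (gh z₀) v + η * ∑ i, ‖v i‖ ^ 2 := by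
    intro z₀ η hη
    by_cases hz₀ : z₀ ∈ K
    · filter_upwards [hg.usc z₀ (hδD hz₀) η hη] with z hz v
      by_cases hzK : z ∈ K
      · rw [gh_eq z hzK, gh_eq z₀ hz₀]; exact hz v
      · rw [gh_eq0 z hzK, quad_zero]
        have := (hpsd z₀).quad_nonneg v
        positivity
    · filter_upwards [isClosed_closedBall.isOpen_compl.mem_nhds hz₀] with z hz v
      rw [gh_eq0 z hz, gh_eq0 z₀ hz₀, quad_zero]
      positivity
  have huscv : ∀ v, UpperSemicontinuous fun z => quad (gh z) v := by
    intro v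
    rw [← upperSemicontinuousOn_univ_iff]
    intro z₀ _
    exact upperSemicontinuousWithinAt_quad (v := fun _ => v)
      (fun η hη => nhdsWithin_le_nhds (husc z₀ η hη)) continuousWithinAt_const
  have hbdv : ∀ v, ∃ B, 0 ≤ B ∧ ∀ z, quad (gh z) v ≤ B := fun v =>
    bddAbove_of_usc_of_compact_support (isCompact_closedBall c (δ + r)) (huscv v) fun z hz => by
      rw [gh_eq0 z hz, quad_zero]
  choose B _ hB using hbdv
  obtain ⟨C, hC⟩ := (Set.finite_range fun p : ι × ι => B (Pi.single p.1 1 + Pi.single p.2 1) +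
      B (Pi.single p.1 1 + Pi.single p.2 Complex.I) + 2 * B (Pi.single p.1 1 + Pi.single p.2 0) +
      2 * B (Pi.single p.1 0 + Pi.single p.2 1)).bddAbove
  have htame : IsTame gh C := by
    refine ⟨hpsd, fun i j => measurable_apply_of_measurable_quad (fun z => (hpsd z).1)
      (fun v => (huscv v).measurable) i j, fun z i j => ?_⟩
    refine ((hpsd z).norm_apply_le i j).trans (le_trans ?_ (hC (mem_range_self (i, j))))
    have := hB (Pi.single i 1 + Pi.single j 1) z
    have := hB (Pi.single i 1 + Pi.single j Complex.I) z
    have := hB (Pi.single i 1 + Pi.single j 0) z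
    have := hB (Pi.single i 0 + Pi.single j 1) z
    dsimp only
    linarith
  have hghD : GriffithsNeg gh K := by
    refine ⟨fun z _ => hpsd z, fun z _ => husc z, fun c' r' W v hr' hW hc' hWD hv => ?_⟩
    have h1 := hg.submean c' r' W v hr' hW hc' (hWD.trans hδD) hv
    rw [gh_eq c' (hWD (hc' (mem_closedBall_self hr'.le)))]
    refine h1.trans_eq (Real.circleAverage_congr_sphere fun z hz => ?_)
    rw [abs_of_pos hr'] at hz
    simp only [gh_eq z (hWD (hc' (sphere_subset_closedBall hz)))]
  -- With `ε k ≤ δ / 2`, a convolution at a point of the disc of radius `r + δ / 2` only sees `K`,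
  -- where nothing was cut off.
  set ε : ℕ → ℝ := fun k => δ / 2 / (k + 1) with hεdef
  have hε : ∀ k, 0 < ε k := fun k => by positivity
  have hεle : ∀ k, ε k ≤ δ / 2 := fun k => by
    refine div_le_self (by positivity) ?_
    have : (0 : ℝ) ≤ k := k.cast_nonneg
    linarith
  have hεt : Filter.Tendsto ε Filter.atTop (𝓝 0) := by
    have := (tendsto_one_div_add_atTop_nhds_zero_nat (𝕜 := ℝ)).const_mul (δ / 2)
    simpa [hεdef, div_eq_mul_inv] using this
  choose ρ hρ hρc hρ0 hρs hρ1 hρr using fun k => exists_rotation_invariant_mollifier (hε k)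
  have hρcont := fun k => (hρ k).continuous
  refine ⟨fun k z => mollify (ρ k) gh z + (1 / ((k : ℝ) + 1)) • 1, r + δ / 2, C + 1, by linarith,
    fun k => ?_, fun k i j => ?_, fun k z => ?_, fun z hz i j => ?_, fun k z i j => ?_⟩
  · refine GriffithsNeg.add ⟨fun z _ => htame.mollify_psd (hρcont k) (hρc k) (hρ0 k) z,
      fun z _ η hη => ?_, fun c' r' W v hr' hW hc' hWD hv => ?_⟩
      (GriffithsNeg.smul_one _ (by positivity) _)
    · refine eventually_quad_le (Filter.Eventually.of_forall fun y =>
        htame.mollify_psd (hρcont k) (hρc k) (hρ0 k) y) (fun v a ha => ?_) hη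
      have hcont : Continuous fun y => quad (mollify (ρ k) gh y) v := by
        rw [← continuousOn_univ]
        exact ContinuousOn.quad (fun i j => (htame.contDiff_mollify (hρ k) (hρc k) i
          j).continuous.continuousOn) continuousOn_const
      exact hcont.continuousAt.tendsto.eventually_lt_const ha
    · refine htame.submean_mollify (hρcont k) (hρc k) (hρ0 k) (hρs k) hghD hr' hW hc'
        (fun z hz => closedBall_subset_closedBall' ?_) hv
      have h1 := hWD hz
      rw [mem_ball] at h1
      linarith [hεle k]
  · have h1 := (htame.contDiff_mollify (hρ k) (hρc k) i j).differentiable (by simp)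
    simpa only [Matrix.add_apply] using h1.add_const _
  · exact PosDef.posSemidef_add (htame.mollify_psd (hρcont k) (hρc k) (hρ0 k) z)
      (PosDef.one.smul (by positivity))
  · have hzK : closedBall z (δ / 2) ⊆ K := closedBall_subset_closedBall' (by
      rw [mem_closedBall] at hz; linarith)
    have hzK' : z ∈ K := hzK (mem_closedBall_self (by positivity))
    rw [← gh_eq z hzK']
    have h1 : Filter.Tendsto (fun k => mollify (ρ k) gh z i j) Filter.atTop (𝓝 (gh z i j)) := by
      refine tendsto_apply_of_tendsto_quad
        (fun k => (htame.mollify_psd (hρcont k) (hρc k) (hρ0 k) z).1) (hpsd z).1 (fun v => ?_) i j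
      -- The lower bound holds for every `k` by the submean inequality, the upper one eventually by
      -- semicontinuity.
      refine tendsto_order.2 ⟨fun a ha => Filter.Eventually.of_forall fun k => ?_, fun a ha => ?_⟩
      · refine ha.trans_le (htame.le_quad_mollify (hρcont k) (hρc k) (hρ0 k) (hρ1 k) (hρr k)
          (hρs k) fun s hs hsε => ?_)
        refine hghD.submean z s (ball c (δ + r)) (fun _ => v) hs isOpen_ball
          (closedBall_subset_ball' ?_) ball_subset_closedBall (differentiableOn_const _)
        rw [mem_closedBall] at hz
        linarith [hεle k]
      · obtain ⟨b, hb1, hb2⟩ := exists_between ha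
        obtain ⟨η, hη, h2⟩ := Metric.eventually_nhds_iff_ball.1 (huscv v z b hb1)
        filter_upwards [hεt.eventually_lt_const hη] with k hk
        refine (htame.quad_mollify_le (hρcont k) (hρc k) (hρ0 k) (hρ1 k) (hρs k)
          fun y hy => ?_).trans_lt hb2
        exact (h2 y (closedBall_subset_ball hk hy)).le
    have h2 : Filter.Tendsto (fun k : ℕ => ((1 / ((k : ℝ) + 1)) • (1 : Matrix ι ι ℂ)) i j)
        Filter.atTop (𝓝 0) := by
      have := (tendsto_one_div_add_atTop_nhds_zero_nat (𝕜 := ℝ)).smul_const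
        ((1 : Matrix ι ι ℂ) i j)
      simpa only [Matrix.smul_apply, zero_smul] using this
    simpa only [Matrix.add_apply, add_zero] using h1.add h2
  · change ‖mollify (ρ k) gh z i j + ((1 / ((k : ℝ) + 1)) • (1 : Matrix ι ι ℂ)) i j‖ ≤ C + 1
    refine (norm_add_le _ _).trans (add_le_add
      (htame.mollify_bound (hρcont k) (hρc k) (hρ0 k) (hρ1 k) z i j) ?_)
    rw [Matrix.smul_apply, norm_smul, Real.norm_of_nonneg (by positivity)]
    have h1 : ‖(1 : Matrix ι ι ℂ) i j‖ ≤ 1 := by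
      rw [one_apply]; split_ifs <;> simp
    have h2 : 1 / ((k : ℝ) + 1) ≤ 1 := by
      rw [div_le_one (by positivity)]
      have : (0 : ℝ) ≤ k := k.cast_nonneg
      linarith
    calc _ ≤ (1 : ℝ) * 1 := by gcongr
      _ = 1 := one_mul 1

end Regularization

end

noncomputable section

/-! ### Products of Griffiths semi-negative matrix functions -/

section Hadamard

open Metric Set Matrix Asymptotics
open scoped ComplexOrder MatrixOrder

variable {ι : Type*} [Fintype ι]

theorem abs_circleAverage_le_of_isLittleO {F : ℂ → ℝ} {z₀ : ℂ}
    (hF : F =o[𝓝 z₀] fun z => ‖z - z₀‖ ^ 2) {δ : ℝ} (hδ : 0 < δ) :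
    ∀ᶠ ρ in 𝓝[>] (0 : ℝ), |Real.circleAverage F z₀ ρ| ≤ δ * ρ ^ 2 := by
  obtain ⟨e, he, h⟩ := Metric.eventually_nhds_iff_ball.1 (hF.bound hδ)
  filter_upwards [Ioo_mem_nhdsGT he] with ρ hρ
  have h1 : ∀ θ : ℝ, ‖F (circleMap z₀ ρ θ)‖ ≤ δ * ρ ^ 2 := by
    intro θ
    have h2 := circleMap_mem_sphere z₀ hρ.1.le θ
    have h3 := h _ (sphere_subset_ball hρ.2 h2)
    rw [mem_sphere_iff_norm] at h2
    simpa [h2] using h3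
  have h4 := intervalIntegral.norm_integral_le_of_norm_le_const (a := 0) (b := 2 * Real.pi)
    (f := fun θ => F (circleMap z₀ ρ θ)) fun θ _ => h1 θ
  rw [Real.circleAverage_def, smul_eq_mul, abs_mul, abs_inv, abs_of_pos Real.two_pi_pos]
  rw [sub_zero, abs_of_pos Real.two_pi_pos, Real.norm_eq_abs] at h4
  rw [inv_mul_le_iff₀ Real.two_pi_pos]
  linarith

theorem isLittleO_re {α : Type*} {l : Filter α} {f : α → ℂ} {k : α → ℝ} (h : f =o[l] k) :
    (fun x => (f x).re) =o[l] k :=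
  (isBigO_of_le l fun x =>
    (Real.norm_eq_abs _).trans_le (Complex.abs_re_le_norm (f x))).trans_isLittleO h

theorem isLittleO_mul_sub {z₀ : ℂ} {R : ℂ → ℂ} {f : ℂ → ℂ} (hR : R =o[𝓝 z₀] fun z => z - z₀)
    (hf : DifferentiableAt ℝ f z₀) :
    (fun z => R z * (f z - f z₀)) =o[𝓝 z₀] fun z => ‖z - z₀‖ ^ 2 := by
  have h1 := hR.mul_isBigO hf.isBigO_sub
  have h2 := h1.norm_right
  refine h2.congr_right fun z => ?_
  rw [norm_mul, sq]

/-- `R` is `o(z - z₀)` and the other factors move by `O(z - z₀)`. So they may be frozen at `z₀` at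
the cost of `o(‖z - z₀‖²)`, which circle means do not notice at order `ρ²`. -/
theorem isLittleO_quad_sub {z₀ : ℂ} {R : ℂ → Matrix ι ι ℂ} {N : ℂ → Matrix ι ι ℂ} {v : ℂ → ι → ℂ}
    (hR : ∀ i j, (fun z => R z i j) =o[𝓝 z₀] fun z => z - z₀)
    (hN : ∀ i j, DifferentiableAt ℝ (fun z => N z i j) z₀)
    (hv : ∀ i, DifferentiableAt ℝ (fun z => v z i) z₀) :
    (fun z => quad (R z ⊙ N z) (v z) - quad (R z ⊙ N z₀) (v z₀)) =o[𝓝 z₀]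
      fun z => ‖z - z₀‖ ^ 2 := by
  have e : ∀ z, quad (R z ⊙ N z) (v z) - quad (R z ⊙ N z₀) (v z₀) =
      (∑ i, ∑ j, R z i j * ((conj (v z i) * N z i j * v z j) -
        (conj (v z₀ i) * N z₀ i j * v z₀ j))).re := by
    intro z
    rw [quad, quad, ← Complex.sub_re, ← Finset.sum_sub_distrib]
    congr 1
    refine Finset.sum_congr rfl fun i _ => ?_
    rw [← Finset.sum_sub_distrib]
    refine Finset.sum_congr rfl fun j _ => ?_
    simp only [hadamard_apply]
    ring
  simp only [e]
  refine isLittleO_re (IsLittleO.fun_sum fun i _ => IsLittleO.fun_sum fun j _ => ?_)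
  refine isLittleO_mul_sub (f := fun z => conj (v z i) * N z i j * v z j) (hR i j) ?_
  exact ((Complex.conjCLE.differentiableAt.comp z₀ (hv i)).mul (hN i j)).mul (hv j)

theorem quad_conj_mul_mul (K A : Matrix ι ι ℂ) (v : ι → ℂ) :
    quad (Aᴴ * K * A) v = quad K (A *ᵥ v) := by
  rw [quad_eq_dotProduct, quad_eq_dotProduct, star_mulVec, ← dotProduct_mulVec, mulVec_mulVec,
    mulVec_mulVec, Matrix.mul_assoc]

/-- A frame of first order contact with a differentiable Griffiths semi-negative metric. -/
theorem GriffithsNeg.exists_normal_frame [DecidableEq ι] {g : ℂ → Matrix ι ι ℂ} {D : Set ℂ}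
    (hg : GriffithsNeg g D) (hD : IsOpen D) (hgd : ∀ i j, Differentiable ℝ fun z => g z i j)
    {z₀ : ℂ} (hz₀ : z₀ ∈ D) (hK : (g z₀).PosDef) :
    ∃ A : ℂ → Matrix ι ι ℂ, (∀ i j, Differentiable ℂ fun z => A z i j) ∧ A z₀ = 1 ∧
      (∀ i j, (fun z => (g z - (A z)ᴴ * g z₀ * A z) i j) =o[𝓝 z₀] fun z => z - z₀) ∧
      ∀ w, ∀ δ > 0, ∀ᶠ ρ in 𝓝[>] (0 : ℝ), -(δ * ρ ^ 2) ≤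
        Real.circleAverage (fun z => quad (g z - (A z)ᴴ * g z₀ * A z) w) z₀ ρ := by
  set K := g z₀ with hKdef
  have hKh : Kᴴ = K := hK.1
  have hKu : IsUnit K.det := (isUnit_iff_isUnit_det K).1 hK.isUnit
  let L : ι → ι → ℂ →L[ℝ] ℂ := fun i j => fderiv ℝ (fun z => g z i j) z₀
  have hL : ∀ i j, HasFDerivAt (fun z => g z i j) (L i j) z₀ := fun i j =>
    (hgd i j z₀).hasFDerivAt
  have hLc : ∀ i j h, conj (L i j h) = L j i h := by
    intro i j h
    have h1 : HasFDerivAt (fun z => conj (g z i j)) ((Complex.conjCLE : ℂ →L[ℝ] ℂ).comp (L i j)) z₀ :=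
      Complex.conjCLE.hasFDerivAt.comp z₀ (hL i j)
    have h2 : (fun z => conj (g z i j)) =ᶠ[𝓝 z₀] fun z => g z j i := by
      filter_upwards [hD.mem_nhds hz₀] with z hz
      exact (hg.psd z hz).1.apply j i
    have h3 := (h1.congr_of_eventuallyEq h2.symm).unique (hL j i)
    have := DFunLike.congr_fun h3 h
    simpa using this
  -- The Wirtinger derivative `∂g/∂z` at `z₀`. Since `g` is Hermitian, `∂g/∂z̄` is its adjoint.
  let α : Matrix ι ι ℂ := Matrix.of fun i j => (L i j 1 - Complex.I * L i j Complex.I) / 2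
  have hLα : ∀ i j h, L i j h = h * α i j + conj h * αᴴ i j := by
    intro i j h
    have h1 : L i j h = h.re * L i j 1 + h.im * L i j Complex.I := by
      conv_lhs => rw [← Complex.re_add_im h, map_add]
      have e1 : ((h.re : ℂ)) = h.re • (1 : ℂ) := by simp
      have e2 : (h.im : ℂ) * Complex.I = h.im • Complex.I := by simp
      rw [e1, e2, map_smul, map_smul]
      simp
    have h2 : αᴴ i j = (L i j 1 + Complex.I * L i j Complex.I) / 2 := by
      rw [conjTranspose_apply, RCLike.star_def]
      simp only [α, of_apply, map_div₀, map_sub, map_mul, hLc, Complex.conj_I, map_ofNat]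
      simp
    rw [h1, h2]
    simp only [α, of_apply]
    conv_rhs => rw [← Complex.re_add_im h]
    simp only [map_add, map_mul, Complex.conj_ofReal, Complex.conj_I]
    ring_nf
    simp only [Complex.I_sq]
    ring
  -- Then `A = 1 + (z - z₀) B` gives `A* K A = K + (z - z₀) α + conj (z - z₀) α* + O(‖z - z₀‖²)`,
  -- the first-order expansion of `g`.
  let B : Matrix ι ι ℂ := K⁻¹ * α
  have hKB : K * B = α := mul_nonsing_inv_cancel_left K α hKu
  have hBK : Bᴴ * K = αᴴ := by
    have : Bᴴ * K = (K * B)ᴴ := by rw [conjTranspose_mul K B, hKh]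
    rw [this, hKB]
  let A : ℂ → Matrix ι ι ℂ := fun z => 1 + (z - z₀) • B
  have hAK : ∀ z, (A z)ᴴ * K * A z = K + (z - z₀) • α + conj (z - z₀) • αᴴ +
      (conj (z - z₀) * (z - z₀)) • (Bᴴ * K * B) := by
    intro z
    simp only [A, conjTranspose_add, conjTranspose_one, conjTranspose_smul, RCLike.star_def]
    rw [add_mul, add_mul, mul_add, mul_add, Matrix.one_mul, Matrix.mul_one, Matrix.mul_smul,
      Matrix.smul_mul, Matrix.smul_mul, Matrix.smul_mul, Matrix.mul_smul, Matrix.mul_one, hKB, hBK,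
      smul_smul]
    abel
  have hAd : ∀ i j, Differentiable ℂ fun z => A z i j := fun i j => by
    simp only [A, Matrix.add_apply, Matrix.smul_apply]
    fun_prop
  have hR : ∀ i j, (fun z => (g z - (A z)ᴴ * K * A z) i j) =o[𝓝 z₀] fun z => z - z₀ := by
    intro i j
    have h1 := (hL i j).isLittleO
    have h2 : (fun z : ℂ => (conj (z - z₀) * (z - z₀)) * (Bᴴ * K * B) i j) =o[𝓝 z₀]
        fun z => z - z₀ := by
      have h3 : (fun z : ℂ => conj (z - z₀) * (Bᴴ * K * B) i j) =o[𝓝 z₀]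
          fun _ => (1 : ℂ) := by
        rw [isLittleO_one_iff]
        have : Continuous fun z : ℂ => conj (z - z₀) * (Bᴴ * K * B) i j := by fun_prop
        simpa using this.tendsto z₀
      have h4 := h3.mul_isBigO (isBigO_refl (fun z : ℂ => z - z₀) (𝓝 z₀))
      simp only [one_mul] at h4
      exact h4.congr_left fun z => by ring
    refine (h1.sub h2).congr_left fun z => ?_
    rw [hAK, hLα]
    simp only [Matrix.sub_apply, Matrix.add_apply, Matrix.smul_apply, smul_eq_mul, hKdef]
    ring
  refine ⟨A, hAd, by simp [A], hR, fun w δ hδ => ?_⟩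
  -- A first-order inverse of `A` applied to `w`, so that `A v = w - (z - z₀)² u`. The submean
  -- inequality of `g` along this `v` isolates the mean of `quad R w`.
  let v : ℂ → ι → ℂ := fun z i => w i - (z - z₀) * (B *ᵥ w) i
  have hvd : Differentiable ℂ v := differentiable_pi.2 fun i => by fun_prop
  let u : ι → ℂ := B *ᵥ (B *ᵥ w)
  have hAv : ∀ z, A z *ᵥ v z = w - (z - z₀) ^ 2 • u := by
    intro z
    have : v z = w - (z - z₀) • (B *ᵥ w) := by funext i; simp [v]
    rw [this]
    simp only [A, add_mulVec, one_mulVec, smul_mulVec, mulVec_sub, mulVec_smul, u]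
    rw [smul_add, smul_smul, sq]
    abel
  -- The coefficient of `(z - z₀)²` in `quad K (A v)`. It enters as the real part of a holomorphic
  -- function vanishing at `z₀`, so its circle mean is zero.
  let κ : ℂ := -(∑ i, ∑ j, (conj (w i) * K i j * u j)) - conj (∑ i, ∑ j, (conj (u i) * K i j * w j))
  have hquadK : ∀ z, quad K (w - (z - z₀) ^ 2 • u) =
      quad K w + (κ * (z - z₀) ^ 2).re + ‖z - z₀‖ ^ 4 * quad K u := by
    intro z
    generalize z - z₀ = h
    have e1 : (‖h‖ : ℝ) ^ 4 = ‖h ^ 2‖ ^ 2 := by rw [norm_pow]; ring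
    rw [e1]
    generalize h ^ 2 = s
    have e2 : (κ * s).re = (-(∑ i, ∑ j, (conj (w i) * K i j * u j)) * s -
        (∑ i, ∑ j, (conj (u i) * K i j * w j)) * conj s).re := by
      simp only [κ, sub_mul, Complex.sub_re]
      congr 1
      rw [← Complex.conj_re]
      simp
    rw [e2, ← quad_smul_right]
    simp only [quad, ← Complex.add_re]
    congr 1
    simp only [Finset.sum_mul, ← Finset.sum_neg_distrib, ← Finset.sum_sub_distrib,
      ← Finset.sum_add_distrib]
    refine Finset.sum_congr rfl fun i _ => Finset.sum_congr rfl fun j _ => ?_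
    simp only [Pi.sub_apply, Pi.smul_apply, smul_eq_mul, map_sub, map_mul]
    ring
  let R : ℂ → Matrix ι ι ℂ := fun z => g z - (A z)ᴴ * K * A z
  have hF : (fun z => quad (g z) (v z) - (quad K w + (κ * (z - z₀) ^ 2).re + quad (R z) w)) =o[𝓝 z₀]
      fun z => ‖z - z₀‖ ^ 2 := by
    have h1 := isLittleO_quad_sub (N := fun _ => Matrix.of fun _ _ => 1) (v := v) hR
      (fun i j => differentiableAt_const _)
      (fun i => (differentiableAt_pi.1 (hvd z₀) i).restrictScalars ℝ)
    have h2 : (fun z => ‖z - z₀‖ ^ 4 * quad K u) =o[𝓝 z₀] fun z => ‖z - z₀‖ ^ 2 := by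
      have h3 : (fun z => ‖z - z₀‖ ^ 2 * quad K u) =o[𝓝 z₀] fun _ => (1 : ℝ) := by
        rw [isLittleO_one_iff]
        have : Continuous fun z => ‖z - z₀‖ ^ 2 * quad K u := by fun_prop
        simpa using this.tendsto z₀
      have h4 := h3.mul_isBigO (isBigO_refl (fun z : ℂ => ‖z - z₀‖ ^ 2) (𝓝 z₀))
      simp only [one_mul] at h4
      exact h4.congr_left fun z => by ring
    refine (h1.add h2).congr_left fun z => ?_
    have e1 : ∀ M : Matrix ι ι ℂ, M ⊙ Matrix.of (fun _ _ => (1 : ℂ)) = M := fun M => by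
      ext; simp
    have e2 : v z₀ = w := by funext i; simp [v]
    have e3 : quad (g z) (v z) = quad (R z) (v z) + quad K (w - (z - z₀) ^ 2 • u) := by
      rw [← hAv, ← quad_conj_mul_mul, ← quad_add]
      simp [R]
    simp only [e1, e2, e3, hquadK, R]
    ring
  have hgc : ∀ i j, Continuous fun z => g z i j := fun i j => (hgd i j).continuous
  have hRc : ∀ i j, Continuous fun z => R z i j := by
    intro i j
    have hAc := fun i j => (hAd i j).continuous
    simp only [R, Matrix.sub_apply, mul_apply, conjTranspose_apply]
    fun_prop
  have c1 : Continuous fun z => quad (g z) (v z) := by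
    rw [← continuousOn_univ]
    exact ContinuousOn.quad (fun i j => (hgc i j).continuousOn) hvd.continuous.continuousOn
  have c2 : Continuous fun z => quad (R z) w := by
    rw [← continuousOn_univ]
    exact ContinuousOn.quad (fun i j => (hRc i j).continuousOn) continuousOn_const
  filter_upwards [abs_circleAverage_le_of_isLittleO hF hδ,
    eventually_pos_closedBall_subset hD hz₀] with ρ h1 ⟨hρ, h2⟩
  have h3 := hg.submean z₀ ρ D v hρ hD h2 subset_rfl hvd.differentiableOn
  have e2 : v z₀ = w := by funext i; simp [v]
  have e3 : Real.circleAverage (fun z => (κ * (z - z₀) ^ 2).re) z₀ ρ = 0 := by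
    rw [circleAverage_re_of_differentiableOn (W := univ) hρ.le (by fun_prop) (subset_univ _)]
    simp
  have i1 := continuousOn_circleIntegrable (c := z₀) hρ.le c1.continuousOn
  have i2 := continuousOn_circleIntegrable (c := z₀) hρ.le c2.continuousOn
  have i3 : CircleIntegrable (fun z => (κ * (z - z₀) ^ 2).re) z₀ ρ :=
    continuousOn_circleIntegrable hρ.le (by fun_prop)
  have i4 : CircleIntegrable (fun _ => quad K w) z₀ ρ :=
    continuousOn_circleIntegrable hρ.le continuousOn_const
  have i5 : CircleIntegrable (fun z => quad K w + (κ * (z - z₀) ^ 2).re) z₀ ρ := i4.add i3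
  have i6 : CircleIntegrable (fun z => quad K w + (κ * (z - z₀) ^ 2).re + quad (R z) w) z₀ ρ :=
    i5.add i2
  rw [Real.circleAverage_fun_sub i1 i6, Real.circleAverage_fun_add i5 i2, Real.circleAverage_fun_add i4 i3, e3,
    Real.circleAverage_const] at h1
  rw [e2] at h3
  have h4 := (abs_le.1 h1).2
  simp only [R] at h4
  change quad K w ≤ _ at h3
  linarith

end Hadamard

end

noncomputable section

/-! ### Hadamard products and tensor powers of Griffiths semi-negative matrix functions -/

section HadamardProduct

open Metric Set Matrix Asymptotics
open scoped ComplexOrder MatrixOrder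

variable {ι : Type*} [Fintype ι]

theorem quad_hadamard_eq_sum (C C' : Matrix ι ι ℂ) (v : ι → ℂ) :
    quad ((Cᴴ * C) ⊙ (C'ᴴ * C')) v = ∑ b, ∑ a, ‖∑ i, C a i * (C' b i * v i)‖ ^ 2 := by
  rw [quad_hadamard_factor]
  simp only [quad_factor]

/-- After factoring `K` and `K'` the integrand is a sum of squared moduli of holomorphic functions.
-/
theorem submean_hadamard_holomorphic {K K' : Matrix ι ι ℂ} (hK : K.PosSemidef)
    (hK' : K'.PosSemidef) {A A' : ℂ → Matrix ι ι ℂ}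
    (hA : ∀ i j, Differentiable ℂ fun z => A z i j)
    (hA' : ∀ i j, Differentiable ℂ fun z => A' z i j) {v : ℂ → ι → ℂ} {W : Set ℂ}
    (hv : DifferentiableOn ℂ v W) {c : ℂ} {r : ℝ} (hr : 0 < r) (hc : closedBall c r ⊆ W) :
    quad (((A c)ᴴ * K * A c) ⊙ ((A' c)ᴴ * K' * A' c)) (v c) ≤ Real.circleAverage
      (fun z => quad (((A z)ᴴ * K * A z) ⊙ ((A' z)ᴴ * K' * A' z)) (v z)) c r := by
  obtain ⟨C, rfl⟩ := hK.exists_factor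
  obtain ⟨C', rfl⟩ := hK'.exists_factor
  have e : ∀ (B E : Matrix ι ι ℂ), Bᴴ * (Eᴴ * E) * B = (E * B)ᴴ * (E * B) := fun B E => by
    rw [conjTranspose_mul]; simp only [Matrix.mul_assoc]
  simp only [e, quad_hadamard_eq_sum]
  have hv' := differentiableOn_pi.1 hv
  have hd : ∀ a b, DifferentiableOn ℂ
      (fun z => ∑ i, (C * A z) a i * ((C' * A' z) b i * v z i)) W := by
    intro a b
    refine DifferentiableOn.fun_sum fun i _ => ?_
    have h1 : ∀ a, Differentiable ℂ fun z => (C * A z) a i := fun a => by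
      simp only [mul_apply]; fun_prop
    have h2 : ∀ a, Differentiable ℂ fun z => (C' * A' z) a i := fun a => by
      simp only [mul_apply]; fun_prop
    exact (h1 a).differentiableOn.mul ((h2 b).differentiableOn.mul (hv' i))
  have hci : ∀ a b, CircleIntegrable
      (fun z => ‖∑ i, (C * A z) a i * ((C' * A' z) b i * v z i)‖ ^ 2) c r := fun a b =>
    continuousOn_circleIntegrable hr.le
      ((((hd a b).continuousOn.norm.pow 2).mono hc).mono sphere_subset_closedBall)
  rw [Real.circleAverage_fun_sum]
  · refine Finset.sum_le_sum fun b _ => ?_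
    rw [Real.circleAverage_fun_sum]
    · exact Finset.sum_le_sum fun a _ => norm_sq_le_circleAverage hr (hd a b) hc
    · exact fun a _ => hci a b
  · intro b _
    exact CircleIntegrable.fun_sum _ fun a _ => hci a b

theorem continuous_quad_of_continuous {R : ℂ → Matrix ι ι ℂ}
    (hR : ∀ i j, Continuous fun z => R z i j) (w : ι → ℂ) : Continuous fun z => quad (R z) w := by
  rw [← continuousOn_univ]
  exact ContinuousOn.quad (fun i j => (hR i j).continuousOn) continuousOn_const

/-- Factoring `K = C* C` writes `quad (R z ⊙ K) w` as a finite sum of values of `quad (R z)` at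
fixed vectors, to which the hypothesis applies with `δ` divided among the summands. -/
theorem eventually_neg_le_circleAverage_hadamard {R : ℂ → Matrix ι ι ℂ} {z₀ : ℂ}
    (hRc : ∀ i j, Continuous fun z => R z i j)
    (hR : ∀ w, ∀ δ > 0, ∀ᶠ ρ in 𝓝[>] (0 : ℝ), -(δ * ρ ^ 2) ≤
      Real.circleAverage (fun z => quad (R z) w) z₀ ρ) {K : Matrix ι ι ℂ} (hK : K.PosSemidef)
    (w : ι → ℂ) {δ : ℝ} (hδ : 0 < δ) :
    ∀ᶠ ρ in 𝓝[>] (0 : ℝ), -(δ * ρ ^ 2) ≤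
      Real.circleAverage (fun z => quad (R z ⊙ K) w) z₀ ρ := by
  obtain ⟨C, rfl⟩ := hK.exists_factor
  simp only [quad_hadamard_factor]
  have hδ' : 0 < δ / (Fintype.card ι + 1) := by positivity
  have h1 : ∀ᶠ ρ in 𝓝[>] (0 : ℝ), ∀ b, -(δ / (Fintype.card ι + 1) * ρ ^ 2) ≤
      Real.circleAverage (fun z => quad (R z) fun i => C b i * w i) z₀ ρ :=
    Filter.eventually_all.2 fun b => hR _ _ hδ'
  filter_upwards [h1, self_mem_nhdsWithin] with ρ h2 hρ
  rw [Real.circleAverage_fun_sum fun b _ => continuousOn_circleIntegrable (le_of_lt hρ)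
    (continuous_quad_of_continuous hRc _).continuousOn]
  calc -(δ * ρ ^ 2) ≤ ∑ _b : ι, -(δ / (Fintype.card ι + 1) * ρ ^ 2) := by
        rw [Finset.sum_const, Finset.card_univ, nsmul_eq_mul, mul_neg, neg_le_neg_iff,
          ← mul_assoc]
        refine mul_le_mul_of_nonneg_right ?_ (by positivity)
        rw [mul_div_assoc', div_le_iff₀ (by positivity)]
        nlinarith
    _ ≤ _ := Finset.sum_le_sum fun b _ => h2 b

/-- Only the submean inequality up to `o(ρ²)` at each interior point is needed. There both factors
are compared with their flat models in normal frames. -/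
theorem GriffithsNeg.submean_hadamard_smooth {g g' : ℂ → Matrix ι ι ℂ} {D : Set ℂ}
    (hg : GriffithsNeg g D) (hg' : GriffithsNeg g' D) (hD : IsOpen D)
    (hgd : ∀ i j, Differentiable ℝ fun z => g z i j)
    (hgd' : ∀ i j, Differentiable ℝ fun z => g' z i j) (hp : ∀ z, (g z).PosDef)
    (hp' : ∀ z, (g' z).PosDef) {v : ℂ → ι → ℂ} {W : Set ℂ} (hW : IsOpen W) (hWD : W ⊆ D)
    (hv : DifferentiableOn ℂ v W) {c : ℂ} {r : ℝ} (hr : 0 < r) (hc : closedBall c r ⊆ W) :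
    quad (g c ⊙ g' c) (v c) ≤ Real.circleAverage (fun z => quad (g z ⊙ g' z) (v z)) c r := by
  classical
  have hgc : ∀ i j, Continuous fun z => g z i j := fun i j => (hgd i j).continuous
  have hgc' : ∀ i j, Continuous fun z => g' z i j := fun i j => (hgd' i j).continuous
  have hcont : ContinuousOn (fun z => quad (g z ⊙ g' z) (v z)) W :=
    ContinuousOn.quad (fun i j => ((hgc i j).mul (hgc' i j)).continuousOn) hv.continuousOn
  refine le_circleAverage_of_local hr (hcont.mono hc).upperSemicontinuousOn (m := 0)
    (fun z _ => ((hp z).posSemidef.hadamard (hp' z).posSemidef).quad_nonneg _)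
    fun z₀ hz₀ δ hδ => ?_
  have hz₀W : z₀ ∈ W := hc (ball_subset_closedBall hz₀)
  obtain ⟨A, hA, hA1, hR, hRm⟩ := hg.exists_normal_frame hD hgd (hWD hz₀W) (hp z₀)
  obtain ⟨A', hA', hA1', hR', hRm'⟩ := hg'.exists_normal_frame hD hgd' (hWD hz₀W) (hp' z₀)
  set K := g z₀ with hK
  set K' := g' z₀ with hK'
  set P : ℂ → Matrix ι ι ℂ := fun z => (A z)ᴴ * K * A z with hPdef
  set P' : ℂ → Matrix ι ι ℂ := fun z => (A' z)ᴴ * K' * A' z with hPdef'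
  set R : ℂ → Matrix ι ι ℂ := fun z => g z - P z with hRdef
  set R' : ℂ → Matrix ι ι ℂ := fun z => g' z - P' z with hRdef'
  have hP0 : P z₀ = K := by simp [hPdef, hA1]
  have hP0' : P' z₀ = K' := by simp [hPdef', hA1']
  have hR0 : R z₀ = 0 := by simp [hRdef, hP0, hK]
  have hR0' : R' z₀ = 0 := by simp [hRdef', hP0', hK']
  have hPd : ∀ i j, Differentiable ℝ fun z => P z i j := by
    intro i j
    have h1 := fun i j => (hA i j).restrictScalars ℝ
    have h2 : ∀ i j, Differentiable ℝ fun z => conj (A z i j) := fun i j =>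
      Complex.conjCLE.differentiable.comp (h1 i j)
    simp only [hPdef, mul_apply, conjTranspose_apply, RCLike.star_def]
    fun_prop
  have hPd' : ∀ i j, Differentiable ℝ fun z => P' z i j := by
    intro i j
    have h1 := fun i j => (hA' i j).restrictScalars ℝ
    have h2 : ∀ i j, Differentiable ℝ fun z => conj (A' z i j) := fun i j =>
      Complex.conjCLE.differentiable.comp (h1 i j)
    simp only [hPdef', mul_apply, conjTranspose_apply, RCLike.star_def]
    fun_prop
  have hRd : ∀ i j, Differentiable ℝ fun z => R z i j := fun i j => (hgd i j).sub (hPd i j)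
  have hRd' : ∀ i j, Differentiable ℝ fun z => R' z i j := fun i j => (hgd' i j).sub (hPd' i j)
  have hvd : ∀ i, DifferentiableAt ℝ (fun z => v z i) z₀ := fun i =>
    (differentiableAt_pi.1 (hv.differentiableAt (hW.mem_nhds hz₀W)) i).restrictScalars ℝ
  -- Expansion of `(P + R) ⊙ (P' + R')` with each mixed term frozen at `z₀`. The term `R ⊙ R'`
  -- disappears entirely, because `R'` vanishes at `z₀`.
  have hE : (fun z => quad (g z ⊙ g' z) (v z) - (quad (P z ⊙ P' z) (v z) +
      (quad (R z ⊙ K') (v z₀) + quad (R' z ⊙ K) (v z₀)))) =o[𝓝 z₀] fun z => ‖z - z₀‖ ^ 2 := by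
    have h1 := isLittleO_quad_sub hR (fun i j => hPd' i j z₀) hvd
    have h2 := isLittleO_quad_sub hR' (fun i j => hPd i j z₀) hvd
    have h3 := isLittleO_quad_sub hR (fun i j => hRd' i j z₀) hvd
    refine ((h1.add h2).add h3).congr_left fun z => ?_
    change (quad (R z ⊙ P' z) (v z) - quad (R z ⊙ P' z₀) (v z₀) + (quad (R' z ⊙ P z) (v z) -
      quad (R' z ⊙ P z₀) (v z₀)) + (quad (R z ⊙ R' z) (v z) - quad (R z ⊙ R' z₀) (v z₀))) = _
    have e : g z ⊙ g' z = P z ⊙ P' z + (R z ⊙ P' z + R' z ⊙ P z + R z ⊙ R' z) := by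
      ext i j
      simp only [hRdef, hRdef', hadamard_apply, Matrix.add_apply, Matrix.sub_apply]
      ring
    rw [hP0, hP0', hR0', hadamard_zero, quad_zero, e, quad_add, quad_add, quad_add]
    ring
  have hδ3 : 0 < δ / 3 := by positivity
  filter_upwards [abs_circleAverage_le_of_isLittleO hE hδ3,
    eventually_neg_le_circleAverage_hadamard (fun i j => (hRd i j).continuous) hRm
      (hp' z₀).posSemidef (v z₀) hδ3,
    eventually_neg_le_circleAverage_hadamard (fun i j => (hRd' i j).continuous) hRm'
      (hp z₀).posSemidef (v z₀) hδ3,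
    eventually_pos_closedBall_subset hW hz₀W] with ρ h1 h2 h3 ⟨hρ, hρW⟩
  have h4 := submean_hadamard_holomorphic (hp z₀).posSemidef (hp' z₀).posSemidef hA hA' hv hρ hρW
  have hs : sphere z₀ ρ ⊆ W := sphere_subset_closedBall.trans hρW
  have i1 : CircleIntegrable (fun z => quad (g z ⊙ g' z) (v z)) z₀ ρ :=
    continuousOn_circleIntegrable hρ.le (hcont.mono hs)
  have i2 : CircleIntegrable (fun z => quad (P z ⊙ P' z) (v z)) z₀ ρ :=
    continuousOn_circleIntegrable hρ.le ((ContinuousOn.quad (fun i j =>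
      ((hPd i j).continuous.mul (hPd' i j).continuous).continuousOn) hv.continuousOn).mono hs)
  have i3 : CircleIntegrable (fun z => quad (R z ⊙ K') (v z₀)) z₀ ρ :=
    continuousOn_circleIntegrable hρ.le (continuous_quad_of_continuous
      (fun i j => (hRd i j).continuous.mul continuous_const) _).continuousOn
  have i4 : CircleIntegrable (fun z => quad (R' z ⊙ K) (v z₀)) z₀ ρ :=
    continuousOn_circleIntegrable hρ.le (continuous_quad_of_continuous
      (fun i j => (hRd' i j).continuous.mul continuous_const) _).continuousOn
  have i5 : CircleIntegrable (fun z => quad (R z ⊙ K') (v z₀) + quad (R' z ⊙ K) (v z₀)) z₀ ρ :=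
    i3.add i4
  have i6 : CircleIntegrable (fun z => quad (P z ⊙ P' z) (v z) +
      (quad (R z ⊙ K') (v z₀) + quad (R' z ⊙ K) (v z₀))) z₀ ρ := i2.add i5
  rw [Real.circleAverage_fun_sub i1 i6, Real.circleAverage_fun_add i2 i5,
    Real.circleAverage_fun_add i3 i4] at h1
  have h5 := (abs_le.1 h1).1
  have h6 : quad (K ⊙ K') (v z₀) = quad (P z₀ ⊙ P' z₀) (v z₀) := by rw [hP0, hP0']
  change quad (P z₀ ⊙ P' z₀) (v z₀) ≤ Real.circleAverage (fun z => quad (P z ⊙ P' z) (v z)) z₀ ρ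
    at h4
  rw [← hK'] at h2
  rw [← hK] at h3
  rw [h6]
  linarith

theorem tendsto_circleAverage {F : ℕ → ℂ → ℝ} {f : ℂ → ℝ} {c : ℂ} {r B : ℝ} (hr : 0 ≤ r)
    (hF : ∀ k, ContinuousOn (F k) (sphere c r)) (hB : ∀ k, ∀ z ∈ sphere c r, |F k z| ≤ B)
    (ht : ∀ z ∈ sphere c r, Filter.Tendsto (fun k => F k z) Filter.atTop (𝓝 (f z))) :
    Filter.Tendsto (fun k => Real.circleAverage (F k) c r) Filter.atTop
      (𝓝 (Real.circleAverage f c r)) := by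
  simp only [Real.circleAverage_def]
  refine Filter.Tendsto.const_smul ?_ _
  refine intervalIntegral.tendsto_integral_filter_of_dominated_convergence (fun _ => B)
    (Filter.Eventually.of_forall fun k => ?_) (Filter.Eventually.of_forall fun k => ?_) (by simp) ?_
  · refine Continuous.aestronglyMeasurable ?_
    rw [← continuousOn_univ]
    exact (hF k).comp (continuous_circleMap c r).continuousOn
      fun θ _ => circleMap_mem_sphere c hr θ
  · exact Filter.Eventually.of_forall fun θ _ => hB k _ (circleMap_mem_sphere c hr θ)
  · exact Filter.Eventually.of_forall fun θ _ => ht _ (circleMap_mem_sphere c hr θ)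

/-- Limit of the smooth positive definite case: the approximants converge at each point of the
closed disc and are uniformly bounded, so the circle means converge by dominated convergence. -/
theorem GriffithsNeg.submean_hadamard {g g' : ℂ → Matrix ι ι ℂ} {D : Set ℂ}
    (hg : GriffithsNeg g D) (hg' : GriffithsNeg g' D) (hD : IsOpen D)
    {v : ℂ → ι → ℂ} {W : Set ℂ} (hW : IsOpen W) (hWD : W ⊆ D)
    (hv : DifferentiableOn ℂ v W) {c : ℂ} {r : ℝ} (hr : 0 < r) (hc : closedBall c r ⊆ W) :
    quad (g c ⊙ g' c) (v c) ≤ Real.circleAverage (fun z => quad (g z ⊙ g' z) (v z)) c r := by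
  obtain ⟨G, R, C, hR, hG, hGd, hGp, hGt, hGC⟩ := hg.exists_smooth_approx hD hr (hc.trans hWD)
  obtain ⟨G', R', C', hR', hG', hGd', hGp', hGt', hGC'⟩ :=
    hg'.exists_smooth_approx hD hr (hc.trans hWD)
  have hs : sphere c r ⊆ W := sphere_subset_closedBall.trans hc
  have hsub : ∀ k, quad (G k c ⊙ G' k c) (v c) ≤
      Real.circleAverage (fun z => quad (G k z ⊙ G' k z) (v z)) c r := by
    intro k
    have hRR : r < min R R' := lt_min hR hR'
    exact ((hG k).mono (ball_subset_ball (min_le_left R R'))).submean_hadamard_smooth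
      ((hG' k).mono (ball_subset_ball (min_le_right R R'))) isOpen_ball (hGd k) (hGd' k) (hGp k)
      (hGp' k) (hW.inter isOpen_ball) inter_subset_right (hv.mono inter_subset_left) hr
      (subset_inter hc (closedBall_subset_ball hRR))
  have hpt : ∀ z ∈ closedBall c r, Filter.Tendsto (fun k => quad (G k z ⊙ G' k z) (v z))
      Filter.atTop (𝓝 (quad (g z ⊙ g' z) (v z))) := by
    intro z hz
    refine (Complex.continuous_re.tendsto _).comp ?_
    refine tendsto_finsetSum _ fun i _ => tendsto_finsetSum _ fun j _ => ?_
    exact (((hGt z hz i j).mul (hGt' z hz i j)).const_mul _).mul_const _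
  obtain ⟨B, hB⟩ : ∃ B, ∀ z ∈ sphere c r, ∑ i, ∑ j, ‖v z i‖ * (C * C') * ‖v z j‖ ≤ B := by
    have h1 : ContinuousOn (fun z => ∑ i, ∑ j, ‖v z i‖ * (C * C') * ‖v z j‖) (sphere c r) := by
      have := continuousOn_pi.1 (hv.continuousOn.mono hs)
      fun_prop
    obtain ⟨B, hB⟩ := (isCompact_sphere c r).bddAbove_image h1
    exact ⟨B, fun z hz => hB (mem_image_of_mem _ hz)⟩
  have hcontk : ∀ k, ContinuousOn (fun z => quad (G k z ⊙ G' k z) (v z)) (sphere c r) := fun k =>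
    ContinuousOn.quad (fun i j => ((hGd k i j).continuous.mul (hGd' k i j).continuous).continuousOn)
      (hv.continuousOn.mono hs)
  have hbd : ∀ k, ∀ z ∈ sphere c r, |quad (G k z ⊙ G' k z) (v z)| ≤ B := by
    intro k z hz
    refine le_trans ?_ (hB z hz)
    unfold quad
    refine (Complex.abs_re_le_norm _).trans ?_
    refine (norm_sum_le _ _).trans (Finset.sum_le_sum fun i _ => ?_)
    refine (norm_sum_le _ _).trans (Finset.sum_le_sum fun j _ => ?_)
    rw [norm_mul, norm_mul, RCLike.norm_conj, hadamard_apply, norm_mul]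
    have h0 : 0 ≤ C := (norm_nonneg _).trans (hGC k 0 i j)
    gcongr
    · exact hGC _ _ _ _
    · exact hGC' _ _ _ _
  have hlim := tendsto_circleAverage hr.le hcontk hbd
    fun z hz => hpt z (sphere_subset_closedBall hz)
  exact le_of_tendsto_of_tendsto' (hpt c (mem_closedBall_self hr.le)) hlim hsub

theorem eventually_quad_hadamard_le {Y : Type*} {l : Filter Y} {g g' : Y → Matrix ι ι ℂ}
    {K K' : Matrix ι ι ℂ} (hg : ∀ᶠ y in l, (g y).PosSemidef) (hg' : ∀ᶠ y in l, (g' y).PosSemidef)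
    (hK : K.PosSemidef) (hK' : K'.PosSemidef)
    (husc : ∀ δ > 0, ∀ᶠ y in l, ∀ v, quad (g y) v ≤ quad K v + δ * ∑ i, ‖v i‖ ^ 2)
    (husc' : ∀ δ > 0, ∀ᶠ y in l, ∀ v, quad (g' y) v ≤ quad K' v + δ * ∑ i, ‖v i‖ ^ 2)
    {η : ℝ} (hη : 0 < η) :
    ∀ᶠ y in l, ∀ v, quad (g y ⊙ g' y) v ≤ quad (K ⊙ K') v + η * ∑ i, ‖v i‖ ^ 2 := by
  classical
  set t := K.trace.re + K'.trace.re with ht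
  -- In `(K + δ) ⊙ (K' + δ)` the excess over `K ⊙ K'` is diagonal with entries `δ (K i i + K' i i +
  -- δ)`, at most `δ (t + δ)` because a diagonal entry is bounded by the trace.
  obtain ⟨δ, hδ, hδη⟩ : ∃ δ : ℝ, 0 < δ ∧ δ * (t + δ) < η := by
    have h1 : Filter.Tendsto (fun δ : ℝ => δ * (t + δ)) (𝓝[>] 0) (𝓝 (0 * (t + 0))) :=
      tendsto_nhdsWithin_of_tendsto_nhds (Continuous.tendsto (by fun_prop) 0)
    obtain ⟨δ, h3, h4⟩ := ((h1.eventually_lt_const (u := η) (by simpa using hη)).and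
      self_mem_nhdsWithin).exists
    exact ⟨δ, h4, h3⟩
  have key : ∀ (M N : Matrix ι ι ℂ), M.PosSemidef → N.PosSemidef →
      (∀ v, quad M v ≤ quad N v + δ * ∑ i, ‖v i‖ ^ 2) → (N + δ • 1 - M).PosSemidef := by
    intro M N hM hN h
    refine posSemidef_sub_of_quad_le hM.1 (hN.add (PosSemidef.one.smul hδ.le)).1 fun v => ?_
    rw [quad_add, quad_smul, quad_one]
    exact h v
  filter_upwards [husc δ hδ, husc' δ hδ, hg, hg'] with z h1 h2 hz hz' v
  refine (quad_hadamard_mono hz hz' (key _ _ hz hK h1)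
    (key _ _ hz' hK' h2) v).trans ?_
  have e : (K + δ • (1 : Matrix ι ι ℂ)) ⊙ (K' + δ • (1 : Matrix ι ι ℂ)) = K ⊙ K' +
      diagonal fun i => ((δ : ℂ) * (K i i + K' i i + δ)) := by
    ext i j
    by_cases hij : i = j
    · subst hij
      simp
      ring
    · simp [hij]
  rw [e, quad_add, quad_diagonal, Finset.mul_sum]
  refine add_le_add le_rfl (Finset.sum_le_sum fun i _ => ?_)
  refine mul_le_mul_of_nonneg_right (le_trans ?_ hδη.le) (by positivity)
  rw [Complex.re_ofReal_mul]
  refine mul_le_mul_of_nonneg_left ?_ hδ.le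
  have hdiag : ∀ M : Matrix ι ι ℂ, M.PosSemidef → (M i i).re ≤ M.trace.re := by
    intro M hM
    simp only [trace, diag_apply, Complex.re_sum]
    refine Finset.single_le_sum (f := fun i => (M i i).re) (fun j _ => ?_) (Finset.mem_univ i)
    have := hM.quad_nonneg (Pi.single j 1 + Pi.single j 0)
    rw [quad_single] at this
    simpa using this
  simp only [Complex.add_re, Complex.ofReal_re, ht]
  linarith [hdiag _ hK, hdiag _ hK']

/-- The Hadamard product of Griffiths semi-negative matrix functions. -/
theorem GriffithsNeg.hadamard {g g' : ℂ → Matrix ι ι ℂ} {D : Set ℂ}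
    (hg : GriffithsNeg g D) (hg' : GriffithsNeg g' D) (hD : IsOpen D) :
    GriffithsNeg (fun z => g z ⊙ g' z) D where
  psd z hz := (hg.psd z hz).hadamard (hg'.psd z hz)
  usc z₀ hz₀ η hη :=
    eventually_quad_hadamard_le (by filter_upwards [hD.mem_nhds hz₀] with z hz using hg.psd z hz)
      (by filter_upwards [hD.mem_nhds hz₀] with z hz using hg'.psd z hz) (hg.psd z₀ hz₀)
      (hg'.psd z₀ hz₀) (hg.usc z₀ hz₀) (hg'.usc z₀ hz₀) hη
  submean c r W v hr hW hc hWD hv := hg.submean_hadamard hg' hD hW hWD hv hr hc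

theorem eventually_quad_submatrix_le {Y κ : Type*} [Fintype κ] {l : Filter Y}
    {g : Y → Matrix ι ι ℂ} {K : Matrix ι ι ℂ}
    (husc : ∀ δ > 0, ∀ᶠ y in l, ∀ v, quad (g y) v ≤ quad K v + δ * ∑ i, ‖v i‖ ^ 2) (f : κ → ι)
    {η : ℝ} (hη : 0 < η) : ∀ᶠ y in l, ∀ v, quad ((g y).submatrix f f) v ≤
      quad (K.submatrix f f) v + η * ∑ i, ‖v i‖ ^ 2 := by
  classical
  -- Cauchy-Schwarz on the fibres of `f` costs a factor of at most the cardinality of `κ`; the `+ 1`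
  -- covers empty `κ`.
  have hδ : 0 < η / (Fintype.card κ + 1) := by positivity
  filter_upwards [husc _ hδ] with z h1 v
  rw [quad_submatrix, quad_submatrix]
  refine (h1 _).trans (add_le_add le_rfl ?_)
  have h2 : ∀ i, ‖∑ k with f k = i, v k‖ ^ 2 ≤ Fintype.card κ * ∑ k with f k = i, ‖v k‖ ^ 2 := by
    intro i
    calc ‖∑ k with f k = i, v k‖ ^ 2 ≤ (∑ k with f k = i, ‖v k‖) ^ 2 := by
          gcongr; exact norm_sum_le _ _
      _ ≤ (Finset.univ.filter fun k => f k = i).card * ∑ k with f k = i, ‖v k‖ ^ 2 :=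
          sq_sum_le_card_mul_sum_sq
      _ ≤ _ := by
          gcongr
          exact Finset.card_le_univ _
  have e3 : ∑ i, ∑ k with f k = i, ‖v k‖ ^ 2 = ∑ k, ‖v k‖ ^ 2 :=
    Finset.sum_fiberwise Finset.univ f _
  calc η / (Fintype.card κ + 1) * ∑ i, ‖∑ k with f k = i, v k‖ ^ 2
      ≤ η / (Fintype.card κ + 1) * ∑ i, (Fintype.card κ * ∑ k with f k = i, ‖v k‖ ^ 2) := by
        gcongr with i _; exact h2 i
    _ = η * (Fintype.card κ / (Fintype.card κ + 1)) * ∑ k, ‖v k‖ ^ 2 := by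
        rw [← Finset.mul_sum, ← e3]; ring
    _ ≤ η * 1 * ∑ k, ‖v k‖ ^ 2 := by
        gcongr
        rw [div_le_one (by positivity)]
        linarith
    _ = _ := by ring

/-- Summing over the fibres of `f` turns a holomorphic section for the reindexed form into one for
`g` with the same norm. -/
theorem GriffithsNeg.submatrix {κ : Type*} [Fintype κ] {g : ℂ → Matrix ι ι ℂ} {D : Set ℂ}
    (hg : GriffithsNeg g D) (f : κ → ι) : GriffithsNeg (fun z => (g z).submatrix f f) D where
  psd z hz := (hg.psd z hz).submatrix f
  usc z₀ hz₀ η hη :=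
    eventually_quad_submatrix_le (hg.usc z₀ hz₀) f hη
  submean c r W v hr hW hc hWD hv := by
    classical
    simp only [quad_submatrix]
    refine hg.submean c r W (fun z i => ∑ k with f k = i, v z k) hr hW hc hWD ?_
    exact differentiableOn_pi.2 fun i => DifferentiableOn.fun_sum fun k _ =>
      differentiableOn_pi.1 hv k

/-- The matrix of the `m`-th tensor power of a Hermitian form. -/
def tensorPowMatrix (m : ℕ) (M : Matrix ι ι ℂ) : Matrix (Fin m → ι) (Fin m → ι) ℂ :=
  Matrix.of fun I J => ∏ k, M (I k) (J k)

/-- For each `k` the factor `M (I k) (J k)` is the reindexing of `M` along `I ↦ I k`, so the product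
is an iterated Hadamard product. The partial products over `s` permit induction, starting from the
all-ones matrix, a Gram matrix of rank at most one. -/
theorem posSemidef_prod {m : ℕ} {M : Matrix ι ι ℂ} (hM : M.PosSemidef) (s : Finset (Fin m)) :
    (Matrix.of fun I J => ∏ k ∈ s, M (I k) (J k) :
        Matrix (Fin m → ι) (Fin m → ι) ℂ).PosSemidef := by
  classical
  induction s using Finset.induction_on with
  | empty =>
    convert posSemidef_conjTranspose_mul_self
      (Matrix.of fun _ _ => 1 : Matrix Unit (Fin m → ι) ℂ) using 1
    ext I J
    simp [mul_apply]
  | insert k s hk ih =>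
    have e : (Matrix.of fun I J => ∏ k ∈ insert k s, M (I k) (J k) :
        Matrix (Fin m → ι) (Fin m → ι) ℂ) =
        (M.submatrix (fun I : Fin m → ι => I k) fun I : Fin m → ι => I k) ⊙
          Matrix.of fun I J => ∏ k ∈ s, M (I k) (J k) := by
      ext I J
      simp [Finset.prod_insert hk]
    rw [e]
    exact (hM.submatrix fun I : Fin m → ι => I k).hadamard ih

theorem posSemidef_tensorPowMatrix {M : Matrix ι ι ℂ} (hM : M.PosSemidef) (m : ℕ) :
    (tensorPowMatrix m M).PosSemidef := posSemidef_prod hM Finset.univ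

theorem eventually_quad_tensorPow_le {Y : Type*} {l : Filter Y} {g : Y → Matrix ι ι ℂ}
    {K : Matrix ι ι ℂ} (hg : ∀ᶠ y in l, (g y).PosSemidef) (hK : K.PosSemidef)
    (husc : ∀ δ > 0, ∀ᶠ y in l, ∀ v, quad (g y) v ≤ quad K v + δ * ∑ i, ‖v i‖ ^ 2) (m : ℕ) :
    ∀ η > 0, ∀ᶠ y in l, ∀ v, quad (tensorPowMatrix m (g y)) v ≤
      quad (tensorPowMatrix m K) v + η * ∑ i, ‖v i‖ ^ 2 := by
  classical
  have key : ∀ s : Finset (Fin m), ∀ η > 0, ∀ᶠ y in l, ∀ v,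
      quad (Matrix.of fun I J => ∏ k ∈ s, g y (I k) (J k) : Matrix (Fin m → ι) (Fin m → ι) ℂ) v ≤
      quad (Matrix.of fun I J => ∏ k ∈ s, K (I k) (J k) : Matrix (Fin m → ι) (Fin m → ι) ℂ) v +
        η * ∑ i, ‖v i‖ ^ 2 := by
    intro s
    induction s using Finset.induction_on with
    | empty =>
      intro η hη
      refine Filter.Eventually.of_forall fun y v => ?_
      simp only [Finset.prod_empty]
      have : 0 ≤ η * ∑ i, ‖v i‖ ^ 2 := by positivity
      linarith
    | insert k s hk ih =>
      intro η hη
      have h := eventually_quad_hadamard_le (hg.mono fun y hy => hy.submatrix fun I : Fin m → ι => I k)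
        (hg.mono fun y hy => posSemidef_prod hy s) (hK.submatrix fun I : Fin m → ι => I k)
        (posSemidef_prod hK s)
        (fun δ hδ => eventually_quad_submatrix_le husc (fun I : Fin m → ι => I k) hδ) ih hη
      filter_upwards [h] with y hy v
      convert hy v using 2
      · congr 1
        ext I J
        simp [Finset.prod_insert hk]
      · congr 1
        ext I J
        simp [Finset.prod_insert hk]
  exact key Finset.univ

theorem GriffithsNeg.tensorPow {g : ℂ → Matrix ι ι ℂ} {D : Set ℂ} (hg : GriffithsNeg g D)
    (hD : IsOpen D) (m : ℕ) : GriffithsNeg (fun z => tensorPowMatrix m (g z)) D := by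
  classical
  have key : ∀ s : Finset (Fin m), GriffithsNeg
      (fun z => (Matrix.of fun I J => ∏ k ∈ s, g z (I k) (J k) :
        Matrix (Fin m → ι) (Fin m → ι) ℂ)) D := by
    intro s
    induction s using Finset.induction_on with
    | empty =>
      have h := GriffithsNeg.of_factor (κ := Unit) (ι := Fin m → ι)
        (C := fun _ => Matrix.of fun _ _ => 1) (fun i j => differentiable_const _) D
      convert h using 2
      ext I J
      simp [mul_apply]
    | insert k s hk ih =>
      have h := (hg.submatrix fun I : Fin m → ι => I k).hadamard ih hD
      convert h using 2
      ext I J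
      simp [Finset.prod_insert hk]
  exact key Finset.univ

end HadamardProduct

end

noncomputable section

/-! ### Logarithms of squared norms -/

section LogNorm

open Metric Set Matrix
open scoped ComplexOrder MatrixOrder

variable {ι : Type*} [Fintype ι]

theorem upperSemicontinuousOn_log_add {Y : Type*} [TopologicalSpace Y] {u : Y → ℝ} {s : Set Y}
    (hu : UpperSemicontinuousOn u s) (h0 : ∀ y ∈ s, 0 ≤ u y) {δ : ℝ} (hδ : 0 < δ) :
    UpperSemicontinuousOn (fun y => Real.log (u y + δ)) s := by
  intro z hz a ha
  have h1 : u z < Real.exp a - δ := by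
    have := (Real.log_lt_iff_lt_exp (by linarith [h0 z hz])).1 ha
    linarith
  filter_upwards [hu z hz _ h1, self_mem_nhdsWithin] with y hy hys
  exact (Real.log_lt_iff_lt_exp (by linarith [h0 y hys])).2 (by linarith)

/-- With `Re P` a majorant of `log (|v|² + δ)` on the circle, apply subharmonicity to the section
`e^{-P/2} v` and to `δ |e^{-P/2}|²`. Their sum is at most `1` on the circle, hence at the centre,
where this reads `log (|v|² + δ) ≤ Re P`. The `δ` keeps the logarithm bounded below. -/
theorem GriffithsNeg.log_submean {g : ℂ → Matrix ι ι ℂ} {D : Set ℂ} (hg : GriffithsNeg g D)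
    {c : ℂ} {r : ℝ} {W : Set ℂ} {v : ℂ → ι → ℂ} (hr : 0 < r) (hW : IsOpen W)
    (hc : closedBall c r ⊆ W) (hWD : W ⊆ D) (hv : DifferentiableOn ℂ v W) {δ : ℝ} (hδ : 0 < δ) :
    Real.log (quad (g c) (v c) + δ) ≤
      Real.circleAverage (fun z => Real.log (quad (g z) (v z) + δ)) c r := by
  have hs : sphere c r ⊆ W := sphere_subset_closedBall.trans hc
  have h0 : ∀ z ∈ W, 0 ≤ quad (g z) (v z) := fun z hz => (hg.psd z (hWD hz)).quad_nonneg _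
  have husc := hg.usc_quad (hs.trans hWD) (hv.continuousOn.mono hs)
  have hcW : c ∈ W := hc (mem_closedBall_self hr.le)
  refine le_of_forall_pos_le_add fun ε hε => ?_
  obtain ⟨P, hP, hP1, hP2⟩ := exists_entire_majorant hr
    (upperSemicontinuousOn_log_add husc (fun z hz => h0 z (hs hz)) hδ) (m := Real.log δ)
    (fun z hz => Real.log_le_log hδ (by linarith [h0 z (hs hz)])) hε
  refine le_trans ?_ hP2
  set E : ℂ → ℂ := fun z => Complex.exp (-P z / 2) with hE
  have hEd : Differentiable ℂ E := by fun_prop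
  have hEn : ∀ z, ‖E z‖ ^ 2 = Real.exp (-(P z).re) := by
    intro z
    rw [hE, Complex.norm_exp, ← Real.exp_nat_mul]
    congr 1
    simp
    ring
  have hq : ∀ z w, quad (g z) (E w • v w) = ‖E w‖ ^ 2 * quad (g z) (v w) := fun z w =>
    quad_smul_right (E w) (g z) (v w)
  have h1 := hg.submean c r W (fun z => E z • v z) hr hW hc hWD (hEd.differentiableOn.smul hv)
  have h2 := norm_sq_le_circleAverage (f := E) hr hEd.differentiableOn (W := W) hc
  have hi1 : CircleIntegrable (fun z => quad (g z) (E z • v z)) c r :=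
    hg.circleIntegrable hr.le (hs.trans hWD)
      ((hEd.continuous.continuousOn).smul (hv.continuousOn.mono hs))
  have hi2 : CircleIntegrable (fun z => δ * ‖E z‖ ^ 2) c r :=
    continuousOn_circleIntegrable hr.le (by have := hEd.continuous; fun_prop)
  have h3 : (quad (g c) (v c) + δ) * Real.exp (-(P c).re) ≤ 1 := by
    calc (quad (g c) (v c) + δ) * Real.exp (-(P c).re)
        = quad (g c) (E c • v c) + δ * ‖E c‖ ^ 2 := by
          rw [hq, hEn]; ring
      _ ≤ Real.circleAverage (fun z => quad (g z) (E z • v z)) c r +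
          δ * Real.circleAverage (fun z => ‖E z‖ ^ 2) c r := by gcongr
      _ = Real.circleAverage (fun z => quad (g z) (E z • v z) + δ * ‖E z‖ ^ 2) c r := by
          rw [Real.circleAverage_fun_add hi1 hi2]
          congr 1
          simpa only [smul_eq_mul] using (Real.circleAverage_fun_smul (𝕜 := ℝ) (a := δ)
            (f := fun z => ‖E z‖ ^ 2) (c := c) (R := r)).symm
      _ ≤ Real.circleAverage (fun _ => (1 : ℝ)) c r := by
          refine Real.circleAverage_mono (hi1.add hi2) (circleIntegrable_const 1 c r) ?_
          intro z hz
          rw [abs_of_pos hr] at hz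
          have h5 : 0 < quad (g z) (v z) + δ := by linarith [h0 z (hs hz)]
          have h4 := (Real.log_le_iff_le_exp h5).1 (hP1 z hz)
          rw [hq, hEn]
          calc _ = (quad (g z) (v z) + δ) * Real.exp (-(P z).re) := by ring
            _ ≤ Real.exp (P z).re * Real.exp (-(P z).re) := by gcongr
            _ = 1 := by rw [← Real.exp_add]; simp
      _ = 1 := Real.circleAverage_const 1 c r
  rw [Real.log_le_iff_le_exp (by linarith [h0 c hcW])]
  rwa [Real.exp_neg, ← div_eq_mul_inv, div_le_one (Real.exp_pos _)] at h3

end LogNorm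

/-! ### Angular means of extended-real functions and passage through the logarithm -/

section EReal

open Set

/-- The mean of an extended real function over `(0, 2π]`. -/
def angleMean (φ : ℝ → EReal) : EReal :=
  (((ENNReal.ofReal (2 * Real.pi))⁻¹ * ∫⁻ θ in Ioc 0 (2 * Real.pi), (φ θ).toENNReal : ENNReal) :
    EReal) -
  (((ENNReal.ofReal (2 * Real.pi))⁻¹ * ∫⁻ θ in Ioc 0 (2 * Real.pi), (-φ θ).toENNReal : ENNReal) :
    EReal)

theorem circleMean_eq_angleMean {n : ℕ} (φ : (Fin n → ℂ) → EReal) (z ξ : Fin n → ℂ) :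
    circleMean φ z ξ = angleMean fun θ : ℝ => φ (z + Complex.exp (θ * Complex.I) • ξ) := rfl

theorem angleMean_mono {φ ψ : ℝ → EReal} (h : ∀ θ, φ θ ≤ ψ θ) : angleMean φ ≤ angleMean ψ := by
  refine EReal.sub_le_sub (EReal.coe_ennreal_le_coe_ennreal_iff.2 ?_)
    (EReal.coe_ennreal_le_coe_ennreal_iff.2 ?_)
  · exact mul_le_mul_right (lintegral_mono fun θ => EReal.toENNReal_le_toENNReal (h θ)) _
  · exact mul_le_mul_right (lintegral_mono fun θ =>
      EReal.toENNReal_le_toENNReal (EReal.neg_le_neg_iff.2 (h θ))) _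

theorem inv_ofReal_two_pi_ne_top : (ENNReal.ofReal (2 * Real.pi))⁻¹ ≠ ⊤ :=
  ENNReal.inv_ne_top.2 (by simp [Real.pi_pos])

theorem angleMean_coe {g : ℝ → ℝ} (hg : IntervalIntegrable g volume 0 (2 * Real.pi)) :
    angleMean (fun θ => (g θ : EReal)) = ((2 * Real.pi)⁻¹ * ∫ θ in (0)..(2 * Real.pi), g θ : ℝ) := by
  have hg' : IntegrableOn g (Ioc 0 (2 * Real.pi)) :=
    (intervalIntegrable_iff_integrableOn_Ioc_of_le Real.two_pi_pos.le).1 hg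
  have e : ∀ f : ℝ → ℝ, IntegrableOn f (Ioc 0 (2 * Real.pi)) →
      (((ENNReal.ofReal (2 * Real.pi))⁻¹ * ∫⁻ θ in Ioc 0 (2 * Real.pi), ENNReal.ofReal (f θ) :
        ENNReal) : EReal) = ((2 * Real.pi)⁻¹ *
          (∫⁻ θ in Ioc 0 (2 * Real.pi), ENNReal.ofReal (f θ)).toReal : ℝ) := by
    intro f hf
    have h1 : ∫⁻ θ in Ioc 0 (2 * Real.pi), ENNReal.ofReal (f θ) ≠ ⊤ := by
      refine ne_top_of_le_ne_top hf.2.ne (lintegral_mono fun θ => ?_)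
      rw [← ofReal_norm]
      exact ENNReal.ofReal_le_ofReal (Real.le_norm_self _)
    rw [← EReal.coe_ennreal_toReal (ENNReal.mul_ne_top inv_ofReal_two_pi_ne_top h1),
      ENNReal.toReal_mul, ENNReal.toReal_inv, ENNReal.toReal_ofReal Real.two_pi_pos.le]
  rw [intervalIntegral.integral_of_le Real.two_pi_pos.le,
    integral_eq_lintegral_pos_part_sub_lintegral_neg_part hg', mul_sub, EReal.coe_sub,
    ← e g hg', ← e (fun θ => -g θ) hg'.neg]
  simp only [angleMean, ← EReal.coe_neg, EReal.real_coe_toENNReal]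

/-- The tangent line of the concave logarithm at `a`; for `t ≤ 0` the left side is `-∞`. -/
theorem log_ofReal_le_coe {a t : ℝ} (ha : 0 < a) :
    ENNReal.log (ENNReal.ofReal t) ≤ ((Real.log a + t / a - 1 : ℝ) : EReal) := by
  rw [ENNReal.log_ofReal]
  split_ifs with h
  · exact bot_le
  · have ht : 0 < t := not_le.1 h
    have := Real.log_le_sub_one_of_pos (div_pos ht ha)
    rw [Real.log_div ht.ne' ha.ne'] at this
    exact EReal.coe_le_coe_iff.2 (by linarith)

/-- Jensen's inequality for the logarithm. -/
theorem le_integral_of_log_le_angleMean {f : ℝ → ℝ} {a : ℝ}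
    (hf : IntervalIntegrable f volume 0 (2 * Real.pi)) (h0 : ∀ θ, 0 ≤ f θ)
    (h : ENNReal.log (ENNReal.ofReal a) ≤
      angleMean fun θ => ENNReal.log (ENNReal.ofReal (f θ))) :
    a ≤ (2 * Real.pi)⁻¹ * ∫ θ in (0)..(2 * Real.pi), f θ := by
  rcases le_or_gt a 0 with ha | ha
  · refine ha.trans (mul_nonneg (by positivity) ?_)
    exact intervalIntegral.integral_nonneg Real.two_pi_pos.le fun θ _ => h0 θ
  have h1 := h.trans (angleMean_mono fun θ => log_ofReal_le_coe (t := f θ) ha)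
  have hi : IntervalIntegrable (fun θ => Real.log a + f θ / a - 1) volume 0 (2 * Real.pi) := by
    have h2 : IntervalIntegrable (fun _ : ℝ => Real.log a) volume 0 (2 * Real.pi) := by simp
    have h3 : IntervalIntegrable (fun _ : ℝ => (1 : ℝ)) volume 0 (2 * Real.pi) := by simp
    exact (h2.add (hf.div_const a)).sub h3
  rw [angleMean_coe hi, ENNReal.log_ofReal_of_pos ha, EReal.coe_le_coe_iff,
    intervalIntegral.integral_sub ((by simp : IntervalIntegrable (fun _ : ℝ => Real.log a) volume 0
      (2 * Real.pi)).add (hf.div_const a)) (by simp),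
    intervalIntegral.integral_add (by simp) (hf.div_const a), intervalIntegral.integral_div] at h1
  simp only [intervalIntegral.integral_const, sub_zero, smul_eq_mul, mul_one] at h1
  have hpi := Real.two_pi_pos
  set I := ∫ θ in (0)..(2 * Real.pi), f θ
  have h2 : (2 * Real.pi)⁻¹ * (2 * Real.pi * Real.log a + I / a - 2 * Real.pi) =
      Real.log a + (2 * Real.pi)⁻¹ * I / a - 1 := by
    field_simp
  rw [h2] at h1
  rw [← one_le_div ha]
  linarith

/-- Splitting `A` into its positive and negative parts removes every subtraction, so that limits can
be taken in `ENNReal`. -/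
theorem coe_le_coe_ennreal_sub_iff {A : ℝ} {P N : ENNReal} (hN : N ≠ ⊤) :
    (A : EReal) ≤ (P : EReal) - (N : EReal) ↔
      ENNReal.ofReal A + N ≤ P + ENNReal.ofReal (-A) := by
  have hA : (A : EReal) = ((ENNReal.ofReal A : ENNReal) : EReal) -
      ((ENNReal.ofReal (-A) : ENNReal) : EReal) := by
    rw [EReal.coe_ennreal_ofReal, EReal.coe_ennreal_ofReal, ← EReal.coe_sub]
    congr 1
    rcases le_total A 0 with h | h
    · rw [max_eq_right h, max_eq_left (by linarith)]; ring
    · rw [max_eq_left h, max_eq_right (by linarith)]; ring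
  rw [hA, EReal.le_sub_iff_add_le (Or.inl (EReal.coe_ennreal_ne_bot N))
    (Or.inl (by rwa [Ne, EReal.coe_ennreal_eq_top_iff])),
    sub_eq_add_neg, add_right_comm, ← sub_eq_add_neg,
    EReal.sub_le_iff_le_add (Or.inl (EReal.coe_ennreal_ne_bot _))
      (Or.inl (by simp))]
  norm_cast

/-- Monotone convergence for the logarithm. -/
theorem log_le_angleMean {f : ℝ → ℝ} {a C : ℝ} (hf : Measurable f) (h0 : ∀ θ, 0 ≤ f θ)
    (hC : ∀ θ, f θ ≤ C) (h : ∀ δ > 0, Real.log (a + δ) ≤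
      (2 * Real.pi)⁻¹ * ∫ θ in (0)..(2 * Real.pi), Real.log (f θ + δ)) :
    ENNReal.log (ENNReal.ofReal a) ≤ angleMean fun θ => ENNReal.log (ENNReal.ofReal (f θ)) := by
  rcases le_or_gt a 0 with ha | ha
  · simp [ENNReal.ofReal_of_nonpos ha]
  set δ : ℕ → ℝ := fun k => 1 / ((k : ℝ) + 1) with hδ
  have hδ0 : ∀ k, 0 < δ k := fun k => by positivity
  have hδt : Filter.Tendsto δ Filter.atTop (𝓝 0) := tendsto_one_div_add_atTop_nhds_zero_nat
  have hδ1 : ∀ k, δ k ≤ 1 := fun k => by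
    rw [hδ]; exact (div_le_one (by positivity)).2 (by linarith [(Nat.cast_nonneg k : (0 : ℝ) ≤ k)])
  have hC0 : 0 ≤ C := (h0 0).trans (hC 0)
  set K : ENNReal := (ENNReal.ofReal (2 * Real.pi))⁻¹
  set l : ℕ → ℝ → ℝ := fun k θ => Real.log (f θ + δ k) with hl
  have hlog : ∀ k θ, ENNReal.log (ENNReal.ofReal (f θ + δ k)) = (l k θ : EReal) := fun k θ =>
    ENNReal.log_ofReal_of_pos (by linarith [h0 θ, hδ0 k])
  have hlim : ∀ θ, Filter.Tendsto (fun k => (l k θ : EReal)) Filter.atTop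
      (𝓝 (ENNReal.log (ENNReal.ofReal (f θ)))) := by
    intro θ
    simp only [← hlog]
    have h1 : Filter.Tendsto (fun k => f θ + δ k) Filter.atTop (𝓝 (f θ)) := by
      simpa using hδt.const_add (f θ)
    exact (ENNReal.continuous_log.tendsto _).comp ((ENNReal.continuous_ofReal.tendsto _).comp h1)
  have hlm : ∀ k, Measurable (l k) := fun k => (hf.add_const _).log
  have hlC : ∀ k θ, l k θ ≤ Real.log (C + 1) := fun k θ =>
    Real.log_le_log (by linarith [h0 θ, hδ0 k]) (add_le_add (hC θ) (hδ1 k))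
  have hlanti : ∀ θ, Antitone fun k => l k θ := by
    intro θ j k hjk
    refine Real.log_le_log (by linarith [h0 θ, hδ0 k]) ?_
    have : δ k ≤ δ j := by
      have : (j : ℝ) ≤ k := by exact_mod_cast hjk
      exact one_div_le_one_div_of_le (by positivity) (by linarith)
    simpa using this
  -- The positive parts are dominated by a constant, since `δ k ≤ 1`.
  have hP : Filter.Tendsto (fun k => ∫⁻ θ in Ioc 0 (2 * Real.pi), ENNReal.ofReal (l k θ))
      Filter.atTop (𝓝 (∫⁻ θ in Ioc 0 (2 * Real.pi),
        (ENNReal.log (ENNReal.ofReal (f θ))).toENNReal)) := by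
    refine tendsto_lintegral_of_dominated_convergence
      (fun _ => ENNReal.ofReal (Real.log (C + 1))) (fun k => (hlm k).ennreal_ofReal)
      (fun k => Filter.Eventually.of_forall fun θ => ENNReal.ofReal_le_ofReal (hlC k θ)) ?_
      (Filter.Eventually.of_forall fun θ => ?_)
    · rw [setLIntegral_const]
      exact ENNReal.mul_ne_top ENNReal.ofReal_ne_top measure_Ioc_lt_top.ne
    · exact (EReal.continuous_toENNReal.tendsto _).comp (hlim θ)
  -- The negative parts increase as `δ k` decreases. The limit might be infinite, so monotone
  -- convergence is used.
  have hN : Filter.Tendsto (fun k => ∫⁻ θ in Ioc 0 (2 * Real.pi), ENNReal.ofReal (-l k θ))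
      Filter.atTop (𝓝 (∫⁻ θ in Ioc 0 (2 * Real.pi),
        (-ENNReal.log (ENNReal.ofReal (f θ))).toENNReal)) := by
    refine lintegral_tendsto_of_tendsto_of_monotone
      (fun k => ((hlm k).neg).ennreal_ofReal.aemeasurable)
      (Filter.Eventually.of_forall fun θ j k hjk =>
        ENNReal.ofReal_le_ofReal (neg_le_neg (hlanti θ hjk)))
      (Filter.Eventually.of_forall fun θ => ?_)
    have := (EReal.continuous_toENNReal.tendsto _).comp
      ((continuous_neg.tendsto _).comp (hlim θ))
    refine this.congr fun k => ?_
    simp only [Function.comp_apply, ← EReal.coe_neg, EReal.real_coe_toENNReal]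
  have hPfin : K * ∫⁻ θ in Ioc 0 (2 * Real.pi),
      (ENNReal.log (ENNReal.ofReal (f θ))).toENNReal ≠ ⊤ := by
    refine ENNReal.mul_ne_top inv_ofReal_two_pi_ne_top (ne_top_of_le_ne_top
      (b := ∫⁻ _ in Ioc 0 (2 * Real.pi), ENNReal.ofReal (Real.log (C + 1))) ?_ ?_)
    · rw [setLIntegral_const]
      exact ENNReal.mul_ne_top ENNReal.ofReal_ne_top measure_Ioc_lt_top.ne
    · refine lintegral_mono fun θ => ?_
      refine le_of_tendsto ((EReal.continuous_toENNReal.tendsto _).comp (hlim θ))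
        (Filter.Eventually.of_forall fun k => ENNReal.ofReal_le_ofReal (hlC k θ))
  set A : ℝ := Real.log a
  have hk : ∀ k, ENNReal.ofReal A + K * ∫⁻ θ in Ioc 0 (2 * Real.pi), ENNReal.ofReal (-l k θ) ≤
      K * (∫⁻ θ in Ioc 0 (2 * Real.pi), ENNReal.ofReal (l k θ)) + ENNReal.ofReal (-A) := by
    intro k
    have hint : IntervalIntegrable (l k) volume 0 (2 * Real.pi) := by
      rw [intervalIntegrable_iff_integrableOn_Ioc_of_le Real.two_pi_pos.le]
      refine Measure.integrableOn_of_bounded (M := |Real.log (C + 1)| + |Real.log (δ k)|)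
        measure_Ioc_lt_top.ne (hlm k).aestronglyMeasurable (Filter.Eventually.of_forall fun θ => ?_)
      have h1 : Real.log (δ k) ≤ l k θ := Real.log_le_log (hδ0 k) (by linarith [h0 θ])
      rw [Real.norm_eq_abs, abs_le]
      constructor
      · linarith [neg_abs_le (Real.log (δ k)), abs_nonneg (Real.log (C + 1))]
      · linarith [hlC k θ, le_abs_self (Real.log (C + 1)), abs_nonneg (Real.log (δ k))]
    have h1 : A ≤ (2 * Real.pi)⁻¹ * ∫ θ in (0)..(2 * Real.pi), l k θ :=
      (Real.log_le_log ha (by linarith [hδ0 k])).trans (h (δ k) (hδ0 k))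
    have h2 := angleMean_coe hint
    have h3 : (A : EReal) ≤ angleMean fun θ => (l k θ : EReal) := by
      rw [h2]; exact EReal.coe_le_coe_iff.2 h1
    simp only [angleMean, ← EReal.coe_neg, EReal.real_coe_toENNReal] at h3
    have hNf : K * ∫⁻ θ in Ioc 0 (2 * Real.pi), ENNReal.ofReal (-l k θ) ≠ ⊤ := by
      refine ENNReal.mul_ne_top inv_ofReal_two_pi_ne_top ?_
      have hi := (intervalIntegrable_iff_integrableOn_Ioc_of_le Real.two_pi_pos.le).1 hint.neg
      refine ne_top_of_le_ne_top hi.2.ne (lintegral_mono fun θ => ?_)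
      rw [← ofReal_norm]
      exact ENNReal.ofReal_le_ofReal (Real.le_norm_self _)
    exact (coe_le_coe_ennreal_sub_iff hNf).1 h3
  have hfin := le_of_tendsto_of_tendsto'
    (tendsto_const_nhds.add (ENNReal.Tendsto.const_mul hN (Or.inr inv_ofReal_two_pi_ne_top)))
    ((ENNReal.Tendsto.const_mul hP (Or.inr inv_ofReal_two_pi_ne_top)).add tendsto_const_nhds) hk
  -- The limiting inequality bounds the negative part by the finite positive one, so the
  -- extended-real difference has its intended meaning.
  have hNf : K * ∫⁻ θ in Ioc 0 (2 * Real.pi),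
      (-ENNReal.log (ENNReal.ofReal (f θ))).toENNReal ≠ ⊤ := by
    refine ne_top_of_le_ne_top (ENNReal.add_ne_top.2 ⟨hPfin, ENNReal.ofReal_ne_top⟩)
      (le_trans le_add_self hfin)
  rw [ENNReal.log_ofReal_of_pos ha]
  exact (coe_le_coe_ennreal_sub_iff hNf).2 hfin

end EReal

end

noncomputable section

/-! ### Log-plurisubharmonic functions -/

section LogPsh

open Metric Set Matrix
open scoped ComplexOrder MatrixOrder

variable {n : ℕ}

/-- Semi-positive upper semicontinuous functions `u` such that `log (u + δ)` is plurisubharmonic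
for all `δ > 0`. -/
structure IsLogPsh (u : (Fin n → ℂ) → ℝ) (Ω : Set (Fin n → ℂ)) : Prop where
  nonneg : ∀ z ∈ Ω, 0 ≤ u z
  usc : UpperSemicontinuousOn u Ω
  submean : ∀ z ξ : Fin n → ℂ, (∀ τ : ℂ, ‖τ‖ ≤ 1 → z + τ • ξ ∈ Ω) → ∀ δ > 0,
    Real.log (u z + δ) ≤ Real.circleAverage (fun τ => Real.log (u (z + τ • ξ) + δ)) 0 1

theorem norm_exp_mul_I_le (θ : ℝ) : ‖Complex.exp (θ * Complex.I)‖ ≤ 1 :=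
  (Complex.norm_exp_ofReal_mul_I θ).le

theorem eventually_disc_subset {Ω : Set (Fin n → ℂ)} (hΩ : IsOpen Ω) {z : Fin n → ℂ}
    (hz : z ∈ Ω) : ∀ᶠ ξ in 𝓝 (0 : Fin n → ℂ), ∀ τ : ℂ, ‖τ‖ ≤ 1 → z + τ • ξ ∈ Ω := by
  obtain ⟨e, he, hb⟩ := Metric.isOpen_iff.1 hΩ z hz
  filter_upwards [ball_mem_nhds 0 he] with ξ hξ τ hτ
  refine hb ?_
  rw [mem_ball, dist_self_add_left, norm_smul]
  rw [mem_ball_zero_iff] at hξ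
  calc ‖τ‖ * ‖ξ‖ ≤ 1 * ‖ξ‖ := by gcongr
    _ < e := by rwa [one_mul]

theorem upperSemicontinuous_circle {u : (Fin n → ℂ) → ℝ} {Ω : Set (Fin n → ℂ)}
    (hu : UpperSemicontinuousOn u Ω) {z ξ : Fin n → ℂ} (h : ∀ τ : ℂ, ‖τ‖ ≤ 1 → z + τ • ξ ∈ Ω) :
    UpperSemicontinuous fun θ : ℝ => u (z + Complex.exp (θ * Complex.I) • ξ) := by
  have hc : Continuous fun θ : ℝ => z + Complex.exp (θ * Complex.I) • ξ := by fun_prop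
  rw [← upperSemicontinuousOn_univ_iff]
  intro θ _ a ha
  have h1 := hu _ (h _ (norm_exp_mul_I_le θ)) a ha
  rw [nhdsWithin_univ]
  have h2 : Filter.Tendsto (fun θ : ℝ => z + Complex.exp (θ * Complex.I) • ξ) (𝓝 θ)
      (𝓝[Ω] (z + Complex.exp (θ * Complex.I) • ξ)) :=
    tendsto_nhdsWithin_iff.2 ⟨hc.tendsto θ,
      Filter.Eventually.of_forall fun θ => h _ (norm_exp_mul_I_le θ)⟩
  exact h2.eventually h1

theorem bddAbove_circle {u : (Fin n → ℂ) → ℝ} {Ω : Set (Fin n → ℂ)}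
    (hu : UpperSemicontinuousOn u Ω) {z ξ : Fin n → ℂ} (h : ∀ τ : ℂ, ‖τ‖ ≤ 1 → z + τ • ξ ∈ Ω) :
    ∃ C, ∀ τ : ℂ, ‖τ‖ ≤ 1 → u (z + τ • ξ) ≤ C := by
  have hc : Continuous fun τ : ℂ => z + τ • ξ := by fun_prop
  have hK : IsCompact ((fun τ : ℂ => z + τ • ξ) '' closedBall 0 1) :=
    (isCompact_closedBall 0 1).image hc
  have hsub : (fun τ : ℂ => z + τ • ξ) '' closedBall 0 1 ⊆ Ω := by
    rintro _ ⟨τ, hτ, rfl⟩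
    exact h τ (by simpa using hτ)
  obtain ⟨C, hC⟩ := (hu.mono hsub).bddAbove_of_isCompact hK
  exact ⟨C, fun τ hτ => hC ⟨_, ⟨τ, by simpa using hτ, rfl⟩, rfl⟩⟩

theorem log_ofReal_upperSemicontinuousOn {Y : Type*} [TopologicalSpace Y] {u : Y → ℝ} {s : Set Y} :
    UpperSemicontinuousOn u s → UpperSemicontinuousOn
      (fun y => ENNReal.log (ENNReal.ofReal (u y))) s := by
  intro hu z hz a ha
  have h1 : Continuous fun t : ℝ => ENNReal.log (ENNReal.ofReal t) :=
    ENNReal.continuous_log.comp ENNReal.continuous_ofReal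
  have h2 : ∀ᶠ t in 𝓝 (u z), ENNReal.log (ENNReal.ofReal t) < a :=
    (h1.tendsto (u z)).eventually_lt_const ha
  obtain ⟨e, he, h3⟩ := Metric.eventually_nhds_iff.1 h2
  filter_upwards [hu z hz (u z + e / 2) (by linarith)] with y hy
  refine lt_of_le_of_lt (ENNReal.log_monotone (ENNReal.ofReal_le_ofReal hy.le)) (h3 ?_)
  rw [Real.dist_eq, add_sub_cancel_left, abs_of_pos (by linarith)]
  linarith

theorem upperSemicontinuousOn_of_log_ofReal {Y : Type*} [TopologicalSpace Y] {u : Y → ℝ}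
    {s : Set Y} (h0 : ∀ y ∈ s, 0 ≤ u y)
    (hu : UpperSemicontinuousOn (fun y => ENNReal.log (ENNReal.ofReal (u y))) s) :
    UpperSemicontinuousOn u s := by
  intro z hz a ha
  have ha0 : 0 < a := (h0 z hz).trans_lt ha
  filter_upwards [hu z hz (ENNReal.log (ENNReal.ofReal a))
    (ENNReal.log_lt_log_iff.2 ((ENNReal.ofReal_lt_ofReal_iff ha0).2 ha))] with y hy
  exact (ENNReal.ofReal_lt_ofReal_iff ha0).1 (ENNReal.log_lt_log_iff.1 hy)

theorem circleAverage_zero_one (f : ℂ → ℝ) : Real.circleAverage f 0 1 =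
    (2 * Real.pi)⁻¹ * ∫ θ in (0)..(2 * Real.pi), f (Complex.exp (θ * Complex.I)) := by
  simpa using circleAverage_eq_integral_exp f 0 1

theorem IsLogPsh.isPsh {u : (Fin n → ℂ) → ℝ} {Ω : Set (Fin n → ℂ)} (hu : IsLogPsh u Ω)
    (hΩ : IsOpen Ω) : IsPsh (fun z => ENNReal.log (ENNReal.ofReal (u z))) Ω where
  lt_top z _ := by
    rw [lt_top_iff_ne_top, Ne, ENNReal.log_eq_top_iff]
    exact ENNReal.ofReal_ne_top
  usc := log_ofReal_upperSemicontinuousOn hu.usc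
  mean_value z hz := by
    filter_upwards [eventually_disc_subset hΩ hz] with ξ hξ
    rw [circleMean_eq_angleMean]
    obtain ⟨C, hC⟩ := bddAbove_circle hu.usc hξ
    refine log_le_angleMean (C := C) (f := fun θ => u (z + Complex.exp (θ * Complex.I) • ξ))
      (upperSemicontinuous_circle hu.usc hξ).measurable
      (fun θ => hu.nonneg _ (hξ _ (norm_exp_mul_I_le θ))) (fun θ => hC _ (norm_exp_mul_I_le θ))
      fun δ hδ => ?_
    have := hu.submean z ξ hξ δ hδ
    rwa [circleAverage_zero_one] at this

theorem circleMean_congr {φ ψ : (Fin n → ℂ) → EReal} {z ξ : Fin n → ℂ}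
    (h : ∀ θ : ℝ, φ (z + Complex.exp (θ * Complex.I) • ξ) = ψ (z + Complex.exp (θ * Complex.I) • ξ)) :
    circleMean φ z ξ = circleMean ψ z ξ := by
  simp only [circleMean, h]

theorem IsPsh.congr {φ ψ : (Fin n → ℂ) → EReal} {Ω : Set (Fin n → ℂ)} (hφ : IsPsh φ Ω)
    (hΩ : IsOpen Ω) (h : ∀ z ∈ Ω, φ z = ψ z) : IsPsh ψ Ω where
  lt_top z hz := h z hz ▸ hφ.lt_top z hz
  usc z hz a ha := by
    have h1 := hφ.usc z hz a (by show φ z < a; rw [h z hz]; exact ha)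
    filter_upwards [h1, self_mem_nhdsWithin] with y hy hyΩ
    rwa [← h y hyΩ]
  mean_value z hz := by
    filter_upwards [hφ.mean_value z hz, eventually_disc_subset hΩ hz] with ξ h1 h2
    rwa [← h z hz, ← circleMean_congr fun θ => h _ (h2 _ (norm_exp_mul_I_le θ))]

/-- Matrix functions on an open set of `ℂⁿ` such that `log |v|²_G` is plurisubharmonic for all
holomorphic `v`. -/
structure LogGriffithsNeg {ι : Type*} [Fintype ι] (G : (Fin n → ℂ) → Matrix ι ι ℂ)
    (Ω : Set (Fin n → ℂ)) : Prop where
  isOpen : IsOpen Ω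
  psd : ∀ z ∈ Ω, (G z).PosSemidef
  psh : ∀ Ω₁ ⊆ Ω, IsOpen Ω₁ → ∀ v : (Fin n → ℂ) → ι → ℂ, ContDiffOn ℂ ω v Ω₁ →
    IsPsh (fun z => ENNReal.log (ENNReal.ofReal (quad (G z) (v z)))) Ω₁

variable {ι : Type*} [Fintype ι] {G : (Fin n → ℂ) → Matrix ι ι ℂ} {Ω : Set (Fin n → ℂ)}

theorem LogGriffithsNeg.eventually_le (hG : LogGriffithsNeg G Ω) {z₀ : Fin n → ℂ} (hz : z₀ ∈ Ω)
    {δ : ℝ} (hδ : 0 < δ) :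
    ∀ᶠ z in 𝓝 z₀, ∀ v, quad (G z) v ≤ quad (G z₀) v + δ * ∑ i, ‖v i‖ ^ 2 := by
  refine eventually_quad_le ?_ (fun v a ha => ?_) hδ
  · filter_upwards [hG.isOpen.mem_nhds hz] with z h using hG.psd z h
  · have h1 := upperSemicontinuousOn_of_log_ofReal
      (fun z hz => (hG.psd z hz).quad_nonneg v)
      (hG.psh Ω subset_rfl hG.isOpen (fun _ => v) contDiffOn_const).usc z₀ hz a ha
    rwa [hG.isOpen.nhdsWithin_eq hz] at h1

/-- Jensen's inequality removes the logarithm from the mean value inequality on small circles, and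
the local maximum principle extends the result to all discs. -/
theorem LogGriffithsNeg.line (hG : LogGriffithsNeg G Ω) (z ξ : Fin n → ℂ) :
    GriffithsNeg (fun τ => G (z + τ • ξ)) {τ | z + τ • ξ ∈ Ω} := by
  have hlc : Continuous fun τ : ℂ => z + τ • ξ := by fun_prop
  -- For `ξ = 0` the slice is constant, or its domain is empty.
  rcases eq_or_ne ξ 0 with rfl | hξ
  · by_cases hz : z ∈ Ω
    · obtain ⟨C, hC⟩ := (hG.psd z hz).exists_factor
      simp only [smul_zero, add_zero, hC]
      exact GriffithsNeg.of_factor (C := fun _ => C) (fun i j => differentiable_const _) _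
    · simp only [smul_zero, add_zero, hz]
      refine ⟨fun _ h => h.elim, fun _ h => h.elim, fun c r W v hr _ hc hW => ?_⟩
      exact (hW (hc (mem_closedBall_self hr.le))).elim
  have husc : ∀ τ₀ : ℂ, z + τ₀ • ξ ∈ Ω → ∀ δ > 0, ∀ᶠ τ in 𝓝 τ₀, ∀ v,
      quad (G (z + τ • ξ)) v ≤ quad (G (z + τ₀ • ξ)) v + δ * ∑ i, ‖v i‖ ^ 2 :=
    fun τ₀ h δ hδ => (hlc.tendsto τ₀).eventually (hG.eventually_le h hδ)
  refine ⟨fun τ hτ => hG.psd _ hτ, husc, fun c r W v hr hW hc hWD hv => ?_⟩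
  obtain ⟨k, hk⟩ := Function.ne_iff.1 hξ
  have hk : ξ k ≠ 0 := hk
  -- A linear coordinate inverting `τ ↦ z + τ ξ` on the line. Composing with it extends a section
  -- from the line to an open set of `ℂⁿ`, where the hypothesis can be applied.
  set ℓ : (Fin n → ℂ) → ℂ := fun y => (y k - z k) / ξ k with hℓ
  have hℓd : ContDiff ℂ ω ℓ := by
    have : ContDiff ℂ ω fun y : Fin n → ℂ => y k := contDiff_apply ℂ ℂ k
    exact (this.sub contDiff_const).div_const _
  have hℓτ : ∀ τ : ℂ, ℓ (z + τ • ξ) = τ := by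
    intro τ
    simp [hℓ, hk]
  have hΩ₁ : IsOpen (Ω ∩ ℓ ⁻¹' W) := hG.isOpen.inter (hW.preimage hℓd.continuous)
  have hpsh := hG.psh (Ω ∩ ℓ ⁻¹' W) inter_subset_left hΩ₁ (v ∘ ℓ)
    ((hv.contDiffOn hW).comp hℓd.contDiffOn fun y hy => hy.2)
  have huscW : UpperSemicontinuousOn (fun τ => quad (G (z + τ • ξ)) (v τ)) W := fun τ hτ =>
    upperSemicontinuousWithinAt_quad
      (fun δ hδ => nhdsWithin_le_nhds (husc τ (hWD hτ) δ hδ)) (hv.continuousOn τ hτ)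
  have h0 : ∀ τ ∈ W, 0 ≤ quad (G (z + τ • ξ)) (v τ) := fun τ hτ =>
    (hG.psd _ (hWD hτ)).quad_nonneg _
  refine le_circleAverage_of_local (u := fun τ => quad (G (z + τ • ξ)) (v τ)) (m := 0) hr
    (huscW.mono hc) (fun τ hτ => h0 τ (hc hτ)) fun a ha δ hδ => ?_
  have haW : a ∈ W := hc (ball_subset_closedBall ha)
  have hmv := hpsh.mean_value (z + a • ξ) ⟨hWD haW, by rwa [mem_preimage, hℓτ]⟩
  have ht : Filter.Tendsto (fun ρ : ℝ => (ρ : ℂ) • ξ) (𝓝[>] 0) (𝓝 0) := by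
    have : Continuous fun ρ : ℝ => (ρ : ℂ) • ξ := by fun_prop
    simpa using (this.tendsto 0).mono_left nhdsWithin_le_nhds
  filter_upwards [ht.eventually hmv, eventually_pos_closedBall_subset hW haW] with ρ h1 ⟨h2, h3⟩
  have e : ∀ θ : ℝ, z + a • ξ + Complex.exp (θ * Complex.I) • (ρ : ℂ) • ξ =
      z + (a + Complex.exp (θ * Complex.I) * ρ) • ξ := by
    intro θ; rw [smul_smul, add_smul, add_assoc]
  have hmem : ∀ θ : ℝ, a + Complex.exp (θ * Complex.I) * ρ ∈ closedBall a ρ := by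
    intro θ
    rw [mem_closedBall, dist_self_add_left, norm_mul, Complex.norm_exp_ofReal_mul_I, one_mul,
      Complex.norm_real, Real.norm_of_nonneg h2.le]
  have hmem' : ∀ θ : ℝ, a + Complex.exp (θ * Complex.I) * ρ ∈ sphere a ρ := by
    intro θ
    rw [mem_sphere, dist_self_add_left, norm_mul, Complex.norm_exp_ofReal_mul_I, one_mul,
      Complex.norm_real, Real.norm_of_nonneg h2.le]
  have hci : CircleIntegrable (fun τ => quad (G (z + τ • ξ)) (v τ)) a ρ :=
    circleIntegrable_of_usc (m := 0) h2.le (huscW.mono (sphere_subset_closedBall.trans h3))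
      fun τ hτ => h0 τ (h3 (sphere_subset_closedBall hτ))
  have hρn : ‖(ρ : ℂ)‖ = ρ := by rw [Complex.norm_real, Real.norm_of_nonneg h2.le]
  have havg := circleAverage_eq_integral_exp (fun τ => quad (G (z + τ • ξ)) (v τ)) a ρ
  rw [hρn] at havg
  have : quad (G (z + a • ξ)) (v a) ≤
      Real.circleAverage (fun τ => quad (G (z + τ • ξ)) (v τ)) a ρ := by
    rw [havg]
    refine le_integral_of_log_le_angleMean ?_ (fun θ => h0 _ (h3 (hmem θ))) ?_
    · simp only [CircleIntegrable, circleMap] at hci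
      refine hci.congr fun θ _ => ?_
      simp only [mul_comm]
    · rw [circleMean_eq_angleMean] at h1
      simpa only [e, Function.comp_apply, hℓτ] using h1
  have : 0 ≤ δ * ρ ^ 2 := by positivity
  linarith

/-- Restrict to a complex line, take the tensor power there, and return to the logarithm. -/
theorem LogGriffithsNeg.isLogPsh_tensorPow (hG : LogGriffithsNeg G Ω) (m : ℕ)
    {Ω₁ : Set (Fin n → ℂ)} (hΩ₁ : IsOpen Ω₁) (h : Ω₁ ⊆ Ω) {T : (Fin n → ℂ) → (Fin m → ι) → ℂ}
    (hT : DifferentiableOn ℂ T Ω₁) :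
    IsLogPsh (fun z => quad (tensorPowMatrix m (G z)) (T z)) Ω₁ where
  nonneg z hz := (posSemidef_tensorPowMatrix (hG.psd z (h hz)) m).quad_nonneg _
  usc z hz := by
    refine upperSemicontinuousWithinAt_quad (fun δ hδ => nhdsWithin_le_nhds ?_)
      (hT.continuousOn z hz)
    refine eventually_quad_tensorPow_le ?_ (hG.psd z (h hz))
      (fun δ hδ => hG.eventually_le (h hz) hδ) m δ hδ
    filter_upwards [hG.isOpen.mem_nhds (h hz)] with y hy using hG.psd y hy
  submean z ξ hz δ hδ := by
    have hlc : Differentiable ℂ fun τ : ℂ => z + τ • ξ := by fun_prop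
    have h1 := ((hG.line z ξ).tensorPow (hG.isOpen.preimage hlc.continuous) m).log_submean
      (c := 0) (r := 1) (W := (fun τ : ℂ => z + τ • ξ) ⁻¹' Ω₁)
      (v := fun τ => T (z + τ • ξ)) one_pos (hΩ₁.preimage hlc.continuous)
      (fun τ hτ => hz τ (by simpa using hτ)) (fun τ hτ => h hτ)
      (hT.comp hlc.differentiableOn fun τ hτ => hτ) hδ
    simpa using h1

end LogPsh

end

noncomputable section

/-! ### Local integrability of logarithms -/

section LogIntegrable

open Metric Set

variable {n : ℕ} {u : (Fin n → ℂ) → ℝ} {Ω : Set (Fin n → ℂ)}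

/-- The submean inequality refers to whole discs inside `Ω`, which no single neighbourhood need
contain; the local maximum principle assembles it from small circles. -/
theorem IsLogPsh.of_local (h : ∀ z ∈ Ω, ∃ Ω₁, IsOpen Ω₁ ∧ z ∈ Ω₁ ∧ IsLogPsh u Ω₁) :
    IsLogPsh u Ω where
  nonneg z hz := by obtain ⟨Ω₁, _, h1, h2⟩ := h z hz; exact h2.nonneg z h1
  usc z hz := by
    obtain ⟨Ω₁, ho, h1, h2⟩ := h z hz
    intro a ha
    have h3 := h2.usc z h1 a ha
    rw [ho.nhdsWithin_eq h1] at h3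
    exact nhdsWithin_le_nhds h3
  submean z ξ hz δ hδ := by
    have hlc : Continuous fun τ : ℂ => z + τ • ξ := by fun_prop
    have h0 : ∀ τ ∈ closedBall (0 : ℂ) 1, 0 ≤ u (z + τ • ξ) := fun τ hτ => by
      obtain ⟨Ω₁, _, h1, h2⟩ := h _ (hz τ (by simpa using hτ))
      exact h2.nonneg _ h1
    have husc : UpperSemicontinuousOn (fun τ : ℂ => u (z + τ • ξ)) (closedBall 0 1) := by
      intro τ hτ a ha
      obtain ⟨Ω₁, ho, h1, h2⟩ := h _ (hz τ (by simpa using hτ))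
      have h3 := h2.usc _ h1 a ha
      rw [ho.nhdsWithin_eq h1] at h3
      exact nhdsWithin_le_nhds ((hlc.tendsto τ).eventually h3)
    have := le_circleAverage_of_local (u := fun τ : ℂ => Real.log (u (z + τ • ξ) + δ))
      (c := 0) one_pos (upperSemicontinuousOn_log_add husc h0 hδ) (m := Real.log δ)
      (fun τ hτ => Real.log_le_log hδ (by linarith [h0 τ hτ])) fun a ha η hη => ?_
    · simpa using this
    · obtain ⟨Ω₁, ho, h1, h2⟩ := h _ (hz a (by simpa using (ball_subset_closedBall ha)))
      have ht : Filter.Tendsto (fun ρ : ℝ => (ρ : ℂ) • ξ) (𝓝[>] 0) (𝓝 0) := by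
        have : Continuous fun ρ : ℝ => (ρ : ℂ) • ξ := by fun_prop
        simpa using (this.tendsto 0).mono_left nhdsWithin_le_nhds
      filter_upwards [ht.eventually (eventually_disc_subset ho h1), self_mem_nhdsWithin]
        with ρ hρ hρ0
      have hρ0 : 0 < ρ := hρ0
      have h3 := h2.submean _ _ hρ δ hδ
      rw [circleAverage_zero_one] at h3
      have h4 := circleAverage_eq_integral_exp
        (fun τ : ℂ => Real.log (u (z + τ • ξ) + δ)) a (ρ : ℂ)
      rw [Complex.norm_real, Real.norm_of_nonneg hρ0.le] at h4
      rw [h4]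
      have e : ∀ θ : ℝ, z + a • ξ + Complex.exp (θ * Complex.I) • (ρ : ℂ) • ξ =
          z + (a + Complex.exp (θ * Complex.I) * ρ) • ξ := by
        intro θ; rw [smul_smul, add_smul, add_assoc]
      simp only [e] at h3
      have : 0 ≤ η * ρ ^ 2 := by positivity
      linarith

theorem aemeasurable_of_upperSemicontinuousOn (hu : UpperSemicontinuousOn u Ω)
    (hΩ : MeasurableSet Ω) : AEMeasurable u (volume.restrict Ω) :=
  aemeasurable_restrict_of_measurable_subtype hΩ
    (UpperSemicontinuous.measurable (upperSemicontinuousOn_iff_restrict.2 hu))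

theorem IsLogPsh.exists_bound (hu : IsLogPsh u Ω) {K : Set (Fin n → ℂ)} (hK : IsCompact K)
    (hKΩ : K ⊆ Ω) : ∃ C, 0 ≤ C ∧ ∀ z ∈ K, u z ≤ C := by
  obtain ⟨C, hC⟩ := (hu.usc.mono hKΩ).bddAbove_of_isCompact hK
  exact ⟨max C 0, le_max_right _ _, fun z hz => (hC ⟨z, hz, rfl⟩).trans (le_max_left _ _)⟩

theorem IsLogPsh.abs_log_le {C δ : ℝ} {z : Fin n → ℂ} (h0 : 0 ≤ u z) (hC : u z ≤ C)
    (hδ : 0 < δ) : |Real.log (u z + δ)| ≤ |Real.log (C + δ)| + |Real.log δ| := by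
  have h1 : Real.log δ ≤ Real.log (u z + δ) := Real.log_le_log hδ (by linarith)
  have h2 : Real.log (u z + δ) ≤ Real.log (C + δ) := Real.log_le_log (by linarith) (by linarith)
  rw [abs_le]
  constructor
  · linarith [neg_abs_le (Real.log δ), abs_nonneg (Real.log (C + δ))]
  · linarith [le_abs_self (Real.log (C + δ)), abs_nonneg (Real.log δ)]

theorem IsLogPsh.integrableOn_log_add (hu : IsLogPsh u Ω) {K : Set (Fin n → ℂ)}
    (hK : IsCompact K) (hKΩ : K ⊆ Ω) {δ : ℝ} (hδ : 0 < δ) :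
    IntegrableOn (fun z => Real.log (u z + δ)) K := by
  obtain ⟨C, hC0, hC⟩ := hu.exists_bound hK hKΩ
  have hum := aemeasurable_of_upperSemicontinuousOn (hu.usc.mono hKΩ) hK.measurableSet
  refine ⟨(hum.add_const δ).log.aestronglyMeasurable, .restrict_of_bounded
    (C := |Real.log (C + δ)| + |Real.log δ|) hK.measure_lt_top ?_⟩
  filter_upwards [ae_restrict_mem hK.measurableSet] with z hz
  exact IsLogPsh.abs_log_le (hu.nonneg z (hKΩ hz)) (hC z hz) hδ

/-- The sup-norm ball about the origin is invariant under `y ↦ e^{iθ} y`, so after translation the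
integral is one of circle means, each at least the value at the centre. -/
theorem IsLogPsh.le_integral_closedBall (hu : IsLogPsh u Ω) {z₀ : Fin n → ℂ} {R : ℝ}
    (hR : closedBall z₀ R ⊆ Ω) {δ : ℝ} (hδ : 0 < δ) :
    volume.real (closedBall z₀ R) * Real.log (u z₀ + δ) ≤
      ∫ z in closedBall z₀ R, Real.log (u z + δ) := by
  have hpre : (fun y => z₀ + y) ⁻¹' closedBall z₀ R = closedBall 0 R := by
    ext y; simp
  have hmp := (measurePreserving_add_left (volume : Measure (Fin n → ℂ)) z₀)
  have hemb : MeasurableEmbedding fun y : Fin n → ℂ => z₀ + y := measurableEmbedding_addLeft z₀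
  have hint : IntegrableOn (fun y => Real.log (u (z₀ + y) + δ)) (closedBall 0 R) := by
    rw [← hpre]
    exact (hmp.integrableOn_comp_preimage hemb).2
      (hu.integrableOn_log_add (isCompact_closedBall z₀ R) hR hδ)
  have hrot : ∀ θ : ℝ, MeasurePreserving (fun y : Fin n → ℂ => Complex.exp (θ * Complex.I) • y)
      (volume.restrict (closedBall 0 R)) (volume.restrict (closedBall 0 R)) := by
    intro θ
    have h1 := (measurePreserving_exp_smul_pi n θ).restrict_preimage
      (measurableSet_closedBall (x := (0 : Fin n → ℂ)) (ε := R))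
    have h2 : (fun y : Fin n → ℂ => Complex.exp (θ * Complex.I) • y) ⁻¹' closedBall 0 R =
        closedBall 0 R := by
      ext y
      simp [norm_smul, Complex.norm_exp_ofReal_mul_I]
    rwa [h2] at h1
  obtain ⟨h1, h2⟩ := integral_eq_integral_rotation hrot hint
  rw [← hmp.setIntegral_preimage_emb hemb, hpre, h1]
  have h3 : volume.real (closedBall z₀ R) = volume.real (closedBall (0 : Fin n → ℂ) R) := by
    rw [← hpre, Measure.real, Measure.real, hmp.measure_preimage_emb hemb]
  rw [h3, ← smul_eq_mul, ← setIntegral_const]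
  refine setIntegral_mono_on (integrableOn_const (measure_closedBall_lt_top.ne)) h2
    measurableSet_closedBall fun y hy => ?_
  have h4 := hu.submean z₀ y (fun τ hτ => hR ?_) δ hδ
  · rwa [circleAverage_zero_one] at h4
  · rw [mem_closedBall, dist_self_add_left, norm_smul]
    rw [mem_closedBall_zero_iff] at hy
    calc ‖τ‖ * ‖y‖ ≤ 1 * ‖y‖ := by gcongr
      _ ≤ R := by rwa [one_mul]

/-- The solid submean inequality at a centre with `u z₀ > 0` bounds the integrals of `A - log (u +
δ)` independently of `δ`, and Fatou's lemma gives the limit. -/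
theorem IsLogPsh.integrableOn_log (hu : IsLogPsh u Ω) {z₀ : Fin n → ℂ} {R : ℝ}
    (hR : closedBall z₀ R ⊆ Ω) (hz₀ : 0 < u z₀)
    (hpos : ∀ᵐ z ∂volume.restrict (closedBall z₀ R), 0 < u z) :
    IntegrableOn (fun z => Real.log (u z)) (closedBall z₀ R) := by
  set B := closedBall z₀ R
  have hBc : IsCompact B := isCompact_closedBall z₀ R
  have : IsFiniteMeasure (volume.restrict B) := ⟨by simpa using hBc.measure_lt_top⟩
  obtain ⟨C, hC0, hC⟩ := hu.exists_bound hBc hR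
  -- An upper bound for `log (u + δ k)` on the ball for all `k`, since `δ k ≤ 1`; the integrands `A
  -- - log (u + δ k)` are thus non-negative.
  set A := Real.log (C + 1)
  set δ : ℕ → ℝ := fun k => 1 / ((k : ℝ) + 1)
  have hδ0 : ∀ k, 0 < δ k := fun k => by positivity
  have hδt : Filter.Tendsto δ Filter.atTop (𝓝 0) := tendsto_one_div_add_atTop_nhds_zero_nat
  have hδ1 : ∀ k, δ k ≤ 1 := fun k =>
    (div_le_one (by positivity)).2 (by linarith [(Nat.cast_nonneg k : (0 : ℝ) ≤ k)])
  have hum : AEMeasurable u (volume.restrict B) :=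
    aemeasurable_of_upperSemicontinuousOn (hu.usc.mono hR) hBc.measurableSet
  have hmem := ae_restrict_mem (μ := volume) hBc.measurableSet
  have hi : ∀ k, Integrable (fun z => A - Real.log (u z + δ k)) (volume.restrict B) := fun k =>
    (integrable_const A).sub (hu.integrableOn_log_add hBc hR (hδ0 k))
  have hk : ∀ k, ∫⁻ z in B, ENNReal.ofReal (A - Real.log (u z + δ k)) ≤
      ENNReal.ofReal (volume.real B * (A - Real.log (u z₀))) := by
    intro k
    rw [← ofReal_integral_eq_lintegral_ofReal (hi k)]
    · refine ENNReal.ofReal_le_ofReal ?_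
      rw [integral_sub (integrable_const A) (hu.integrableOn_log_add hBc hR (hδ0 k)),
        setIntegral_const, smul_eq_mul, mul_sub]
      have h1 := hu.le_integral_closedBall hR (hδ0 k)
      have h2 : Real.log (u z₀) ≤ Real.log (u z₀ + δ k) :=
        Real.log_le_log hz₀ (by linarith [hδ0 k])
      have h3 := mul_le_mul_of_nonneg_left h2 (measureReal_nonneg (μ := volume) (s := B))
      linarith
    · filter_upwards [hmem] with z hz
      exact sub_nonneg.2 (Real.log_le_log (by linarith [hu.nonneg z (hR hz), hδ0 k])
        (add_le_add (hC z hz) (hδ1 k)))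
  have hlim : ∀ᵐ z ∂volume.restrict B, Filter.liminf (fun k =>
      ENNReal.ofReal (A - Real.log (u z + δ k))) Filter.atTop =
      ENNReal.ofReal (A - Real.log (u z)) := by
    filter_upwards [hpos] with z hz
    refine Filter.Tendsto.liminf_eq ((ENNReal.continuous_ofReal.tendsto _).comp
      (tendsto_const_nhds.sub ?_))
    refine ((Real.continuousAt_log hz.ne').tendsto).comp ?_
    simpa using hδt.const_add (u z)
  have hfatou : ∫⁻ z in B, ENNReal.ofReal (A - Real.log (u z)) < ⊤ := by
    rw [← lintegral_congr_ae hlim]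
    refine lt_of_le_of_lt (lintegral_liminf_le' fun k => ?_) (lt_of_le_of_lt
      (Filter.liminf_le_of_le (by isBoundedDefault) fun b hb => ?_)
      (ENNReal.ofReal_lt_top (r := volume.real B * (A - Real.log (u z₀)))))
    · exact ((hum.add_const _).log.const_sub A).ennreal_ofReal
    · obtain ⟨k, hk'⟩ := hb.exists
      exact hk'.trans (hk k)
  have hint : Integrable (fun z => A - Real.log (u z)) (volume.restrict B) := by
    refine ⟨(hum.log.const_sub A).aestronglyMeasurable, ?_⟩
    rw [hasFiniteIntegral_iff_ofReal]
    · exact hfatou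
    · filter_upwards [hmem, hpos] with z hz hz'
      exact sub_nonneg.2 (Real.log_le_log hz' (by linarith [hC z hz]))
  have := (integrable_const (μ := volume.restrict B) A).sub hint
  refine this.congr (Filter.Eventually.of_forall fun z => ?_)
  simp

theorem IsLogPsh.locallyIntegrableOn_log (hu : IsLogPsh u Ω) (hΩ : IsOpen Ω)
    (hpos : ∀ᵐ z ∂volume.restrict Ω, 0 < u z) :
    LocallyIntegrableOn (fun z => Real.log (u z)) Ω := by
  intro z hz
  obtain ⟨e, he, hb⟩ := Metric.isOpen_iff.1 hΩ z hz
  have hsub : ball z (e / 3) ⊆ Ω := (ball_subset_ball (by linarith)).trans hb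
  -- The value at `z` itself may be zero, so the ball is centred at a nearby point with `u > 0`. The
  -- radius `e / 3` leaves room for it to contain `z` and stay inside `Ω`.
  obtain ⟨z₀, hz₀, hz₀b⟩ : ∃ z₀, 0 < u z₀ ∧ z₀ ∈ ball z (e / 3) := by
    have h1 : ∀ᵐ z ∂volume.restrict (ball z (e / 3)), 0 < u z :=
      ae_restrict_of_ae_restrict_of_subset hsub hpos
    have h2 := h1.and (ae_restrict_mem measurableSet_ball)
    have : (ae (volume.restrict (ball z (e / 3)))).NeBot := by
      rw [ae_neBot, Ne, Measure.restrict_eq_zero]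
      exact (measure_ball_pos volume z (by linarith)).ne'
    exact h2.exists
  rw [mem_ball] at hz₀b
  have hB : closedBall z₀ (e / 3) ⊆ Ω := fun y hy => hb (by
    rw [mem_closedBall] at hy
    have := dist_triangle y z₀ z
    rw [mem_ball]; linarith)
  have h := hu.integrableOn_log hB hz₀ (ae_restrict_of_ae_restrict_of_subset hB hpos)
  refine ⟨closedBall z₀ (e / 3), mem_nhdsWithin_of_mem_nhds ?_, h⟩
  refine Filter.mem_of_superset (isOpen_ball.mem_nhds ?_) ball_subset_closedBall
  rw [mem_ball, dist_comm]
  exact hz₀b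

end LogIntegrable

end

noncomputable section

/-! ### Positivity of the Levi form of log-plurisubharmonic functions -/

section LeviForm

open Metric Set

/-- Integral form of the Taylor remainder; the third derivative is bounded because the support is
compact. -/
theorem exists_abs_sub_taylor_le {V : Type*} [NormedAddCommGroup V] [NormedSpace ℝ V] {χ : V → ℝ}
    (hχ : ContDiff ℝ ∞ χ) (hc : HasCompactSupport χ) : ∃ M, 0 ≤ M ∧ ∀ z y : V,
      |χ (z + y) - (χ z + fderiv ℝ χ z y + 2⁻¹ * fderiv ℝ (fderiv ℝ χ) z y y)| ≤ M * ‖y‖ ^ 3 := by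
  obtain ⟨M, hM⟩ := (hc.iteratedFDeriv (𝕜 := ℝ) 3).exists_bound_of_continuous
    ((contDiff_infty.1 hχ 3).continuous_iteratedFDeriv (m := 3) le_rfl)
  have hM0 : 0 ≤ M := (norm_nonneg _).trans (hM 0)
  refine ⟨M, hM0, fun z y => ?_⟩
  have h := map_add_eq_sum_add_integral_iteratedFDeriv (f := χ) (x := z) (y := y) (n := 2)
    fun t _ => by exact_mod_cast (contDiff_infty.1 hχ 3).contDiffAt
  have h2 : iteratedFDeriv ℝ 2 χ z (fun _ => y) = fderiv ℝ (fderiv ℝ χ) z y y :=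
    iteratedFDeriv_two_apply χ z _
  simp only [Finset.sum_range_succ, Finset.sum_range_zero, iteratedFDeriv_zero_apply,
    iteratedFDeriv_one_apply, h2, smul_eq_mul, Nat.factorial_two, Nat.factorial_one, Nat.factorial_zero, zero_add, Nat.cast_one, inv_one,
    one_mul, Nat.reduceAdd, Nat.cast_ofNat] at h
  rw [h, add_sub_cancel_left, abs_mul]
  have h3 : |(∫ t in (0 : ℝ)..1, (1 - t) ^ 2 * iteratedFDeriv ℝ 3 χ (z + t • y) (fun _ => y) : ℝ)| ≤
      (M * ‖y‖ ^ 3) * |1 - 0| := by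
    rw [← Real.norm_eq_abs]
    refine intervalIntegral.norm_integral_le_of_norm_le_const fun t ht => ?_
    rw [uIoc_of_le zero_le_one] at ht
    have h4 : ‖(iteratedFDeriv ℝ 3 χ (z + t • y)) fun _ => y‖ ≤ M * ‖y‖ ^ 3 := by
      refine ((iteratedFDeriv ℝ 3 χ (z + t • y)).le_opNorm _).trans ?_
      simp only [Finset.prod_const, Finset.card_univ, Fintype.card_fin]
      gcongr
      exact hM _
    rw [norm_mul, norm_pow, Real.norm_of_nonneg (by linarith [ht.2] : 0 ≤ 1 - t)]
    calc (1 - t) ^ 2 * ‖(iteratedFDeriv ℝ 3 χ (z + t • y)) fun _ => y‖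
        ≤ 1 * (M * ‖y‖ ^ 3) := by
          gcongr
          exact pow_le_one₀ (by linarith [ht.2]) (by linarith [ht.1])
      _ = _ := one_mul _
  rw [sub_zero, abs_one, mul_one] at h3
  calc |(2 : ℝ)⁻¹| * _ ≤ 1 * (M * ‖y‖ ^ 3) := by
        gcongr
        rw [abs_of_pos (by norm_num)]; norm_num
    _ = _ := one_mul _

variable {n : ℕ}

/-- The mean of `χ` over the circle of radius `t` in the direction `w`. -/
def discMean (χ : (Fin n → ℂ) → ℝ) (w : Fin n → ℂ) (t : ℝ) (z : Fin n → ℂ) : ℝ :=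
  (2 * Real.pi)⁻¹ * ∫ θ in (0)..(2 * Real.pi), χ (z - (t * Complex.exp (θ * Complex.I)) • w)

/-- In the second-order expansion the means of `cos`, `sin` and `sin · cos` vanish while those of
`cos²` and `sin²` are `1/2`. What remains at order `t²` is exactly the Levi form. -/
theorem exists_abs_discMean_sub_le {χ : (Fin n → ℂ) → ℝ} (hχ : ContDiff ℝ ∞ χ)
    (hc : HasCompactSupport χ) : ∃ M, 0 ≤ M ∧ ∀ w z : Fin n → ℂ, ∀ t : ℝ, 0 ≤ t →
      |discMean χ w t z - χ z - t ^ 2 * leviForm χ z w| ≤ M * (t * ‖w‖) ^ 3 := by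
  obtain ⟨M, hM0, hM⟩ := exists_abs_sub_taylor_le hχ hc
  refine ⟨M, hM0, fun w z t ht => ?_⟩
  set L := fderiv ℝ χ z
  set B := fderiv ℝ (fderiv ℝ χ) z
  set y : ℝ → (Fin n → ℂ) := fun θ => -((t * Complex.exp (θ * Complex.I)) • w) with hy
  have hyn : ∀ θ, ‖y θ‖ = t * ‖w‖ := by
    intro θ
    rw [hy, norm_neg, norm_smul, norm_mul, Complex.norm_exp_ofReal_mul_I, Complex.norm_real,
      Real.norm_of_nonneg ht, mul_one]
  have hye : ∀ θ, y θ = (-(t * Real.cos θ)) • w + (-(t * Real.sin θ)) • (Complex.I • w) := by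
    intro θ
    ext k
    simp only [hy, Pi.neg_apply, Pi.smul_apply, Pi.add_apply, smul_eq_mul, Complex.real_smul,
      Complex.exp_mul_I]
    push_cast
    ring
  set q : ℝ → ℝ := fun θ => χ z + L (y θ) + 2⁻¹ * B (y θ) (y θ) with hq
  have hqe : ∀ θ, q θ = χ z + (-(t * L w)) * Real.cos θ + (-(t * L (Complex.I • w))) * Real.sin θ +
      (t ^ 2 / 2 * B w w) * Real.cos θ ^ 2 +
      (t ^ 2 / 2 * (B w (Complex.I • w) + B (Complex.I • w) w)) * (Real.sin θ * Real.cos θ) +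
      (t ^ 2 / 2 * B (Complex.I • w) (Complex.I • w)) * Real.sin θ ^ 2 := by
    intro θ
    simp only [hq, hye, map_add, map_smul, add_apply,
      smul_apply, smul_eq_mul]
    ring
  have hqi : (2 * Real.pi)⁻¹ * ∫ θ in (0)..(2 * Real.pi), q θ = χ z + t ^ 2 * leviForm χ z w := by
    simp only [hqe]
    rw [intervalIntegral.integral_add (Continuous.intervalIntegrable (by fun_prop) _ _)
        (Continuous.intervalIntegrable (by fun_prop) _ _),
      intervalIntegral.integral_add (Continuous.intervalIntegrable (by fun_prop) _ _)
        (Continuous.intervalIntegrable (by fun_prop) _ _),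
      intervalIntegral.integral_add (Continuous.intervalIntegrable (by fun_prop) _ _)
        (Continuous.intervalIntegrable (by fun_prop) _ _),
      intervalIntegral.integral_add (Continuous.intervalIntegrable (by fun_prop) _ _)
        (Continuous.intervalIntegrable (by fun_prop) _ _),
      intervalIntegral.integral_add (Continuous.intervalIntegrable (by fun_prop) _ _)
        (Continuous.intervalIntegrable (by fun_prop) _ _)]
    simp only [intervalIntegral.integral_const_mul, intervalIntegral.integral_const, integral_cos,
      integral_sin, integral_cos_sq, integral_sin_sq, integral_sin_mul_cos₁, Real.sin_two_pi,
      Real.cos_two_pi, Real.sin_zero, Real.cos_zero, leviForm, iteratedFDeriv_two_apply,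
      smul_eq_mul, Matrix.cons_val_zero, Matrix.cons_val_one]
    have := Real.pi_ne_zero
    field_simp
    ring
  have hyc : Continuous y := by fun_prop
  have hqc : Continuous q := by
    have h1 : Continuous fun θ => B (y θ) (y θ) := by fun_prop
    fun_prop
  have hχy : Continuous fun θ => χ (z + y θ) := by
    have := hχ.continuous
    fun_prop
  have h1 : discMean χ w t z - χ z - t ^ 2 * leviForm χ z w =
      (2 * Real.pi)⁻¹ * ∫ θ in (0)..(2 * Real.pi), (χ (z + y θ) - q θ) := by
    rw [intervalIntegral.integral_sub (hχy.intervalIntegrable _ _) (hqc.intervalIntegrable _ _),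
      mul_sub, hqi, discMean]
    simp only [hy, sub_eq_add_neg]
    ring
  have h2 : ‖∫ θ in (0)..(2 * Real.pi), (χ (z + y θ) - q θ)‖ ≤
      (M * (t * ‖w‖) ^ 3) * |2 * Real.pi - 0| :=
    intervalIntegral.norm_integral_le_of_norm_le_const fun θ _ => by
      rw [← hyn θ]
      exact hM z (y θ)
  rw [h1, abs_mul, abs_of_pos (by positivity)]
  rw [sub_zero, abs_of_pos Real.two_pi_pos, Real.norm_eq_abs] at h2
  calc _ ≤ (2 * Real.pi)⁻¹ * (M * (t * ‖w‖) ^ 3 * (2 * Real.pi)) := by gcongr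
    _ = _ := by have := Real.pi_ne_zero; field_simp

/-- Averaging over circles in the direction `w` is transferred from `ψ` to the test function by
translating the variable, which explains the minus sign in `discMean`. -/
theorem integral_mul_discMean {χ ψ : (Fin n → ℂ) → ℝ} (hχ : Continuous χ)
    (hc : HasCompactSupport χ) (hψ : Integrable ψ) (w : Fin n → ℂ) (t : ℝ) :
    Integrable (fun z => χ z * ((2 * Real.pi)⁻¹ * ∫ θ in (0)..(2 * Real.pi),
      ψ (z + (t * Complex.exp (θ * Complex.I)) • w))) ∧
    Integrable (fun z => ψ z * discMean χ w t z) ∧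
    ∫ z, χ z * ((2 * Real.pi)⁻¹ * ∫ θ in (0)..(2 * Real.pi),
      ψ (z + (t * Complex.exp (θ * Complex.I)) • w)) = ∫ z, ψ z * discMean χ w t z := by
  obtain ⟨C, hC⟩ := hc.exists_bound_of_continuous hχ
  set μ := volume.restrict (uIoc 0 (2 * Real.pi)) with hμ
  have hfin : IsFiniteMeasure μ := by
    rw [hμ, uIoc_of_le Real.two_pi_pos.le]; infer_instance
  set y : ℝ → (Fin n → ℂ) := fun θ => (t * Complex.exp (θ * Complex.I)) • w
  have hy : Continuous y := by fun_prop
  have hmp : MeasurePreserving (fun p : ℝ × (Fin n → ℂ) => (p.1, p.2 + y p.1))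
      (μ.prod volume) (μ.prod volume) :=
    (MeasurePreserving.id μ).skew_product (f := id) (g := fun θ z => z + y θ)
      (Continuous.measurable (by unfold Function.uncurry; fun_prop))
      (Filter.Eventually.of_forall fun θ => (measurePreserving_add_right volume (y θ)).map_eq)
  have h1 : Integrable (fun p : ℝ × (Fin n → ℂ) => ψ p.2) (μ.prod volume) := hψ.comp_snd μ
  have h2 : Integrable (fun p : ℝ × (Fin n → ℂ) => ψ (p.2 + y p.1)) (μ.prod volume) :=
    (hmp.integrable_comp h1.aestronglyMeasurable).2 h1
  have i1 : Integrable (Function.uncurry fun (θ : ℝ) (z : Fin n → ℂ) => χ z * ψ (z + y θ))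
      (μ.prod volume) :=
    h2.bdd_mul (c := C) (f := fun p : ℝ × (Fin n → ℂ) => χ p.2)
      (hχ.comp continuous_snd).aestronglyMeasurable
      (Filter.Eventually.of_forall fun p => hC p.2)
  have i2 : Integrable (Function.uncurry fun (θ : ℝ) (z : Fin n → ℂ) => χ (z - y θ) * ψ z)
      (μ.prod volume) :=
    h1.bdd_mul (c := C) (f := fun p : ℝ × (Fin n → ℂ) => χ (p.2 - y p.1))
      (Continuous.aestronglyMeasurable (by fun_prop))
      (Filter.Eventually.of_forall fun p => hC _)
  have e1 : (fun z => χ z * ((2 * Real.pi)⁻¹ * ∫ θ in (0)..(2 * Real.pi), ψ (z + y θ))) =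
      fun z => (2 * Real.pi)⁻¹ * ∫ θ in (0)..(2 * Real.pi), χ z * ψ (z + y θ) := by
    funext z
    rw [intervalIntegral.integral_const_mul]; ring
  have e2 : (fun z => ψ z * discMean χ w t z) =
      fun z => (2 * Real.pi)⁻¹ * ∫ θ in (0)..(2 * Real.pi), χ (z - y θ) * ψ z := by
    funext z
    rw [intervalIntegral.integral_mul_const, discMean]; ring
  have j : ∀ f : ℝ → (Fin n → ℂ) → ℝ, Integrable (Function.uncurry f) (μ.prod volume) →
      Integrable fun z => (2 * Real.pi)⁻¹ * ∫ θ in (0)..(2 * Real.pi), f θ z := by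
    intro f hf
    refine Integrable.const_mul ?_ _
    have := hf.integral_prod_right
    simpa only [intervalIntegral.integral_of_le Real.two_pi_pos.le, hμ,
      uIoc_of_le Real.two_pi_pos.le, Function.uncurry] using this
  rw [e1, e2]
  refine ⟨j _ i1, j _ i2, ?_⟩
  rw [integral_const_mul, integral_const_mul, ← intervalIntegral_integral_swap i1,
    ← intervalIntegral_integral_swap i2]
  congr 1
  refine intervalIntegral.integral_congr fun θ _ => ?_
  have := integral_sub_right_eq_self (μ := (volume : Measure (Fin n → ℂ)))
    (fun z => χ z * ψ (z + y θ)) (y θ)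
  simpa using this.symm

theorem continuous_leviForm {χ : (Fin n → ℂ) → ℝ} (hχ : ContDiff ℝ ∞ χ) (w : Fin n → ℂ) :
    Continuous fun z => leviForm χ z w := by
  have h := (contDiff_infty.1 hχ 2).continuous_iteratedFDeriv (m := 2) le_rfl
  unfold leviForm
  fun_prop

theorem leviForm_eq_zero {χ : (Fin n → ℂ) → ℝ} {z : Fin n → ℂ} (hz : z ∉ tsupport χ)
    (w : Fin n → ℂ) : leviForm χ z w = 0 := by
  have : iteratedFDeriv ℝ 2 χ z = 0 := by
    by_contra h
    exact hz (support_iteratedFDeriv_subset 2 h)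
  simp [leviForm, this]

variable {u : (Fin n → ℂ) → ℝ} {Ω : Set (Fin n → ℂ)}

/-- Integrating the submean inequality against `χ` and moving the mean to `χ` gives `∫ ψ (discMean χ
- χ) ≥ 0`. Dividing by `t²` and letting `t → 0` leaves the Levi form. -/
theorem IsLogPsh.integral_log_add_mul_leviForm_nonneg (hu : IsLogPsh u Ω) (hΩ : IsOpen Ω)
    {δ : ℝ} (hδ : 0 < δ) (w : Fin n → ℂ) {χ : (Fin n → ℂ) → ℝ} (hχ : ContDiff ℝ ∞ χ)
    (hc : HasCompactSupport χ) (hs : tsupport χ ⊆ Ω) (h0 : ∀ z, 0 ≤ χ z) :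
    0 ≤ ∫ z in Ω, Real.log (u z + δ) * leviForm χ z w := by
  obtain ⟨e, he, hK⟩ := hc.isCompact.exists_cthickening_subset_open hΩ hs
  set K := cthickening e (tsupport χ)
  have hKc : IsCompact K := hc.isCompact.cthickening
  -- The cut-off is invisible to the argument: for `t ‖w‖ ≤ e` every disc centred in the support of
  -- `χ` stays in `K`.
  set ψ : (Fin n → ℂ) → ℝ := K.indicator fun z => Real.log (u z + δ) with hψd
  have hψ : Integrable ψ :=
    (integrable_indicator_iff hKc.measurableSet).2 (hu.integrableOn_log_add hKc hK hδ)
  have hψK : ∀ z ∈ K, ψ z = Real.log (u z + δ) := fun z hz => indicator_of_mem hz _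
  have hsK : tsupport χ ⊆ K := self_subset_cthickening _
  have hfinal : ∫ z in Ω, Real.log (u z + δ) * leviForm χ z w = ∫ z, ψ z * leviForm χ z w := by
    rw [← integral_indicator hΩ.measurableSet]
    refine integral_congr_ae (Filter.Eventually.of_forall fun z => ?_)
    by_cases hz : z ∈ tsupport χ
    · simp only [indicator_of_mem (hs hz), hψK z (hsK hz)]
    · simp [leviForm_eq_zero hz]
  rw [hfinal]
  obtain ⟨M, hM0, hM⟩ := exists_abs_discMean_sub_le hχ hc
  have hLi : Integrable fun z => ψ z * leviForm χ z w := by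
    have hLc : HasCompactSupport fun z => leviForm χ z w :=
      HasCompactSupport.intro hc.isCompact fun z hz => leviForm_eq_zero hz w
    obtain ⟨C, hC⟩ := hLc.exists_bound_of_continuous (continuous_leviForm hχ w)
    have := hψ.bdd_mul (c := C) (continuous_leviForm hχ w).aestronglyMeasurable
      (Filter.Eventually.of_forall hC)
    simpa only [mul_comm] using this
  have hχψ : Integrable fun z => χ z * ψ z := by
    obtain ⟨C, hC⟩ := hc.exists_bound_of_continuous hχ.continuous
    exact hψ.bdd_mul (c := C) hχ.continuous.aestronglyMeasurable (Filter.Eventually.of_forall hC)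
  have key : ∀ t : ℝ, 0 < t → t * ‖w‖ ≤ e →
      0 ≤ (∫ z, ψ z * leviForm χ z w) + t * (M * ‖w‖ ^ 3 * ∫ z, |ψ z|) := by
    intro t ht hte
    obtain ⟨i1, i2, h12⟩ := integral_mul_discMean hχ.continuous hc hψ w t
    have h1 : ∫ z, χ z * ψ z ≤ ∫ z, ψ z * discMean χ w t z := by
      rw [← h12]
      refine integral_mono hχψ i1 fun z => ?_
      by_cases hz : z ∈ tsupport χ
      · refine mul_le_mul_of_nonneg_left ?_ (h0 z)
        have hmem : ∀ τ : ℂ, ‖τ‖ ≤ 1 → z + τ • (t : ℂ) • w ∈ K := by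
          intro τ hτ
          refine mem_cthickening_of_dist_le _ z _ _ hz ?_
          rw [dist_self_add_left, norm_smul, norm_smul, Complex.norm_real,
            Real.norm_of_nonneg ht.le]
          calc ‖τ‖ * (t * ‖w‖) ≤ 1 * (t * ‖w‖) := by gcongr
            _ ≤ e := by rwa [one_mul]
        have h3 := hu.submean z ((t : ℂ) • w) (fun τ hτ => hK (hmem τ hτ)) δ hδ
        rw [circleAverage_zero_one] at h3
        rw [hψK z (hsK hz)]
        refine h3.trans_eq ?_
        congr 1
        refine intervalIntegral.integral_congr fun θ _ => ?_
        have h4 := hmem _ (norm_exp_mul_I_le θ)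
        rw [← hψK _ h4, smul_smul, mul_comm]
      · simp [image_eq_zero_of_notMem_tsupport hz]
    have h2 : ∫ z, (ψ z * discMean χ w t z - χ z * ψ z) ≤
        ∫ z, (t ^ 2 * (ψ z * leviForm χ z w) + M * (t * ‖w‖) ^ 3 * |ψ z|) := by
      refine integral_mono (i2.sub hχψ) ((hLi.const_mul _).add (hψ.abs.const_mul _)) fun z => ?_
      have h3 := hM w z t ht.le
      have h4 : ψ z * (discMean χ w t z - χ z - t ^ 2 * leviForm χ z w) ≤
          |ψ z| * (M * (t * ‖w‖) ^ 3) :=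
        (le_abs_self _).trans (by rw [abs_mul]; gcongr)
      linarith
    rw [integral_sub i2 hχψ, integral_add (hLi.const_mul _) (hψ.abs.const_mul _),
      integral_const_mul, integral_const_mul] at h2
    have h5 : 0 ≤ t ^ 2 * ((∫ z, ψ z * leviForm χ z w) + t * (M * ‖w‖ ^ 3 * ∫ z, |ψ z|)) := by
      have : t ^ 2 * ((∫ z, ψ z * leviForm χ z w) + t * (M * ‖w‖ ^ 3 * ∫ z, |ψ z|)) =
        t ^ 2 * (∫ z, ψ z * leviForm χ z w) + M * (t * ‖w‖) ^ 3 * ∫ z, |ψ z| := by ring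
      linarith
    exact nonneg_of_mul_nonneg_right h5 (by positivity)
  have hlim : Filter.Tendsto (fun t : ℝ => (∫ z, ψ z * leviForm χ z w) +
      t * (M * ‖w‖ ^ 3 * ∫ z, |ψ z|)) (𝓝[>] 0) (𝓝 (∫ z, ψ z * leviForm χ z w)) := by
    have : Continuous fun t : ℝ => (∫ z, ψ z * leviForm χ z w) +
      t * (M * ‖w‖ ^ 3 * ∫ z, |ψ z|) := by fun_prop
    simpa using (this.tendsto 0).mono_left nhdsWithin_le_nhds
  refine ge_of_tendsto hlim ?_
  have hsmall : ∀ᶠ t in 𝓝[>] (0 : ℝ), t * ‖w‖ < e := by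
    have : Continuous fun t : ℝ => t * ‖w‖ := by fun_prop
    exact nhdsWithin_le_nhds ((this.tendsto 0).eventually_lt_const (by simpa using he))
  filter_upwards [hsmall, self_mem_nhdsWithin] with t h1 h2
  exact key t h2 h1.le

/-- Remove `δ` by dominated convergence on the support of `χ`. Since `log u ≤ log (u + δ) ≤ log (C +
1)` there, the bound uses only the local integrability of `φ`. -/
theorem IsLogPsh.isPositiveDDbar (hu : IsLogPsh u Ω) (hΩ : IsOpen Ω) {φ : (Fin n → ℂ) → ℝ}
    (hφ : ∀ᵐ z ∂volume.restrict Ω, 0 < u z ∧ φ z = Real.log (u z)) : IsPositiveDDbar φ Ω := by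
  have hloc : LocallyIntegrableOn φ Ω := by
    have h1 := hu.locallyIntegrableOn_log hΩ (hφ.mono fun z h => h.1)
    intro z hz
    obtain ⟨s, hs, hi⟩ := h1 z hz
    refine ⟨s ∩ Ω, Filter.inter_mem hs self_mem_nhdsWithin, ?_⟩
    refine (hi.mono_set inter_subset_left).congr ?_
    exact (ae_restrict_of_ae_restrict_of_subset inter_subset_right hφ).mono fun z h => h.2.symm
  refine ⟨hloc, fun w χ hχ hc hs h0 => ?_⟩
  set δ : ℕ → ℝ := fun k => 1 / ((k : ℝ) + 1)
  have hδ0 : ∀ k, 0 < δ k := fun k => by positivity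
  have hδt : Filter.Tendsto δ Filter.atTop (𝓝 0) := tendsto_one_div_add_atTop_nhds_zero_nat
  have hδ1 : ∀ k, δ k ≤ 1 := fun k =>
    (div_le_one (by positivity)).2 (by linarith [(Nat.cast_nonneg k : (0 : ℝ) ≤ k)])
  set K := tsupport χ
  have hKc : IsCompact K := hc.isCompact
  obtain ⟨C, hC0, hC⟩ := hu.exists_bound hKc hs
  have hLc : HasCompactSupport fun z => leviForm χ z w :=
    HasCompactSupport.intro hKc fun z hz => leviForm_eq_zero hz w
  obtain ⟨B, hB⟩ := hLc.exists_bound_of_continuous (continuous_leviForm hχ w)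
  have hum := aemeasurable_of_upperSemicontinuousOn hu.usc hΩ.measurableSet
  have hφK : IntegrableOn φ K := hloc.integrableOn_compact_subset hs hKc
  have hbound : IntegrableOn (K.indicator fun z => (|φ z| + |Real.log (C + 1)|) * B) Ω := by
    refine (((integrable_indicator_iff hKc.measurableSet).2 ?_)).integrableOn
    exact (hφK.abs.add (integrableOn_const hKc.measure_lt_top.ne)).mul_const B
  refine ge_of_tendsto' (tendsto_integral_of_dominated_convergence
    (F := fun k z => Real.log (u z + δ k) * leviForm χ z w) _ (fun k => ?_) hbound (fun k => ?_)
    ?_) (fun k => hu.integral_log_add_mul_leviForm_nonneg hΩ (hδ0 k) w hχ hc hs h0)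
  · exact (hum.add_const _).log.aestronglyMeasurable.mul
      (continuous_leviForm hχ w).aestronglyMeasurable
  · filter_upwards [hφ] with z ⟨hz, hφz⟩
    by_cases hzK : z ∈ K
    · rw [indicator_of_mem hzK, norm_mul]
      refine mul_le_mul ?_ (hB z) (norm_nonneg _) (by positivity)
      have h1 : Real.log (u z) ≤ Real.log (u z + δ k) := Real.log_le_log hz (by linarith [hδ0 k])
      have h2 : Real.log (u z + δ k) ≤ Real.log (C + 1) :=
        Real.log_le_log (by linarith [hδ0 k]) (add_le_add (hC z hzK) (hδ1 k))
      rw [Real.norm_eq_abs, abs_le, hφz]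
      constructor
      · linarith [neg_abs_le (Real.log (u z)), abs_nonneg (Real.log (C + 1))]
      · linarith [le_abs_self (Real.log (C + 1)), abs_nonneg (Real.log (u z))]
    · simp [leviForm_eq_zero hzK, indicator_of_notMem hzK]
  · filter_upwards [hφ] with z ⟨hz, hφz⟩
    rw [hφz]
    refine Filter.Tendsto.mul_const _ (((Real.continuousAt_log hz.ne').tendsto).comp ?_)
    simpa using hδt.const_add (u z)

end LeviForm

end

noncomputable section

/-! ### The form induced on the dual of a power of a vector space -/

section Forms

variable {V : Type*} [AddCommGroup V] [Module ℂ V]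

theorem IsPosDefForm.isPosSemidefForm {h : SesqForm V} (hh : IsPosDefForm h) :
    IsPosSemidefForm h where
  conj_symm := hh.conj_symm
  nonneg v := by
    rcases eq_or_ne v 0 with rfl | hv
    · simp
    · exact (hh.pos v hv).le

/-- A conjugate-linear map is real-linear, so the dimension count is made over `ℝ`. -/
theorem bijective_of_injective_conj {V W : Type*} [AddCommGroup V] [Module ℂ V] [AddCommGroup W]
    [Module ℂ W] [FiniteDimensional ℂ V] [FiniteDimensional ℂ W]
    (hd : Module.finrank ℂ V = Module.finrank ℂ W) (f : V →ₗ⋆[ℂ] W) (hf : Function.Injective f) :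
    Function.Bijective f := by
  let f' : V →ₗ[ℝ] W :=
    { toFun := f
      map_add' := map_add f
      map_smul' := fun c v => by
        have h1 : c • v = (c : ℂ) • v := (Complex.coe_smul c v).symm
        have h2 : c • f v = (c : ℂ) • f v := (Complex.coe_smul c _).symm
        rw [h1, LinearMap.map_smulₛₗ, Complex.conj_ofReal, RingHom.id_apply, h2] }
  have h1 : Module.finrank ℝ V = Module.finrank ℝ W := by
    rw [finrank_real_of_complex, finrank_real_of_complex, hd]
  have : FiniteDimensional ℝ V := FiniteDimensional.complexToReal V
  have : FiniteDimensional ℝ W := FiniteDimensional.complexToReal W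
  exact ⟨hf, (LinearMap.injective_iff_surjective_of_finrank_eq_finrank (f := f') h1).1 hf⟩

theorem IsPosDefForm.bijective_flip [FiniteDimensional ℂ V] {h : SesqForm V}
    (hh : IsPosDefForm h) : Function.Bijective h.flip := by
  refine bijective_of_injective_conj (Subspace.dual_finrank_eq).symm _
    ((injective_iff_map_eq_zero _).2 fun v hv => ?_)
  by_contra hv0
  have h1 := hh.pos v hv0
  have h2 : h v v = 0 := by
    have := congrArg (fun f : Module.Dual ℂ V => f v) hv
    simpa using this
  simp [h2] at h1

theorem dualForm_apply_flip (h : SesqForm V) (hb : Function.Bijective h.flip)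
    (ξ : Module.Dual ℂ V) (v : V) : dualForm h ξ (h.flip v) = ξ v := by
  obtain ⟨a, rfl⟩ := hb.2 ξ
  rw [dualForm_flip h hb]
  rfl

theorem IsPosDefForm.isPosSemidefForm_dualForm [FiniteDimensional ℂ V] {h : SesqForm V}
    (hh : IsPosDefForm h) : IsPosSemidefForm (dualForm h) where
  conj_symm u v := by
    obtain ⟨a, rfl⟩ := hh.bijective_flip.2 u
    obtain ⟨b, rfl⟩ := hh.bijective_flip.2 v
    rw [dualForm_flip h hh.bijective_flip, dualForm_flip h hh.bijective_flip, hh.conj_symm]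
  nonneg v := by
    obtain ⟨a, rfl⟩ := hh.bijective_flip.2 v
    rw [dualForm_flip h hh.bijective_flip]
    exact hh.isPosSemidefForm.nonneg a

/-- The null case of Cauchy-Schwarz: for a null vector `y` the norm of `x - t a y` with `a = h x y`
is affine in `t` with slope `-2 |a|²`, so non-negativity forces `a = 0`. -/
theorem IsPosSemidefForm.apply_eq_zero {h : SesqForm V} (hh : IsPosSemidefForm h) {y : V}
    (hy : (h y y).re = 0) (x : V) : h x y = 0 := by
  set a := h x y with ha
  have hyy : h y y = 0 := by
    refine Complex.ext hy ?_
    have := congrArg Complex.im (hh.conj_symm y y)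
    simp only [Complex.conj_im] at this
    simp only [Complex.zero_im]
    linarith
  have h1 : ∀ t : ℝ, 0 ≤ (h x x).re - 2 * t * Complex.normSq a := by
    intro t
    have h2 := hh.nonneg (x + (-(t : ℂ) * a) • y)
    have h3 : h y x = conj a := by rw [ha, hh.conj_symm]
    simp only [map_add, LinearMap.add_apply, LinearMap.map_smulₛₗ, LinearMap.smul_apply,
      RingHom.id_apply, hyy, h3, ← ha, smul_eq_mul, map_mul, map_neg, Complex.conj_ofReal,
      mul_zero, add_zero] at h2
    have h4 : (h x x + -(t : ℂ) * a * conj a + -(t : ℂ) * conj a * a).re =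
        (h x x).re - 2 * t * Complex.normSq a := by
      have h5 : h x x + -(t : ℂ) * a * conj a + -(t : ℂ) * conj a * a =
        h x x - ((2 * t * Complex.normSq a : ℝ) : ℂ) := by
        push_cast
        rw [Complex.normSq_eq_conj_mul_self]; ring
      rw [h5, Complex.sub_re, Complex.ofReal_re]
    rw [← h4]
    convert h2 using 2
  by_contra h0
  have h2 : 0 < Complex.normSq a := Complex.normSq_pos.2 h0
  have h3 := h1 (((h x x).re + 1) / Complex.normSq a)
  have h4 : 2 * (((h x x).re + 1) / Complex.normSq a) * Complex.normSq a =
      2 * ((h x x).re + 1) := by field_simp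
  rw [h4] at h3
  linarith [hh.nonneg x]

/-! ### Dual of an induced form as a restricted tensor power of the dual form -/

section TensorDual

variable {N : Type*} [AddCommGroup N] [Module ℂ N] {m : ℕ} {ι κ : Type*} [Fintype ι] [Fintype κ]

/-- The canonical element `∑ b*_I ⊗ b_I` does not depend on the basis: expand one basis in the other
on both sides. -/
theorem sum_basis_tensor {P : Type*} [AddCommGroup P] [Module ℂ P] (b : Module.Basis ι ℂ V)
    (c : Module.Basis κ ℂ V) (μ : MultilinearMap ℂ (fun _ : Fin m => V) P)
    (Q : MultilinearMap ℂ (fun _ : Fin m => Module.Dual ℂ V) ℂ) :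
    ∑ I : Fin m → ι, Q (fun k => b.coord (I k)) • μ (fun k => b (I k)) =
      ∑ J : Fin m → κ, Q (fun k => c.coord (J k)) • μ (fun k => c (J k)) := by
  classical
  have h1 : ∀ J : Fin m → κ, μ (fun k => c (J k)) =
      ∑ I : Fin m → ι, (∏ k, b.coord (I k) (c (J k))) • μ fun k => b (I k) := by
    intro J
    have : (fun k => c (J k)) = fun k => ∑ i, b.coord i (c (J k)) • b i := by
      funext k; simp [b.sum_repr]
    rw [this, MultilinearMap.map_sum]
    simp only [MultilinearMap.map_smul_univ]
  have h2 : ∀ I : Fin m → ι, Q (fun k => b.coord (I k)) =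
      ∑ J : Fin m → κ, (∏ k, b.coord (I k) (c (J k))) * Q fun k => c.coord (J k) := by
    intro I
    have : (fun k => b.coord (I k)) = fun k => ∑ j, b.coord (I k) (c j) • c.coord j := by
      funext k; rw [c.sum_dual_apply_smul_coord]
    conv_lhs => rw [this, MultilinearMap.map_sum]
    simp only [MultilinearMap.map_smul_univ, smul_eq_mul]
  simp only [h1, h2, Finset.smul_sum, Finset.sum_smul, smul_smul]
  rw [Finset.sum_comm]
  simp only [mul_comm]

/-- The form on the dual of a power `N` of `V` induced by a form on the dual of `V`, in a basis. -/
def tensorDual (b : Module.Basis ι ℂ V) (μ : MultilinearMap ℂ (fun _ : Fin m => V) N)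
    (g : SesqForm (Module.Dual ℂ V)) : SesqForm (Module.Dual ℂ N) :=
  LinearMap.mk₂'ₛₗ (RingHom.id ℂ) (starRingEnd ℂ)
    (fun η ζ => (m.factorial : ℂ)⁻¹ * ∑ J : Fin m → ι, ∑ I : Fin m → ι,
      (∏ k, g (b.coord (I k)) (b.coord (J k))) * η (μ fun k => b (I k)) *
        conj (ζ (μ fun k => b (J k))))
    (fun _ _ _ => by
      simp only [LinearMap.add_apply, mul_add, add_mul, Finset.sum_add_distrib])
    (fun c _ _ => by
      simp only [LinearMap.smul_apply, smul_eq_mul, Finset.mul_sum, RingHom.id_apply]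
      exact Finset.sum_congr rfl fun _ _ => Finset.sum_congr rfl fun _ _ => by ring)
    (fun _ _ _ => by
      simp only [LinearMap.add_apply, map_add, mul_add, Finset.sum_add_distrib])
    (fun c _ _ => by
      simp only [LinearMap.smul_apply, smul_eq_mul, map_mul, Finset.mul_sum]
      exact Finset.sum_congr rfl fun _ _ => Finset.sum_congr rfl fun _ _ => by ring)

theorem tensorDual_apply (b : Module.Basis ι ℂ V) (μ : MultilinearMap ℂ (fun _ : Fin m => V) N)
    (g : SesqForm (Module.Dual ℂ V)) (η ζ : Module.Dual ℂ N) :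
    tensorDual b μ g η ζ = (m.factorial : ℂ)⁻¹ * ∑ J : Fin m → ι, ∑ I : Fin m → ι,
      (∏ k, g (b.coord (I k)) (b.coord (J k))) * η (μ fun k => b (I k)) *
        conj (ζ (μ fun k => b (J k))) := rfl

/-- The product of linear functionals as a multilinear map. -/
def prodFunctional {D : Type*} [AddCommGroup D] [Module ℂ D] (f : Fin m → D →ₗ[ℂ] ℂ) :
    MultilinearMap ℂ (fun _ : Fin m => D) ℂ :=
  (MultilinearMap.mkPiAlgebra ℂ (Fin m) ℂ).compLinearMap f

theorem prodFunctional_apply {D : Type*} [AddCommGroup D] [Module ℂ D] (f : Fin m → D →ₗ[ℂ] ℂ)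
    (v : Fin m → D) : prodFunctional f v = ∏ k, f k (v k) := by
  simp [prodFunctional]

/-- Change the basis in the two index sets one at a time. This lets the representative be defined
with arbitrary bases pointwise and computed in a holomorphic frame. -/
theorem tensorDual_basis_indep (b : Module.Basis ι ℂ V) (c : Module.Basis κ ℂ V)
    (μ : MultilinearMap ℂ (fun _ : Fin m => V) N) (g : SesqForm (Module.Dual ℂ V)) :
    tensorDual b μ g = tensorDual c μ g := by
  refine LinearMap.ext fun η => LinearMap.ext fun ζ => ?_
  rw [tensorDual_apply, tensorDual_apply]
  congr 1
  have h1 : ∀ J : Fin m → ι, ∑ I : Fin m → ι,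
      (∏ k, g (b.coord (I k)) (b.coord (J k))) * η (μ fun k => b (I k)) *
        conj (ζ (μ fun k => b (J k))) = ∑ I : Fin m → κ,
      (∏ k, g (c.coord (I k)) (b.coord (J k))) * η (μ fun k => c (I k)) *
        conj (ζ (μ fun k => b (J k))) := by
    intro J
    have := sum_basis_tensor b c (η.compMultilinearMap μ)
      (prodFunctional fun k => g.flip (b.coord (J k)))
    simp only [prodFunctional_apply, LinearMap.flip_apply, smul_eq_mul,
      LinearMap.compMultilinearMap_apply] at this
    rw [← Finset.sum_mul, ← Finset.sum_mul, this]
  have h2 : ∀ I : Fin m → κ, ∑ J : Fin m → ι,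
      (∏ k, g (c.coord (I k)) (b.coord (J k))) * η (μ fun k => c (I k)) *
        conj (ζ (μ fun k => b (J k))) = ∑ J : Fin m → κ,
      (∏ k, g (c.coord (I k)) (c.coord (J k))) * η (μ fun k => c (I k)) *
        conj (ζ (μ fun k => c (J k))) := by
    intro I
    have := congrArg conj (sum_basis_tensor b c (ζ.compMultilinearMap μ)
      (prodFunctional fun k => conjFunctional' (g (c.coord (I k)))))
    simp only [prodFunctional_apply, conjFunctional', smul_eq_mul, map_sum, map_mul, map_prod,
      LinearMap.compMultilinearMap_apply, LinearMap.coe_mk, AddHom.coe_mk, Complex.conj_conj] at this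
    simp only [mul_right_comm _ (η _), ← Finset.sum_mul]
    rw [this]
  simp only [h1]
  rw [Finset.sum_comm]
  simp only [h2]
  rw [Finset.sum_comm]

/-- The matrix of a form on the dual space in the dual basis. -/
def dualMatrix (b : Module.Basis ι ℂ V) (g : SesqForm (Module.Dual ℂ V)) : Matrix ι ι ℂ :=
  Matrix.of fun i j => g (b.coord j) (b.coord i)

theorem quad_dualMatrix (b : Module.Basis ι ℂ V) (g : SesqForm (Module.Dual ℂ V)) (v : ι → ℂ) :
    quad (dualMatrix b g) v = (g (∑ i, v i • b.coord i) (∑ i, v i • b.coord i)).re := by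
  simp only [quad, dualMatrix, Matrix.of_apply, map_sum, LinearMap.sum_apply,
    LinearMap.map_smulₛₗ, LinearMap.smul_apply, smul_eq_mul, RingHom.id_apply]
  congr 1
  refine Finset.sum_congr rfl fun i _ => ?_
  simp only [Finset.mul_sum]
  exact Finset.sum_congr rfl fun j _ => by ring

open scoped ComplexOrder MatrixOrder in
theorem posSemidef_dualMatrix (b : Module.Basis ι ℂ V) {g : SesqForm (Module.Dual ℂ V)}
    (hg : IsPosSemidefForm g) : (dualMatrix b g).PosSemidef := by
  refine posSemidef_of_quad_nonneg ?_ fun v => ?_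
  · ext i j
    simp only [Matrix.conjTranspose_apply, dualMatrix, Matrix.of_apply]
    exact hg.conj_symm _ _
  · rw [quad_dualMatrix]
    exact hg.nonneg _

theorem re_tensorDual_self (b : Module.Basis ι ℂ V)
    (μ : MultilinearMap ℂ (fun _ : Fin m => V) N) (g : SesqForm (Module.Dual ℂ V))
    (η : Module.Dual ℂ N) : (tensorDual b μ g η η).re =
      (m.factorial : ℝ)⁻¹ * quad (tensorPowMatrix m (dualMatrix b g))
        fun I => η (μ fun k => b (I k)) := by
  rw [tensorDual_apply]
  have : (m.factorial : ℂ)⁻¹ = (((m.factorial : ℝ)⁻¹ : ℝ) : ℂ) := by push_cast; rfl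
  rw [this, Complex.re_ofReal_mul, quad]
  congr 2
  refine Finset.sum_congr rfl fun J _ => Finset.sum_congr rfl fun I _ => ?_
  simp only [tensorPowMatrix, dualMatrix, Matrix.of_apply]
  ring

theorem isPosSemidefForm_tensorDual (b : Module.Basis ι ℂ V)
    (μ : MultilinearMap ℂ (fun _ : Fin m => V) N) {g : SesqForm (Module.Dual ℂ V)}
    (hg : IsPosSemidefForm g) : IsPosSemidefForm (tensorDual b μ g) where
  conj_symm η ζ := by
    rw [tensorDual_apply, tensorDual_apply, map_mul, map_sum, Finset.sum_comm]
    simp only [map_sum, map_mul, map_prod, hg.conj_symm, Complex.conj_conj, map_inv₀, map_natCast]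
    rw [Finset.sum_comm]
    congr 1
    rw [Finset.sum_comm]
    exact Finset.sum_congr rfl fun _ _ => Finset.sum_congr rfl fun _ _ => by ring
  nonneg η := by
    rw [re_tensorDual_self]
    have := (posSemidef_tensorPowMatrix (posSemidef_dualMatrix b hg) m).quad_nonneg
      fun I => η (μ fun k => b (I k))
    positivity

/-- `S` is the form induced by `h` on the power `N` of `V` with symmetry character `χ`. -/
structure IsInducedForm (μ : MultilinearMap ℂ (fun _ : Fin m => V) N)
    (χ : Equiv.Perm (Fin m) →* ℤˣ) (h : SesqForm V) (S : SesqForm N) : Prop where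
  span : Submodule.span ℂ (Set.range μ) = ⊤
  perm : ∀ (σ : Equiv.Perm (Fin m)) (v : Fin m → V),
    μ (fun i => v (σ i)) = (((χ σ : ℤˣ) : ℤ) : ℂ) • μ v
  apply : ∀ u v : Fin m → V,
    S (μ u) (μ v) = ∑ σ : Equiv.Perm (Fin m), (((χ σ : ℤˣ) : ℤ) : ℂ) * ∏ i, h (u (σ i)) (v i)

variable {μ : MultilinearMap ℂ (fun _ : Fin m => V) N} {χ : Equiv.Perm (Fin m) →* ℤˣ}
  {h : SesqForm V} {S : SesqForm N}

theorem finiteDimensional_of_span [FiniteDimensional ℂ V]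
    (hμ : Submodule.span ℂ (Set.range μ) = ⊤) : FiniteDimensional ℂ N := by
  classical
  let b := Module.finBasis ℂ V
  refine Module.finite_def.2 ((Submodule.fg_def).2
    ⟨Set.range fun I : Fin m → Fin (Module.finrank ℂ V) => μ fun k => b (I k),
      Set.finite_range _, ?_⟩)
  rw [eq_top_iff, ← hμ, Submodule.span_le]
  rintro _ ⟨v, rfl⟩
  have : v = fun k => ∑ i, b.repr (v k) i • b i := by
    funext k; rw [b.sum_repr]
  rw [this, MultilinearMap.map_sum]
  simp only [MultilinearMap.map_smul_univ]
  exact Submodule.sum_mem _ fun I _ =>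
    Submodule.smul_mem _ _ (Submodule.subset_span ⟨I, rfl⟩)

/-- The reproducing property that characterizes the dual form. It follows from the one on `V`,
factor by factor. It is available before `S` is known to be definite, and implies it. -/
theorem IsInducedForm.tensorDual_apply_flip [FiniteDimensional ℂ V] (hS : IsInducedForm μ χ h S)
    (hh : IsPosDefForm h) (b : Module.Basis ι ℂ V) (η : Module.Dual ℂ N) (y : N) :
    tensorDual b μ (dualForm h) η (S.flip y) = η y := by
  classical
  have hy : y ∈ Submodule.span ℂ (Set.range μ) := by rw [hS.span]; trivial
  induction hy using Submodule.span_induction with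
  | zero => simp
  | add x y _ _ hx hy => rw [map_add, map_add, map_add, hx, hy]
  | smul c x _ hx =>
    rw [LinearMap.map_smulₛₗ, LinearMap.map_smulₛₗ, hx, Complex.conj_conj, map_smul]
  | mem y hy =>
    obtain ⟨v, rfl⟩ := hy
    rw [tensorDual_apply]
    have e1 : ∀ J : Fin m → ι, conj (S.flip (μ v) (μ fun k => b (J k))) =
        ∑ σ : Equiv.Perm (Fin m), (((χ σ : ℤˣ) : ℤ) : ℂ) *
          ∏ k, h (v (σ⁻¹ k)) (b (J k)) := by
      intro J
      rw [LinearMap.flip_apply, hS.apply, map_sum]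
      refine Finset.sum_congr rfl fun σ _ => ?_
      rw [map_mul, map_intCast, map_prod]
      congr 1
      refine Fintype.prod_equiv σ _ _ fun i => ?_
      rw [hh.conj_symm]
      simp
    -- The reproducing property of `dualForm h`, written in the dual basis.
    have e2 : ∀ (w : V) (ξ : Module.Dual ℂ V),
        ∑ j, dualForm h ξ (b.coord j) * h w (b j) = ξ w := by
      intro w ξ
      have h1 : h.flip w = ∑ j, conj (h w (b j)) • b.coord j := by
        rw [← b.sum_dual_apply_smul_coord (h.flip w)]
        refine Finset.sum_congr rfl fun j _ => ?_
        rw [LinearMap.flip_apply, hh.conj_symm]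
      rw [← dualForm_apply_flip h hh.bijective_flip ξ w, h1, map_sum]
      refine Finset.sum_congr rfl fun j _ => ?_
      rw [LinearMap.map_smulₛₗ, Complex.conj_conj, smul_eq_mul, mul_comm]
    have e3 : ∀ w : Fin m → V, ∑ I : Fin m → ι, (∏ k, b.coord (I k) (w k)) *
        η (μ fun k => b (I k)) = η (μ w) := by
      intro w
      have : w = fun k => ∑ i, b.coord i (w k) • b i := by
        funext k; simp [b.sum_repr]
      conv_rhs => rw [this, MultilinearMap.map_sum]
      simp only [MultilinearMap.map_smul_univ, map_sum, map_smul, smul_eq_mul]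
    have e4 : ∀ (w : Fin m → V) (I : Fin m → ι), ∑ J : Fin m → ι,
        (∏ k, dualForm h (b.coord (I k)) (b.coord (J k))) * ∏ k, h (w k) (b (J k)) =
        ∏ k, b.coord (I k) (w k) := by
      intro w I
      simp only [← e2 (w _) (b.coord (I _)), Finset.prod_univ_sum, Fintype.piFinset_univ,
        Finset.prod_mul_distrib]
    have e5 : ∀ σ : Equiv.Perm (Fin m), η (μ fun k => v (σ⁻¹ k)) =
        (((χ σ : ℤˣ) : ℤ) : ℂ) * η (μ v) := by
      intro σ
      rw [hS.perm σ⁻¹ v, map_smul, smul_eq_mul, map_inv, Int.units_inv_eq_self]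
    calc (m.factorial : ℂ)⁻¹ * ∑ J : Fin m → ι, ∑ I : Fin m → ι,
          (∏ k, dualForm h (b.coord (I k)) (b.coord (J k))) * η (μ fun k => b (I k)) *
            conj (S.flip (μ v) (μ fun k => b (J k)))
        = (m.factorial : ℂ)⁻¹ * ∑ σ : Equiv.Perm (Fin m), (((χ σ : ℤˣ) : ℤ) : ℂ) *
            ∑ I : Fin m → ι, (∑ J : Fin m → ι,
              (∏ k, dualForm h (b.coord (I k)) (b.coord (J k))) *
                ∏ k, h (v (σ⁻¹ k)) (b (J k))) * η (μ fun k => b (I k)) := by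
          simp only [e1, Finset.mul_sum, Finset.sum_mul]
          congr 1
          rw [Finset.sum_comm_cycle]
          refine Finset.sum_congr rfl fun σ _ => ?_
          rw [Finset.sum_comm]
          exact Finset.sum_congr rfl fun _ _ => Finset.sum_congr rfl fun _ _ => by ring
      -- The character occurs twice, once in `S` and once from permuting the arguments of `μ`. It
      -- squares to `1`, so the `m!` summands agree and the normalization cancels them.
      _ = (m.factorial : ℂ)⁻¹ * ∑ σ : Equiv.Perm (Fin m), η (μ v) := by
          congr 1
          refine Finset.sum_congr rfl fun σ _ => ?_
          simp only [e4 (fun k => v (σ⁻¹ k))]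
          rw [e3 fun k => v (σ⁻¹ k), e5, ← mul_assoc, ← Int.cast_mul, Int.units_coe_mul_self,
            Int.cast_one, one_mul]
      _ = η (μ v) := by
          rw [Finset.sum_const, Finset.card_univ, Fintype.card_perm, Fintype.card_fin,
            nsmul_eq_mul, ← mul_assoc, inv_mul_cancel₀ (by exact_mod_cast m.factorial_ne_zero),
            one_mul]

/-- Reproduction writes `S` as the pullback of a semi-positive form on the dual. A null vector `y`
of `S` has `S.flip y = 0`, hence is killed by every functional. -/
theorem IsInducedForm.isPosDefForm [FiniteDimensional ℂ V] (hS : IsInducedForm μ χ h S)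
    (hh : IsPosDefForm h) : IsPosDefForm S := by
  set b := Module.finBasis ℂ V
  have hfl := hS.tensorDual_apply_flip hh b
  have hH := isPosSemidefForm_tensorDual b μ hh.isPosSemidefForm_dualForm
  have hSH : ∀ x y, S x y = tensorDual b μ (dualForm h) (S.flip y) (S.flip x) := fun x y => by
    rw [hfl]; rfl
  have hpsd : IsPosSemidefForm S := ⟨fun x y => by rw [hSH, hSH, hH.conj_symm],
    fun x => by rw [hSH]; exact hH.nonneg _⟩
  refine ⟨hpsd.conj_symm, fun y hy => lt_of_le_of_ne (hpsd.nonneg y) fun h0 => hy ?_⟩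
  refine (Module.forall_dual_apply_eq_zero_iff ℂ y).1 fun η => ?_
  have : S.flip y = 0 := LinearMap.ext fun x => hpsd.apply_eq_zero h0.symm x
  rw [← hfl η y, this, map_zero]

/-- Both sides have the same reproducing property, and every functional on `N` has the form `S.flip
y`. -/
theorem IsInducedForm.dualForm_eq [FiniteDimensional ℂ V] (hS : IsInducedForm μ χ h S)
    (hh : IsPosDefForm h) (b : Module.Basis ι ℂ V) :
    dualForm S = tensorDual b μ (dualForm h) := by
  have := finiteDimensional_of_span hS.span
  have hb := (hS.isPosDefForm hh).bijective_flip
  refine LinearMap.ext fun η => LinearMap.ext fun ζ => ?_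
  obtain ⟨y, rfl⟩ := hb.2 ζ
  rw [dualForm_apply_flip S hb, hS.tensorDual_apply_flip hh]

theorem isInducedForm_symForm (m : ℕ) (h : SesqForm V) :
    IsInducedForm (SymmetricPower.tprod ℂ) (1 : Equiv.Perm (Fin m) →* ℤˣ) h (symForm m h) where
  span := SymmetricPower.span_tprod_eq_top ℂ (Fin m) V
  perm σ v := by simp
  apply u v := by simp [symForm_tprod]

theorem isInducedForm_extForm (q : ℕ) (h : SesqForm V) :
    IsInducedForm (exteriorPower.ιMulti ℂ q).toMultilinearMap
      (Equiv.Perm.sign : Equiv.Perm (Fin q) →* ℤˣ) h (extForm q h) where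
  span := exteriorPower.ιMulti_span ℂ q V
  perm σ v := by
    have := (exteriorPower.ιMulti ℂ q (M := V)).map_perm v σ
    simp only [AlternatingMap.coe_multilinearMap]
    rw [Int.cast_smul_eq_zsmul]
    exact this
  apply u v := by
    simp [extForm_ιMulti, Matrix.det_apply']

end TensorDual

end Forms

end

noncomputable section

/-! ### Holomorphic frames -/

section Frames

open Set

variable {n : ℕ} {X : Type*} [TopologicalSpace X] [ChartedSpace (Fin n → ℂ) X]

theorem IsHolo.mono {U V : Set X} {f : X → ℂ} (hf : IsHolo n U f) (h : V ⊆ U) : IsHolo n V f :=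
  ContMDiffOn.mono hf h

theorem IsHolo.congr {U : Set X} {f f' : X → ℂ} (hf : IsHolo n U f) (h : ∀ x ∈ U, f' x = f x) :
    IsHolo n U f' :=
  ContMDiffOn.congr hf h

theorem IsHolo.of_local {U : Set X} {f : X → ℂ}
    (h : ∀ x ∈ U, ∃ V, IsOpen V ∧ x ∈ V ∧ IsHolo n (V ∩ U) f) : IsHolo n U f := by
  intro x hx
  obtain ⟨V, hV, hxV, hf⟩ := h x hx
  exact (hf x ⟨hxV, hx⟩).mono_of_mem_nhdsWithin
    (Filter.inter_mem (mem_nhdsWithin_of_mem_nhds (hV.mem_nhds hxV)) self_mem_nhdsWithin)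

theorem isHolo_const (U : Set X) (a : ℂ) : IsHolo n U fun _ => a := contMDiffOn_const

theorem IsHolo.mul {U : Set X} {f f' : X → ℂ} (hf : IsHolo n U f) (hf' : IsHolo n U f') :
    IsHolo n U fun x => f x * f' x :=
  ContMDiffOn.mul hf hf'

theorem IsHolo.sum {α : Type*} {t : Finset α} {U : Set X} {f : α → X → ℂ}
    (hf : ∀ i ∈ t, IsHolo n U (f i)) : IsHolo n U fun x => ∑ i ∈ t, f i x :=
  contMDiffOn_finsetSum hf

theorem IsHolo.prod {α : Type*} {t : Finset α} {U : Set X} {f : α → X → ℂ}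
    (hf : ∀ i ∈ t, IsHolo n U (f i)) : IsHolo n U fun x => ∏ i ∈ t, f i x :=
  contMDiffOn_finsetProd hf

theorem IsHolo.inv {U : Set X} {f : X → ℂ} (hf : IsHolo n U f) (h0 : ∀ x ∈ U, f x ≠ 0) :
    IsHolo n U fun x => (f x)⁻¹ :=
  ContMDiffOn.inv₀ hf h0

theorem isOpen_chartImage (c : OpenPartialHomeomorph X (Fin n → ℂ)) {U : Set X} (hU : IsOpen U) :
    IsOpen (chartImage c U) := c.symm.isOpen_inter_preimage hU

theorem isOpen_chartPreimage (c : OpenPartialHomeomorph X (Fin n → ℂ)) {Ω : Set (Fin n → ℂ)}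
    (hΩ : IsOpen Ω) : IsOpen (c.source ∩ c ⁻¹' Ω) := c.isOpen_inter_preimage hΩ

theorem chartImage_chartPreimage (c : OpenPartialHomeomorph X (Fin n → ℂ)) {Ω : Set (Fin n → ℂ)}
    (hΩ : Ω ⊆ c.target) : chartImage c (c.source ∩ c ⁻¹' Ω) = Ω := by
  ext z
  constructor
  · rintro ⟨hz, _, hz'⟩
    simpa [c.right_inv hz] using hz'
  · intro hz
    exact ⟨hΩ hz, c.map_target (hΩ hz), by simpa [c.right_inv (hΩ hz)] using hz⟩

theorem chartImage_mono (c : OpenPartialHomeomorph X (Fin n → ℂ)) {U V : Set X} (h : U ⊆ V) :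
    chartImage c U ⊆ chartImage c V := fun _ hz => ⟨hz.1, h hz.2⟩

section IsManifold

variable [IsManifold 𝓘(ℂ, Fin n → ℂ) ω X]

theorem IsHolo.contDiffOn {U : Set X} {f : X → ℂ} (hf : IsHolo n U f)
    {c : OpenPartialHomeomorph X (Fin n → ℂ)} (hc : c ∈ atlas (Fin n → ℂ) X) :
    ContDiffOn ℂ ω (fun z => f (c.symm z)) (chartImage c U) := by
  have h1 : ContMDiffOn 𝓘(ℂ, Fin n → ℂ) 𝓘(ℂ, Fin n → ℂ) ω c.symm c.target :=
    contMDiffOn_symm_of_mem_maximalAtlas (IsManifold.subset_maximalAtlas hc)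
  exact contMDiffOn_iff_contDiffOn.1
    (ContMDiffOn.comp hf (h1.mono inter_subset_left) fun z hz => hz.2)

theorem ContDiffOn.isHolo {Ω : Set (Fin n → ℂ)} {f : (Fin n → ℂ) → ℂ} (hf : ContDiffOn ℂ ω f Ω)
    {c : OpenPartialHomeomorph X (Fin n → ℂ)} (hc : c ∈ atlas (Fin n → ℂ) X) :
    IsHolo n (c.source ∩ c ⁻¹' Ω) fun x => f (c x) := by
  have h1 : ContMDiffOn 𝓘(ℂ, Fin n → ℂ) 𝓘(ℂ, Fin n → ℂ) ω c c.source :=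
    contMDiffOn_of_mem_maximalAtlas (IsManifold.subset_maximalAtlas hc)
  exact ContMDiffOn.comp (contMDiffOn_iff_contDiffOn.2 hf) (h1.mono inter_subset_left)
    fun z hz => hz.2

end IsManifold

variable {W : X → Type*} [∀ x, AddCommGroup (W x)] [∀ x, Module ℂ (W x)] {ι : Type*} [Fintype ι]

/-- The bases `b x` form a holomorphic frame over `O`. -/
structure IsHoloFrame (n : ℕ) {X : Type*} [TopologicalSpace X] [ChartedSpace (Fin n → ℂ) X]
    {W : X → Type*} [∀ x, AddCommGroup (W x)] [∀ x, Module ℂ (W x)] {ι : Type*}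
    (𝒪 : SectionPred W) (O : Set X) (b : ∀ x, Module.Basis ι ℂ (W x)) : Prop where
  mem : ∀ i, ∀ U ⊆ O, IsOpen U → 𝒪 U fun x => b x i
  coord : ∀ U ⊆ O, IsOpen U → ∀ s, 𝒪 U s → ∀ i, IsHolo n U fun x => (b x).coord i (s x)

/-- The section predicate `𝒪` behaves like the sections of a holomorphic vector bundle. -/
structure IsLocallyFree (n : ℕ) {X : Type*} [TopologicalSpace X] [ChartedSpace (Fin n → ℂ) X]
    {W : X → Type*} [∀ x, AddCommGroup (W x)] [∀ x, Module ℂ (W x)] (ι : Type*)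
    (𝒪 : SectionPred W) : Prop where
  mono : ∀ U V : Set X, V ⊆ U → ∀ s, 𝒪 U s → 𝒪 V s
  exists_frame : ∀ x₀ : X, ∃ (O : Set X) (b : ∀ x, Module.Basis ι ℂ (W x)),
    IsOpen O ∧ x₀ ∈ O ∧ IsHoloFrame n 𝒪 O b

/-- `𝒬` consists of the sections of `N` which are locally finite sums `∑ⱼ fⱼ μ(sⱼ₁, …, sⱼₘ)`. -/
def IsPowerSections (n : ℕ) {X : Type*} [TopologicalSpace X] [ChartedSpace (Fin n → ℂ) X]
    {W N : X → Type*} [∀ x, AddCommGroup (W x)] [∀ x, Module ℂ (W x)]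
    [∀ x, AddCommGroup (N x)] [∀ x, Module ℂ (N x)] {m : ℕ}
    (μ : ∀ x, MultilinearMap ℂ (fun _ : Fin m => W x) (N x)) (𝒪 : SectionPred W)
    (𝒬 : SectionPred N) : Prop :=
  ∀ U η, 𝒬 U η ↔ ∀ x ∈ U, ∃ U' ⊆ U, IsOpen U' ∧ x ∈ U' ∧
    ∃ (k : ℕ) (f : Fin k → X → ℂ) (s : Fin k → Fin m → ∀ y, W y),
      (∀ j, IsHolo n U' (f j)) ∧ (∀ j i, 𝒪 U' (s j i)) ∧
      ∀ y ∈ U', η y = ∑ j, f j y • μ y fun i => s j i y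

variable {𝒪 : SectionPred W}

theorem dualSections_of_coord {O U : Set X} {b : ∀ x, Module.Basis ι ℂ (W x)}
    (hb : IsHoloFrame n 𝒪 O b) (hUO : U ⊆ O) {v : ι → X → ℂ}
    (hv : ∀ i, IsHolo n U (v i)) :
    dualSections n 𝒪 U fun x => ∑ i, v i x • (b x).coord i := by
  intro U' hU' hU'o s hs
  have h1 : IsHolo n U' fun x => ∑ i, v i x * (b x).coord i (s x) :=
    IsHolo.sum fun i _ => ((hv i).mono hU').mul
      (hb.coord U' (hU'.trans hUO) hU'o s hs i)
  refine h1.congr fun x _ => ?_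
  simp

variable {N : X → Type*} [∀ x, AddCommGroup (N x)] [∀ x, Module ℂ (N x)] {m : ℕ}
  {μ : ∀ x, MultilinearMap ℂ (fun _ : Fin m => W x) (N x)} {𝒬 : SectionPred N}

theorem IsPowerSections.of_sections (h𝒬 : IsPowerSections n μ 𝒪 𝒬) {U : Set X} (hU : IsOpen U)
    {s : Fin m → ∀ x, W x} (hs : ∀ i, 𝒪 U (s i)) : 𝒬 U fun x => μ x fun i => s i x :=
  (h𝒬 U _).2 fun x hx => ⟨U, subset_rfl, hU, hx, 1, fun _ _ => 1, fun _ => s,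
    fun _ => isHolo_const U 1, fun _ => hs, fun y _ => by simp⟩

theorem HoldsAE.mono {p q : X → Prop} (hp : HoldsAE n p) (h : ∀ x, p x → q x) : HoldsAE n q :=
  fun c hc => (hp c hc).mono fun _ hz => h _ hz

theorem HoldsAE.and {p q : X → Prop} (hp : HoldsAE n p) (hq : HoldsAE n q) :
    HoldsAE n fun x => p x ∧ q x :=
  fun c hc => (hp c hc).and (hq c hc)

/-- By the Lindelöf property countably many of the neighbourhoods suffice. -/
theorem aemeasurable_of_local {f : (Fin n → ℂ) → ℂ} {Ω : Set (Fin n → ℂ)}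
    (h : ∀ z ∈ Ω, ∃ V, IsOpen V ∧ z ∈ V ∧ AEMeasurable f (volume.restrict V)) :
    AEMeasurable f (volume.restrict Ω) := by
  choose! V hV hzV hf using h
  obtain ⟨t, ht, htc, hcover⟩ := TopologicalSpace.countable_cover_nhdsWithin
    (f := V) fun z hz => mem_nhdsWithin_of_mem_nhds ((hV z hz).mem_nhds (hzV z hz))
  have : Countable t := htc
  rw [biUnion_eq_iUnion] at hcover
  exact (aemeasurable_iUnion_iff.2 fun z : t => hf z (ht z.2)).mono_measure
    (Measure.restrict_mono hcover le_rfl)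

theorem IsLocallyFree.finiteDimensional (hL : IsLocallyFree n ι 𝒪) (x : X) :
    FiniteDimensional ℂ (W x) := by
  obtain ⟨O, b, -⟩ := hL.exists_frame x
  exact Module.Finite.of_basis (b x)

/-! ### Metrics induced on powers of a locally free sheaf -/

section Power

variable [IsManifold 𝓘(ℂ, Fin n → ℂ) ω X] {χ : Equiv.Perm (Fin m) →* ℤˣ}
  {h : ∀ x, SesqForm (W x)} {S : ∀ x, SesqForm (N x)}

theorem isSingularHermitianMetric_power (hL : IsLocallyFree n ι 𝒪)
    (h𝒬 : IsPowerSections n μ 𝒪 𝒬) (hS : ∀ x, IsInducedForm (μ x) χ (h x) (S x))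
    (hh : IsSingularHermitianMetric n 𝒪 h) : IsSingularHermitianMetric n 𝒬 S where
  measurable := by
    intro c hc U hU s t hs ht
    refine aemeasurable_of_local fun z hz => ?_
    obtain ⟨U₁, -, hU₁, hz₁, k, f, σ, hf, hσ, hs'⟩ := (h𝒬 U s).1 hs _ hz.2
    obtain ⟨U₂, -, hU₂, hz₂, l, f', τ, hf', hτ, ht'⟩ := (h𝒬 U t).1 ht _ hz.2
    have hV : IsOpen (U₁ ∩ U₂) := hU₁.inter hU₂
    refine ⟨chartImage c (U₁ ∩ U₂), isOpen_chartImage c hV, ⟨hz.1, hz₁, hz₂⟩, ?_⟩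
    have hΩ := (isOpen_chartImage c hV).measurableSet
    have hfm : ∀ j, AEMeasurable (fun z => f j (c.symm z))
        (volume.restrict (chartImage c (U₁ ∩ U₂))) := fun j =>
      ((((hf j).mono inter_subset_left).contDiffOn hc).continuousOn).aemeasurable hΩ
    have hfm' : ∀ j, AEMeasurable (fun z => f' j (c.symm z))
        (volume.restrict (chartImage c (U₁ ∩ U₂))) := fun j =>
      ((((hf' j).mono inter_subset_right).contDiffOn hc).continuousOn).aemeasurable hΩ
    have hm : ∀ i j p q, AEMeasurable
        (fun z => h (c.symm z) (σ i p (c.symm z)) (τ j q (c.symm z)))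
        (volume.restrict (chartImage c (U₁ ∩ U₂))) := fun i j p q =>
      hh.measurable c hc _ hV _ _ (hL.mono _ _ inter_subset_left _ (hσ i p))
        (hL.mono _ _ inter_subset_right _ (hτ j q))
    have key : AEMeasurable (fun z => ∑ i, ∑ j, f i (c.symm z) * conj (f' j (c.symm z)) *
        ∑ e : Equiv.Perm (Fin m), (((χ e : ℤˣ) : ℤ) : ℂ) *
          ∏ p, h (c.symm z) (σ i (e p) (c.symm z)) (τ j p (c.symm z)))
        (volume.restrict (chartImage c (U₁ ∩ U₂))) := by
      refine Finset.aemeasurable_fun_sum _ fun i _ => Finset.aemeasurable_fun_sum _ fun j _ => ?_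
      refine ((hfm i).mul (Complex.continuous_conj.measurable.comp_aemeasurable (hfm' j))).mul ?_
      refine Finset.aemeasurable_fun_sum _ fun e _ => AEMeasurable.const_mul ?_ _
      exact Finset.aemeasurable_fun_prod _ fun p _ => hm i j (e p) p
    refine key.congr ?_
    filter_upwards [ae_restrict_mem hΩ] with z hz
    rw [hs' _ hz.2.1, ht' _ hz.2.2]
    simp only [map_sum, LinearMap.sum_apply, LinearMap.map_smulₛₗ, LinearMap.smul_apply,
      smul_eq_mul, RingHom.id_apply, (hS _).apply]
    rw [Finset.sum_comm]
    refine Finset.sum_congr rfl fun _ _ => ?_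
    rw [Finset.mul_sum]
    exact Finset.sum_congr rfl fun _ _ => by ring
  posDef := hh.posDef.mono fun x hx => by
    have := hL.finiteDimensional x
    exact (hS x).isPosDefForm hx

/-- The dual of the induced metric has an everywhere defined representative all of whose local
squared norms are log-plurisubharmonic. -/
theorem exists_isLogPsh_dual (hL : IsLocallyFree n ι 𝒪) (h𝒬 : IsPowerSections n μ 𝒪 𝒬)
    (hS : ∀ x, IsInducedForm (μ x) χ (h x) (S x)) (hh : IsSingularHermitianMetric n 𝒪 h)
    (hpos : IsSemiPositivelyCurved n 𝒪 h) :
    ∃ H : ∀ x, SesqForm (Module.Dual ℂ (N x)), (∀ x, IsPosSemidefForm (H x)) ∧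
      HoldsAE n (fun x => H x = dualForm (S x)) ∧
      ∀ U : Set X, IsOpen U → ∀ η, dualSections n 𝒬 U η → ∀ c ∈ atlas (Fin n → ℂ) X,
        IsLogPsh (fun z => (H (c.symm z) (η (c.symm z)) (η (c.symm z))).re)
          (chartImage c U) := by
  classical
  obtain ⟨g, hg, hgh, hpsh⟩ := hpos
  choose O₀ b₀ hO₀ hx₀ hb₀ using hL.exists_frame
  -- The bases `b₀ x x` need not vary nicely with `x`, since the form is basis independent. It
  -- agrees with the dual metric wherever `g` is the dual form and `h` is definite, hence almost
  -- everywhere.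
  refine ⟨fun x => tensorDual (b₀ x x) (μ x) (g x),
    fun x => isPosSemidefForm_tensorDual _ _ (hg x), ?_, ?_⟩
  · refine (hgh.and hh.posDef).mono fun x hx => ?_
    have := hL.finiteDimensional x
    have h1 : g x = dualForm (h x) := hx.1
    show tensorDual (b₀ x x) (μ x) (g x) = _
    rw [h1, (hS x).dualForm_eq hx.2 (b₀ x x)]
  intro U hU η hη c hc
  refine IsLogPsh.of_local fun z hz => ?_
  obtain ⟨O, b, hO, hxO, hb⟩ := hL.exists_frame (c.symm z)
  have hOU : IsOpen (O ∩ U) := hO.inter hU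
  refine ⟨chartImage c (O ∩ U), isOpen_chartImage c hOU, ⟨hz.1, hxO, hz.2⟩, ?_⟩
  set G : (Fin n → ℂ) → Matrix ι ι ℂ := fun z => dualMatrix (b (c.symm z)) (g (c.symm z)) with hG
  have hGN : LogGriffithsNeg G (chartImage c O) := by
    -- A holomorphic vector function in the chart gives, with the dual frame, a holomorphic section
    -- of the dual bundle, and curvature of `g` is tested on it.
    refine ⟨isOpen_chartImage c hO, fun z _ => posSemidef_dualMatrix _ (hg _), ?_⟩
    intro Ω hΩ hΩo v hv
    have hΩt : Ω ⊆ c.target := fun z hz => (hΩ hz).1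
    set U₂ := c.source ∩ c ⁻¹' Ω with hU₂
    have hU₂o : IsOpen U₂ := isOpen_chartPreimage c hΩo
    have hU₂O : U₂ ⊆ O := by
      rintro x ⟨hx, hx'⟩
      have := (hΩ hx').2
      rwa [mem_preimage, c.left_inv hx] at this
    have hvi : ∀ i, IsHolo n U₂ fun x => v (c x) i := fun i =>
      ContDiffOn.isHolo (contDiffOn_pi.1 hv i) hc
    have h1 := hpsh U₂ hU₂o _ (dualSections_of_coord hb hU₂O hvi) c hc
    rw [hU₂, chartImage_chartPreimage c hΩt] at h1
    refine h1.congr hΩo fun z hz => ?_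
    simp only [Function.comp_apply, logNormSq, hG, quad_dualMatrix, c.right_inv (hΩt hz)]
  -- This scalar absorbs the factor `1/m!` into the tensor section.
  set a : ℂ := (((√(m.factorial : ℝ))⁻¹ : ℝ) : ℂ) with ha
  have han : ‖a‖ ^ 2 = (m.factorial : ℝ)⁻¹ := by
    rw [ha, Complex.norm_real, norm_inv, inv_pow, Real.norm_of_nonneg (Real.sqrt_nonneg _),
      Real.sq_sqrt (Nat.cast_nonneg _)]
  have hT : DifferentiableOn ℂ (fun z => fun I : Fin m → ι =>
      a * η (c.symm z) (μ (c.symm z) fun k => b (c.symm z) (I k))) (chartImage c (O ∩ U)) := by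
    -- The components of `η` in the tensor power are its pairings with the sections `μ(b_I)`,
    -- holomorphic by the definition of the dual sections.
    refine differentiableOn_pi.2 fun I => DifferentiableOn.const_mul ?_ a
    have h1 : 𝒬 (O ∩ U) fun x => μ x fun k => b x (I k) :=
      h𝒬.of_sections hOU fun k => hb.mem (I k) _ inter_subset_left hOU
    have h2 := hη (O ∩ U) inter_subset_right hOU _ h1
    exact (h2.contDiffOn hc).differentiableOn (by simp)
  have hlog := hGN.isLogPsh_tensorPow m (isOpen_chartImage c hOU)
    (chartImage_mono c inter_subset_left) hT
  have e : (fun z => quad (tensorPowMatrix m (G z)) fun I : Fin m → ι =>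
      a * η (c.symm z) (μ (c.symm z) fun k => b (c.symm z) (I k))) = fun z =>
      (tensorDual (b₀ (c.symm z) (c.symm z)) (μ (c.symm z)) (g (c.symm z)) (η (c.symm z))
        (η (c.symm z))).re := by
    funext z
    rw [tensorDual_basis_indep _ (b (c.symm z)), re_tensorDual_self, quad_smul_right, han]
  rwa [e] at hlog

theorem isSemiPositivelyCurved_power (hL : IsLocallyFree n ι 𝒪) (h𝒬 : IsPowerSections n μ 𝒪 𝒬)
    (hS : ∀ x, IsInducedForm (μ x) χ (h x) (S x)) (hh : IsSingularHermitianMetric n 𝒪 h)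
    (hpos : IsSemiPositivelyCurved n 𝒪 h) : IsSemiPositivelyCurved n 𝒬 S := by
  obtain ⟨H, hH, hHS, hlog⟩ := exists_isLogPsh_dual hL h𝒬 hS hh hpos
  exact ⟨H, hH, hHS, fun U hU η hη c hc => (hlog U hU η hη c hc).isPsh (isOpen_chartImage c hU)⟩

end Power

end Frames

/-! ### Local frames of a holomorphic vector bundle -/

section VectorBundle

variable {n : ℕ} {X : Type*} [TopologicalSpace X] [ChartedSpace (Fin n → ℂ) X]
  {F : Type*} [NormedAddCommGroup F] [NormedSpace ℂ F] [FiniteDimensional ℂ F]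
  {E : X → Type*} [TopologicalSpace (TotalSpace F E)] [∀ x, TopologicalSpace (E x)]
  [∀ x, AddCommGroup (E x)] [∀ x, Module ℂ (E x)] [FiberBundle F E] [VectorBundle ℂ F E]
  [ContMDiffVectorBundle ω F E 𝓘(ℂ, Fin n → ℂ)]

variable (n F E) in
theorem isLocallyFree_holoSections :
    IsLocallyFree n (Fin (Module.finrank ℂ F)) (holoSections n F E) where
  mono U V h s hs := ContMDiffOn.mono hs h
  exists_frame x₀ := by
    classical
    set e := trivializationAt F E x₀
    set f := Module.finBasis ℂ F
    -- A frame must supply a basis in every fibre; off the trivializing set the choice is arbitrary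
    -- and plays no role.
    refine ⟨e.baseSet, fun x => if hx : x ∈ e.baseSet then e.basisAt f hx else
      (trivializationAt F E x).basisAt f (FiberBundle.mem_baseSet_trivializationAt F E x),
      e.open_baseSet, FiberBundle.mem_baseSet_trivializationAt F E x₀, ?_, ?_⟩
    · intro i U hU hUo
      have h1 := (e.contMDiffOn_localFrame_baseSet (I := 𝓘(ℂ, Fin n → ℂ)) ω f i).mono hU
      refine h1.congr fun x hx => ?_
      simp [hU hx]
    · intro U hU hUo s hs i
      have h1 := (e.contMDiffOn_section_iff hUo hU).1 hs
      have h2 : IsHolo n U fun x => f.coord i (e ⟨x, s x⟩).2 :=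
        (LinearMap.toContinuousLinearMap (f.coord i)).contMDiff.comp_contMDiffOn h1
      refine h2.congr fun x hx => ?_
      simp only [hU hx, dif_pos, Module.Basis.coord_apply, Trivialization.basisAt,
        Module.Basis.map_repr]
      simp [Trivialization.linearEquivAt_apply]

end VectorBundle

end

noncomputable section

/-! ### The determinant line bundle -/

section DetLine

open Set

/-! ### The top exterior power as a line -/

section LinearAlgebra

variable {V : Type*} [AddCommGroup V] [Module ℂ V] {r : ℕ}

/-- The coordinate on the top exterior power given by a basis. -/
def detFunctional (b : Module.Basis (Fin r) ℂ V) : Module.Dual ℂ (⋀[ℂ]^r V) :=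
  exteriorPower.alternatingMapLinearEquiv b.det

theorem detFunctional_ιMulti (b : Module.Basis (Fin r) ℂ V) (v : Fin r → V) :
    detFunctional b (exteriorPower.ιMulti ℂ r v) = b.det v :=
  exteriorPower.alternatingMapLinearEquiv_apply_ιMulti _ _

/-- The top exterior power is spanned by `b₁ ∧ … ∧ b_r`. Alternating maps are determined on
injective families of basis vectors, which here are permutations of `b`. -/
theorem detFunctional_smul_ιMulti (b : Module.Basis (Fin r) ℂ V) (y : ⋀[ℂ]^r V) :
    detFunctional b y • exteriorPower.ιMulti ℂ r b = y := by
  have h1 : ((LinearMap.toSpanSingleton ℂ (⋀[ℂ]^r V)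
      (exteriorPower.ιMulti ℂ r b)).compAlternatingMap b.det) = exteriorPower.ιMulti ℂ r := by
    refine Module.Basis.ext_alternating b fun v hv => ?_
    let σ : Equiv.Perm (Fin r) := Equiv.ofBijective v (Finite.injective_iff_bijective.1 hv)
    have e : (fun i => b (v i)) = (b : Fin r → V) ∘ σ := rfl
    rw [e, AlternatingMap.map_perm, AlternatingMap.map_perm]
    congr 1
    simp [Module.Basis.det_self]
  have hy : y ∈ Submodule.span ℂ (Set.range (exteriorPower.ιMulti ℂ r (M := V))) := by
    rw [exteriorPower.ιMulti_span]; trivial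
  induction hy using Submodule.span_induction with
  | zero => simp
  | add x y _ _ hx hy => rw [map_add, add_smul, hx, hy]
  | smul c x _ hx => rw [map_smul, smul_assoc, hx]
  | mem y hy =>
    obtain ⟨v, rfl⟩ := hy
    rw [detFunctional_ιMulti]
    have := congrArg (fun f => f v) h1
    simpa using this

theorem detFunctional_ne_zero (b : Module.Basis (Fin r) ℂ V) {y : ⋀[ℂ]^r V} (hy : y ≠ 0) :
    detFunctional b y ≠ 0 := fun h0 => hy (by rw [← detFunctional_smul_ιMulti b y, h0, zero_smul])

/-- Changing the basis multiplies `detFunctional` by a nonzero constant, which cancels in the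
quotient. The dual section of `s` is thus independent of frames, and holomorphic because local
frames compute it. -/
theorem detFunctional_div_eq (b b' : Module.Basis (Fin r) ℂ V) {y : ⋀[ℂ]^r V} (hy : y ≠ 0)
    (z : ⋀[ℂ]^r V) :
    (detFunctional b y)⁻¹ * detFunctional b z = (detFunctional b' y)⁻¹ * detFunctional b' z := by
  have h1 : ∀ z, detFunctional b z =
      detFunctional b' z * detFunctional b (exteriorPower.ιMulti ℂ r b') := by
    intro z
    conv_lhs => rw [← detFunctional_smul_ιMulti b' z, map_smul, smul_eq_mul]
  have h2 := detFunctional_ne_zero b hy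
  have h3 := detFunctional_ne_zero b' hy
  have h4 : detFunctional b (exteriorPower.ιMulti ℂ r b') ≠ 0 := fun h => h2 (by rw [h1, h, mul_zero])
  rw [h1 y, h1 z]
  field_simp

/-- On a line, the dual norm of the functional with value `1` at `y` is the inverse of that
of `y`. -/
theorem re_dualForm_self_of_line {L : Type*} [AddCommGroup L] [Module ℂ L] {S : SesqForm L}
    [FiniteDimensional ℂ L] (hS : IsPosDefForm S) {ξ : Module.Dual ℂ L} {y : L} (hy : y ≠ 0)
    (hξ : ∀ z, z = ξ z • y) :
    0 < (dualForm S ξ ξ).re ∧ -Real.log (S y y).re = Real.log (dualForm S ξ ξ).re := by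
  have hpos := hS.pos y hy
  set a := (S y y).re
  have hSy : S y y = (a : ℂ) := by
    refine Complex.ext rfl ?_
    have := congrArg Complex.im (hS.conj_symm y y)
    simp only [Complex.conj_im] at this
    simp only [Complex.ofReal_im]
    linarith
  have hξy : ξ y = 1 := by
    have h1 := hξ y
    have h2 : (1 - ξ y) • y = 0 := by rw [sub_smul, one_smul, ← h1, sub_self]
    rcases smul_eq_zero.1 h2 with h | h
    · exact (sub_eq_zero.1 h).symm
    · exact absurd h hy
  -- The functional `ξ` is represented by `a⁻¹ y`, which is why its squared norm is `a⁻¹`.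
  have hflip : S.flip (((a⁻¹ : ℝ) : ℂ) • y) = ξ := by
    refine LinearMap.ext fun z => ?_
    rw [hξ z, LinearMap.flip_apply, LinearMap.map_smulₛₗ, Complex.conj_ofReal, map_smul,
      LinearMap.smul_apply, hSy, map_smul, hξy, smul_eq_mul, smul_eq_mul, smul_eq_mul, mul_one,
      mul_left_comm, ← Complex.ofReal_mul, inv_mul_cancel₀ hpos.ne', Complex.ofReal_one, mul_one]
  have h1 : dualForm S ξ ξ = ((a⁻¹ : ℝ) : ℂ) := by
    conv_lhs => rw [← hflip]
    rw [dualForm_apply_flip S hS.bijective_flip, hflip, map_smul, hξy, smul_eq_mul, mul_one]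
  rw [h1, Complex.ofReal_re, Real.log_inv]
  exact ⟨inv_pos.2 hpos, rfl⟩

end LinearAlgebra

variable {n : ℕ} {X : Type*} [TopologicalSpace X] [ChartedSpace (Fin n → ℂ) X]
  {W : X → Type*} [∀ x, AddCommGroup (W x)] [∀ x, Module ℂ (W x)] {r : ℕ} {𝒪 : SectionPred W}

theorem isPowerSections_symSections (m : ℕ) (𝒪 : SectionPred W) :
    IsPowerSections n (fun _ => SymmetricPower.tprod ℂ) 𝒪 (symSections n m 𝒪) :=
  fun _ _ => Iff.rfl

theorem isPowerSections_extSections (q : ℕ) (𝒪 : SectionPred W) :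
    IsPowerSections n (fun _ => (exteriorPower.ιMulti ℂ q).toMultilinearMap) 𝒪
      (extSections n q 𝒪) :=
  fun _ _ => Iff.rfl

theorem isHolo_detFunctional {O U : Set X} (hO : IsOpen O)
    {b : ∀ x, Module.Basis (Fin r) ℂ (W x)} (hb : IsHoloFrame n 𝒪 O b)
    (hmono : ∀ U V : Set X, V ⊆ U → ∀ s, 𝒪 U s → 𝒪 V s) {t : ∀ x, ⋀[ℂ]^r (W x)}
    (ht : extSections n r 𝒪 U t) : IsHolo n (O ∩ U) fun x => detFunctional (b x) (t x) := by
  refine IsHolo.of_local fun x hx => ?_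
  obtain ⟨U', hU', hU'o, hxU', k, f, s, hf, hs, hts⟩ := ht x hx.2
  refine ⟨U', hU'o, hxU', ?_⟩
  have hsub : U' ∩ (O ∩ U) ⊆ U' ∩ O := fun y hy => ⟨hy.1, hy.2.1⟩
  refine IsHolo.mono (U := U' ∩ O) ?_ hsub
  have h1 : IsHolo n (U' ∩ O) fun x => ∑ j, f j x * ∑ σ : Equiv.Perm (Fin r),
      ((Equiv.Perm.sign σ : ℤ) : ℂ) * ∏ i, (b x).coord (σ i) (s j i x) := by
    refine IsHolo.sum fun j _ => ((hf j).mono inter_subset_left).mul (IsHolo.sum fun σ _ =>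
      (isHolo_const _ _).mul (IsHolo.prod fun i _ => ?_))
    exact hb.coord _ inter_subset_right (hU'o.inter hO) _
      (hmono _ _ inter_subset_left _ (hs j i)) _
  refine h1.congr fun y hy => ?_
  rw [hts y hy.1, map_sum]
  refine Finset.sum_congr rfl fun j _ => ?_
  rw [map_smul, smul_eq_mul, detFunctional_ιMulti, Module.Basis.det_apply, Matrix.det_apply']
  simp only [Module.Basis.toMatrix_apply, Module.Basis.coord_apply]

/-- The dual section of `s` turns the weight `-log |s|²` into the logarithm of a dual norm, with the
same sign, so positivity comes directly from log-plurisubharmonicity on the dual. -/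
theorem hasPositiveCurvatureCurrent_det [IsManifold 𝓘(ℂ, Fin n → ℂ) ω X]
    {h : ∀ x, SesqForm (W x)} (hL : IsLocallyFree n (Fin r) 𝒪)
    (hh : IsSingularHermitianMetric n 𝒪 h) (hpos : IsSemiPositivelyCurved n 𝒪 h) :
    HasPositiveCurvatureCurrent n (extSections n r 𝒪) fun x => extForm r (h x) := by
  intro c hc U hU s hs hs0
  obtain ⟨H, -, hHS, hlog⟩ := exists_isLogPsh_dual hL (isPowerSections_extSections r 𝒪)
    (fun x => isInducedForm_extForm r (h x)) hh hpos
  have hbasis : ∀ x, Nonempty (Module.Basis (Fin r) ℂ (W x)) := fun x => by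
    obtain ⟨_, b, -⟩ := hL.exists_frame x
    exact ⟨b x⟩
  set b₀ : ∀ x, Module.Basis (Fin r) ℂ (W x) := fun x => (hbasis x).some
  -- The functional with value `1` at `s x`; the bases are chosen pointwise, without any regularity
  -- in `x`.
  set ξ : ∀ x, Module.Dual ℂ (⋀[ℂ]^r (W x)) := fun x =>
    (detFunctional (b₀ x) (s x))⁻¹ • detFunctional (b₀ x)
  have hξ : dualSections n (extSections n r 𝒪) U ξ := by
    intro U' hU' hU'o t ht
    refine IsHolo.of_local fun x hx => ?_
    obtain ⟨O, b, hO, hxO, hb⟩ := hL.exists_frame x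
    refine ⟨O, hO, hxO, ?_⟩
    have h1 := isHolo_detFunctional hO hb hL.mono ht
    have h2 := (isHolo_detFunctional hO hb hL.mono hs).mono
      (inter_subset_inter_right O hU')
    refine ((h2.inv fun y hy => detFunctional_ne_zero _ (hs0 y (hU' hy.2))).mul h1).congr
      fun y hy => ?_
    exact detFunctional_div_eq _ _ (hs0 y (hU' hy.2)) _
  -- It remains to identify the weight with the logarithm of the representative, which is needed
  -- only almost everywhere.
  refine (hlog U hU ξ hξ c hc).isPositiveDDbar (isOpen_chartImage c hU) ?_
  have hae := ae_restrict_of_ae_restrict_of_subset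
    (inter_subset_left : chartImage c U ⊆ c.target) ((hHS.and hh.posDef) c hc)
  filter_upwards [hae, ae_restrict_mem (isOpen_chartImage c hU).measurableSet] with z hz hzU
  obtain ⟨hz1, hz2⟩ := hz
  have := hL.finiteDimensional (c.symm z)
  have hS := (isInducedForm_extForm r (h (c.symm z))).isPosDefForm hz2
  have hy := hs0 _ hzU.2
  have hD := detFunctional_ne_zero (b₀ (c.symm z)) hy
  have key := re_dualForm_self_of_line hS (ξ := ξ (c.symm z)) hy fun w => by
    show w = ((detFunctional (b₀ (c.symm z)) (s (c.symm z)))⁻¹ *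
      detFunctional (b₀ (c.symm z)) w) • s (c.symm z)
    conv_rhs => rw [← detFunctional_smul_ιMulti (b₀ (c.symm z)) (s (c.symm z)), smul_smul,
      map_smul, detFunctional_ιMulti, Module.Basis.det_self, smul_eq_mul, mul_one]
    rw [mul_right_comm, inv_mul_cancel₀ hD, one_mul, detFunctional_smul_ιMulti]
  have hz1 : H (c.symm z) = dualForm (extForm r (h (c.symm z))) := hz1
  rw [hz1]
  exact key

end DetLine

end

theorem mainTheorem9 {n : ℕ} {X : Type*} [TopologicalSpace X] [ChartedSpace (Fin n → ℂ) X]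
    [IsManifold 𝓘(ℂ, Fin n → ℂ) ω X]
    {F : Type*} [NormedAddCommGroup F] [NormedSpace ℂ F] [FiniteDimensional ℂ F]
    {E : X → Type*} [TopologicalSpace (TotalSpace F E)] [∀ x, TopologicalSpace (E x)]
    [∀ x, AddCommGroup (E x)] [∀ x, Module ℂ (E x)] [FiberBundle F E] [VectorBundle ℂ F E]
    [ContMDiffVectorBundle ω F E 𝓘(ℂ, Fin n → ℂ)]
    (h : ∀ x, SesqForm (E x))
    (hh : IsSingularHermitianMetric n (holoSections n F E) h)
    (hpos : IsSemiPositivelyCurved n (holoSections n F E) h) :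
    (∀ m : ℕ,
      IsSingularHermitianMetric n (symSections n m (holoSections n F E))
        (fun x => symForm m (h x)) ∧
      IsSemiPositivelyCurved n (symSections n m (holoSections n F E))
        (fun x => symForm m (h x))) ∧
    (∀ q : ℕ,
      IsSingularHermitianMetric n (extSections n q (holoSections n F E))
        (fun x => extForm q (h x)) ∧
      IsSemiPositivelyCurved n (extSections n q (holoSections n F E))
        (fun x => extForm q (h x))) ∧
    HasPositiveCurvatureCurrent n
      (extSections n (Module.finrank ℂ F) (holoSections n F E))
      (fun x => extForm (Module.finrank ℂ F) (h x)) := by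
  have hL := isLocallyFree_holoSections n F E
  exact ⟨fun m => ⟨isSingularHermitianMetric_power hL (isPowerSections_symSections m _)
      (fun x => isInducedForm_symForm m (h x)) hh,
    isSemiPositivelyCurved_power hL (isPowerSections_symSections m _)
      (fun x => isInducedForm_symForm m (h x)) hh hpos⟩,
    fun q => ⟨isSingularHermitianMetric_power hL (isPowerSections_extSections q _)
      (fun x => isInducedForm_extForm q (h x)) hh,
    isSemiPositivelyCurved_power hL (isPowerSections_extSections q _)
      (fun x => isInducedForm_extForm q (h x)) hh hpos⟩,
    hasPositiveCurvatureCurrent_det hL hh hpos⟩
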